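/- Let $f(x,y)=\operatorname{sgn}(x-y)$ (with $\operatorname{sgn} 0=0$), and for a tuple $x=(x_1,\dots,x_n)$ of real numbers put $$U^{\circ}_n(f;x)=\sum_{i\in\mathbb Z/n}\ \sum_{1\le j<n/2} f(x_i,x_{i+j}),\qquad U^{--}_n(f;x)=\sum_{1\le i<j\le n}(-1)^{i+j}f(x_i,x_j),$$ where indices in the first sum are taken modulo $n$. For a permutation $\sigma$ of $\{1,\dots,n\}$, $U^{\circ}_n(f;\sigma)$ is called its writhe (usually only for odd $n$) and $U^{--}_n(f;\sigma)$ its bi-alternating inversion number, with $x_i=\sigma(i)$. Let $f_{12}(x,y)=f(x,y)-f_1(x)-f_2(y)-f_\emptyset$ be the last component of the Hoeffding decomposition of $f$ under the uniform distribution $U(0,1)$, where, for independent $X,Y\sim U(0,1)$, $f_\emptyset=\mathbb E f(X,Y)$, $f_1(x)=\mathbb E f(x,Y)-f_\emptyset$, $f_2(y)=\mathbb E f(X,y)-f_\emptyset$; let $T_{f_{12}}\varphi(x)=\int_0^1 f_{12}(x,y)\varphi(y)\,dy$ on the complex space $L^2([0,1])$. A stochastic-area variable is a real random variable $\eta$ with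 characteristic function $\mathbb E e^{it\eta}=1/\cosh t$, $t\in\mathbb R$ (such a distribution exists). Then: (a) The nonzero eigenvalues of $T_{f_{12}}$ are exactly the numbers $\frac{i}{\pi k}$, $k\in\mathbb Z\setminus\{0\}$, and each of them has multiplicity one. (b) If $X_1,X_2,\dots$ are i.i.d. $U(0,1)$ variables and $\sigma_n$ is a uniformly random permutation of $\{1,\dots,n\}$, then, for every $n$, $U^{\circ}_n(f;X_1,\dots,X_n)\overset{d}{=}U^{\circ}_n(f;\sigma_n)$ and $U^{--}_n(f;X_1,\dots,X_n)\overset{d}{=}U^{--}_n(f;\sigma_n)$. If $n$ is odd, then $U^{\circ}_n(f;\sigma_n)\overset{d}{=}U^{--}_n(f;\sigma_n)$. (c) If $\eta_1,\eta_2,\dots$ are i.i.d. stochastic-area variables, then the series $W=\sum_{k=1}^\infty\frac{1}{\pi k}\eta_k$ converges almost surely and, as $n\to\infty$, $$\frac1n U^{\circ}_n(f;X_1,\dots,X_n)\overset{d}{\longrightarrow}W,\qquad \frac1n U^{\circ}_n(f;\sigma_n)\overset{d}{\longrightarrow}W,\qquad \frac1n U^{--}_n(f;\sigma_n)\overset{d}{\longrightarrow}W.$$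 -/

import Mathlib

open MeasureTheory ProbabilityTheory Filter Topology

noncomputable section

namespace CyclicU

/-! Statistics of a tuple `x = (x₁, …, xₙ)`, indexed here by `Fin n`, that is, shifted by one. -/

/-- The cyclic `U`-statistic `∑_{i ∈ ℤ/n} ∑_{1 ≤ j < n/2} f (x_i, x_{i+j})`. The addition of
`Fin n` is addition modulo `n`. -/
def cyclicU {S : Type*} (f : S → S → ℝ) {n : ℕ} (x : Fin n → S) : ℝ :=
  ∑ i : Fin n, ∑ j : Fin n, if 1 ≤ (j : ℕ) ∧ 2 * (j : ℕ) < n then f (x i) (x (i + j)) else 0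

/-- The bi-alternating `U`-statistic `∑_{1 ≤ i < j ≤ n} (-1)^{i+j} f (x_i, x_j)`. Shifting both
indices by one does not change the sign `(-1)^{i+j}`. -/
def biAlternatingU {S : Type*} (f : S → S → ℝ) {n : ℕ} (x : Fin n → S) : ℝ :=
  ∑ i : Fin n, ∑ j : Fin n, if i < j then (-1 : ℝ) ^ ((i : ℕ) + (j : ℕ)) * f (x i) (x j) else 0

/-- The kernel `f(x, y) = sgn (x - y)`, with `sgn 0 = 0`. -/
def sgnKernel (x y : ℝ) : ℝ := Real.sign (x - y)

/-! Random permutations. -/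

/-- Permutations of an `n`-point set carry the discrete σ-algebra. -/
instance permMeasurableSpace (n : ℕ) : MeasurableSpace (Equiv.Perm (Fin n)) := ⊤

/-- The uniform distribution on the symmetric group of an `n`-point set. -/
def uniformPerm (n : ℕ) : Measure (Equiv.Perm (Fin n)) :=
  (PMF.uniformOfFintype (Equiv.Perm (Fin n))).toMeasure

instance isProbabilityMeasure_uniformPerm (n : ℕ) : IsProbabilityMeasure (uniformPerm n) := by
  unfold uniformPerm; infer_instance

/-- The sequence of values `σ₁, …, σₙ` of a permutation, as real numbers. -/
def permValues {n : ℕ} (σ : Equiv.Perm (Fin n)) (i : Fin n) : ℝ := (((σ i : Fin n) : ℕ) : ℝ) + 1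

/-- The writhe of a permutation (the name is used for odd `n`; the formula makes sense for
every `n`). -/
def writhe {n : ℕ} (σ : Equiv.Perm (Fin n)) : ℝ := cyclicU sgnKernel (permValues σ)

/-- The bi-alternating inversion number of a permutation. -/
def biAlternatingInv {n : ℕ} (σ : Equiv.Perm (Fin n)) : ℝ :=
  biAlternatingU sgnKernel (permValues σ)

/-! Hoeffding's decomposition `f (x, y) = f_∅ + f₁ (x) + f₂ (y) + f₁₂ (x, y)`. -/

section Hoeffding

variable {S : Type*} [MeasurableSpace S]

/-- `f_∅ = 𝔼 f (X₁, X₂)`. -/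
def hoeffdingMean (ν : Measure S) (f : S → S → ℝ) : ℝ := ∫ p : S × S, f p.1 p.2 ∂(ν.prod ν)

/-- `f₁ (x) = 𝔼 f (x, X) - f_∅`. -/
def hoeffdingFst (ν : Measure S) (f : S → S → ℝ) (x : S) : ℝ :=
  ∫ y, f x y ∂ν - hoeffdingMean ν f

/-- `f₂ (y) = 𝔼 f (X, y) - f_∅`. -/
def hoeffdingSnd (ν : Measure S) (f : S → S → ℝ) (y : S) : ℝ :=
  ∫ x, f x y ∂ν - hoeffdingMean ν f

/-- `f₁₂ (x, y) = f (x, y) - f₁ (x) - f₂ (y) - f_∅`. -/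
def hoeffdingTop (ν : Measure S) (f : S → S → ℝ) (x y : S) : ℝ :=
  f x y - hoeffdingFst ν f x - hoeffdingSnd ν f y - hoeffdingMean ν f

end Hoeffding

/-! The integral operator with a square integrable kernel. -/

section IntegralOperator

variable {S : Type*} [MeasurableSpace S] {ν : Measure S} [SFinite ν] {g : S → S → ℂ}

/-- Almost all sections of a square integrable kernel are square integrable. -/
theorem memLp_section (hg : MemLp (Function.uncurry g) 2 (ν.prod ν)) :
    ∀ᵐ x ∂ν, MemLp (g x) 2 ν := by
  have h1 := (memLp_two_iff_integrable_sq_norm hg.1).1 hg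
  filter_upwards [h1.prod_right_ae, hg.1.prodMk_left] with x hx hm
  exact (memLp_two_iff_integrable_sq_norm hm).2 hx

theorem memLp_integral (hg : MemLp (Function.uncurry g) 2 (ν.prod ν)) (φ : Lp ℂ 2 ν) :
    MemLp (fun x ↦ ∫ y, g x y * φ y ∂ν) 2 ν := by
  have hφ := Lp.memLp φ
  have hm : AEStronglyMeasurable (fun p : S × S ↦ g p.1 p.2 * φ p.2) (ν.prod ν) :=
    hg.1.mul (hφ.1.comp_snd)
  have hm' : AEStronglyMeasurable (fun x ↦ ∫ y, g x y * φ y ∂ν) ν := hm.integral_prod_right'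
  refine (memLp_two_iff_integrable_sq_norm hm').2 ?_
  have h1 := (memLp_two_iff_integrable_sq_norm hg.1).1 hg
  have h2 : Integrable (fun x ↦ (∫ y, ‖g x y‖ ^ 2 ∂ν) * ∫ y, ‖φ y‖ ^ 2 ∂ν) ν :=
    (h1.integral_prod_left).mul_const _
  refine h2.mono' (hm'.norm.pow 2) ?_
  filter_upwards [memLp_section hg] with x hx
  rw [Real.norm_of_nonneg (by positivity)]
  have h3 : ‖∫ y, g x y * φ y ∂ν‖ ≤ ∫ y, ‖g x y‖ * ‖φ y‖ ∂ν := by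
    refine (norm_integral_le_integral_norm _).trans (le_of_eq ?_)
    simp only [norm_mul]
  have h4 := integral_mul_le_Lp_mul_Lq_of_nonneg (μ := ν) (p := 2) (q := 2)
    Real.HolderConjugate.two_two (f := fun y ↦ ‖g x y‖) (g := fun y ↦ ‖φ y‖)
    (ae_of_all _ fun _ ↦ norm_nonneg _) (ae_of_all _ fun _ ↦ norm_nonneg _)
    (by simpa using hx.norm) (by simpa using hφ.norm)
  have hA : 0 ≤ ∫ y, ‖g x y‖ ^ 2 ∂ν := integral_nonneg fun _ ↦ by positivity
  have hB : 0 ≤ ∫ y, ‖φ y‖ ^ 2 ∂ν := integral_nonneg fun _ ↦ by positivity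
  simp only [Real.rpow_two, ← Real.sqrt_eq_rpow] at h4
  calc ‖∫ y, g x y * φ y ∂ν‖ ^ 2
      ≤ (√(∫ y, ‖g x y‖ ^ 2 ∂ν) * √(∫ y, ‖φ y‖ ^ 2 ∂ν)) ^ 2 :=
        pow_le_pow_left₀ (norm_nonneg _) (h3.trans h4) 2
    _ = _ := by rw [mul_pow, Real.sq_sqrt hA, Real.sq_sqrt hB]

/-- The integral operator `(T_g φ)(x) = ∫ g (x, y) φ (y) dν(y)` on the complex space `L²(ν)`,
for a kernel `g ∈ L²(ν × ν)`. -/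
def integralOperator (hg : MemLp (Function.uncurry g) 2 (ν.prod ν)) :
    Lp ℂ 2 ν →ₗ[ℂ] Lp ℂ 2 ν where
  toFun φ := (memLp_integral hg φ).toLp
  map_add' φ ψ := by
    rw [← MemLp.toLp_add, MemLp.toLp_eq_toLp_iff]
    filter_upwards [memLp_section hg] with x hx
    have h : ∫ y, g x y * (φ + ψ : Lp ℂ 2 ν) y ∂ν = ∫ y, (g x y * φ y + g x y * ψ y) ∂ν := by
      refine integral_congr_ae ?_
      filter_upwards [Lp.coeFn_add φ ψ] with y hy
      rw [hy, Pi.add_apply, mul_add]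
    rw [h]
    exact integral_add (hx.integrable_mul (Lp.memLp φ)) (hx.integrable_mul (Lp.memLp ψ))
  map_smul' c φ := by
    rw [RingHom.id_apply, ← MemLp.toLp_const_smul, MemLp.toLp_eq_toLp_iff]
    filter_upwards with x
    have h : ∫ y, g x y * (c • φ : Lp ℂ 2 ν) y ∂ν = ∫ y, c * (g x y * φ y) ∂ν := by
      refine integral_congr_ae ?_
      filter_upwards [Lp.coeFn_smul c φ] with y hy
      rw [hy, Pi.smul_apply, smul_eq_mul]
      ring
    rw [h, integral_const_mul]
    rfl

end IntegralOperator

/-! The writhe kernel. -/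

/-- The uniform distribution `U(0,1)`, as a measure on `ℝ`. -/
def unif : Measure ℝ := volume.restrict (Set.Icc 0 1)

instance isProbabilityMeasure_unif : IsProbabilityMeasure unif :=
  ⟨by simp [unif]⟩

/-- The component `f₁₂` of the kernel `sgn (x - y)` under `U(0,1)`, regarded as complex valued. -/
def writheKernel (x y : ℝ) : ℂ := (hoeffdingTop unif sgnKernel x y : ℂ)

theorem measurable_sgnKernel : Measurable (Function.uncurry sgnKernel) := by
  have h : Measurable Real.sign := by
    unfold Real.sign
    exact Measurable.ite measurableSet_Iio measurable_const
      (Measurable.ite measurableSet_Ioi measurable_const measurable_const)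
  exact h.comp (measurable_fst.sub measurable_snd)

theorem abs_sgnKernel_le (x y : ℝ) : ‖sgnKernel x y‖ ≤ 1 := by
  unfold sgnKernel
  rcases Real.sign_apply_eq (x - y) with h | h | h <;> simp [h]

theorem memLp_writheKernel : MemLp (Function.uncurry writheKernel) 2 (unif.prod unif) := by
  have hm := measurable_sgnKernel
  have h1 : StronglyMeasurable fun x : ℝ ↦ ∫ y, sgnKernel x y ∂unif :=
    hm.stronglyMeasurable.integral_prod_right'
  have h2 : StronglyMeasurable fun y : ℝ ↦ ∫ x, sgnKernel x y ∂unif :=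
    hm.stronglyMeasurable.integral_prod_left'
  have hk : Measurable (Function.uncurry writheKernel) := by
    refine Complex.measurable_ofReal.comp (g := Complex.ofReal)
      (f := fun p : ℝ × ℝ ↦ hoeffdingTop unif sgnKernel p.1 p.2) ?_
    exact ((hm.sub ((h1.measurable.comp measurable_fst).sub_const _)).sub
      ((h2.measurable.comp measurable_snd).sub_const _)).sub_const _
  refine MemLp.of_bound hk.aestronglyMeasurable 6 (ae_of_all _ fun p ↦ ?_)
  have b (h : ℝ → ℝ) (hh : ∀ y, ‖h y‖ ≤ 1) : |∫ y, h y ∂unif| ≤ 1 := by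
    have := norm_integral_le_of_norm_le_const (μ := unif) (ae_of_all _ hh)
    simpa using this
  have b0 : |hoeffdingMean unif sgnKernel| ≤ 1 := by
    have := norm_integral_le_of_norm_le_const (μ := unif.prod unif)
      (ae_of_all _ fun p : ℝ × ℝ ↦ abs_sgnKernel_le p.1 p.2)
    simpa [hoeffdingMean] using this
  have b1 := b (fun y ↦ sgnKernel p.1 y) fun y ↦ abs_sgnKernel_le _ _
  have b2 := b (fun x ↦ sgnKernel x p.2) fun x ↦ abs_sgnKernel_le _ _
  have b3 := abs_sgnKernel_le p.1 p.2
  simp only [Function.uncurry, writheKernel, Complex.norm_real, Real.norm_eq_abs, hoeffdingTop,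
    hoeffdingFst, hoeffdingSnd] at *
  rw [abs_le] at *
  constructor <;> linarith [b0.1, b0.2, b1.1, b1.2, b2.1, b2.2, b3.1, b3.2]

/-- The operator `T_{f₁₂}` on the complex space `L²([0,1])`, for `f (x, y) = sgn (x - y)`. -/
def writheOperator : Module.End ℂ (Lp ℂ 2 unif) := integralOperator memLp_writheKernel

/-! The stochastic area. -/

/-- A law on `ℝ` is the stochastic area distribution if its characteristic function is
`t ↦ 1 / cosh t`. -/
def IsStochasticAreaLaw (γ : Measure ℝ) : Prop :=
  ∀ t : ℝ, charFun γ t = ((1 / Real.cosh t : ℝ) : ℂ)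

end CyclicU

end

/-! Spectrum. For the sign kernel, `f₁₂ (x, y) = sgn (x - y) - 2 (x - y)` on the unit square. Its
operator is twice a primitive plus an affine function of `x`, so an eigenfunction for `z ≠ 0`
satisfies `φ' = (2 / z) (φ - ∫ φ)` together with `φ 0 = φ 1`. The solutions have mean zero and are
the multiples of `exp (2 x / z)` with `exp (2 / z) = 1` (`eq_exp_of_writheOperator_eq`,
`writheOperator_exp`).

Equalities in law. Both statistics depend only on the relative order of the variables, and the ranks
of i.i.d. uniform variables form a uniform permutation (`map_pi_eq_map_uniformPerm`). For odd `n`,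
doubling is a bijection of `ℤ/n` that carries the shifts `1 ≤ j < n/2` to the nonzero even residues.
For an antisymmetric kernel this turns the cyclic statistic into the bi-alternating one
(`cyclicU_double`).

Limit theorem. All limits are proved with characteristic functions. Cyclic sums kill cocycles `h x -
h y`, so `sgn (x - y)` may be replaced by the odd periodic sawtooth `s (x - y)`, which is completely
degenerate. Folded onto pairs `i < j`, the statistic is `∑ q ((j - i) / n) s (x_i - x_j)`, with `q`
the square wave. Cutting both `q` and `s` to partial Fourier sums costs, after division by `n`, a
small `L¹` error uniformly in large `n`: degenerate kernels are orthogonal over distinct pairs, and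
the Fourier tails vanish in mean square (`integral_abs_sub_truncU_le`).

The truncated statistic is a finite combination of terms `sin (u_i - u_j) sin (v_j - v_i)`. It
diagonalizes as a difference of squared moduli of the exponential sums with phases `u + v` and `u -
v` (`truncU_eq_sum_sq`). The normalized cosine and sine sums converge jointly to independent
standard Gaussians (`tendsto_charFun_waveSum`). Hence the truncated statistic has a limiting
characteristic function that is a product of factors `1 / (1 + 4 a²)`. The product over the time
frequencies is `1 / cosh (t / (π k))`, by the product formula for `cosh` (`tendsto_prod_cosh`). The
remaining product over `k` is the characteristic function of `W`, whose series converges by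
martingale convergence (`exists_area_series`).

For the bi-alternating statistic, odd `n` follows from the equality in law, and even `n` by deleting
the last variable, which changes the normalized statistic by `O (n ^ (-1/2))` in `L¹`
(`norm_charFun_biAlternatingU_sub_le`). -/

namespace CyclicU

/-! ### Combinatorics of the cyclic and bi-alternating sums. -/

/-- A double sum over all ordered pairs, folded onto the pairs `i < j` when the diagonal
vanishes. -/
theorem sum_sum_eq_sum_lt {n : ℕ} (G : Fin n → Fin n → ℝ) (h : ∀ i, G i i = 0) :
    ∑ i, ∑ j, G i j = ∑ i, ∑ j, if i < j then G i j + G j i else 0 := by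
  have h1 : ∀ i j, G i j = (if i < j then G i j else 0) + (if j < i then G i j else 0) := by
    intro i j
    rcases lt_trichotomy i j with hij | hij | hij
    · simp [hij, hij.not_gt]
    · subst hij; simp [h]
    · simp [hij, hij.not_gt]
  have h2 : ∑ i, ∑ j, (if j < i then G i j else 0) = ∑ i, ∑ j, if i < j then G j i else 0 :=
    Finset.sum_comm
  calc ∑ i, ∑ j, G i j
      = ∑ i, ∑ j, ((if i < j then G i j else 0) + (if j < i then G i j else 0)) :=
        Finset.sum_congr rfl fun i _ ↦ Finset.sum_congr rfl fun j _ ↦ h1 i j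
    _ = _ := by
      simp only [Finset.sum_add_distrib]
      rw [h2]
      simp only [← Finset.sum_add_distrib]
      refine Finset.sum_congr rfl fun i _ ↦ Finset.sum_congr rfl fun j _ ↦ ?_
      split_ifs <;> simp

theorem sum_fin_add_left {n : ℕ} (i : Fin n) (G : Fin n → ℝ) : ∑ j, G (i + j) = ∑ j, G j := by
  have : NeZero n := ⟨by have := i.2; omega⟩
  exact Equiv.sum_comp (Equiv.addLeft i) G

theorem sum_fin_add_right {n : ℕ} (i : Fin n) (G : Fin n → ℝ) : ∑ j, G (j + i) = ∑ j, G j := by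
  have : NeZero n := ⟨by have := i.2; omega⟩
  exact Equiv.sum_comp (Equiv.addRight i) G

theorem fin_add_sub_cancel {n : ℕ} (i j : Fin n) : i + j - i = j := by
  have : NeZero n := ⟨by have := i.2; omega⟩
  exact add_sub_cancel_left i j

theorem cyclicU_eq_sum_sub {S : Type*} (f : S → S → ℝ) {n : ℕ} (x : Fin n → S) :
    cyclicU f x = ∑ i : Fin n, ∑ j : Fin n,
      if 1 ≤ ((j - i : Fin n) : ℕ) ∧ 2 * ((j - i : Fin n) : ℕ) < n then f (x i) (x j) else 0 := by
  unfold cyclicU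
  refine Finset.sum_congr rfl fun i _ ↦ ?_
  refine Eq.trans (Finset.sum_congr rfl fun j _ ↦ ?_) (sum_fin_add_left i fun j ↦
    if 1 ≤ ((j - i : Fin n) : ℕ) ∧ 2 * ((j - i : Fin n) : ℕ) < n then f (x i) (x j) else 0)
  rw [fin_add_sub_cancel]

theorem val_sub_of_lt {n : ℕ} {i j : Fin n} (h : i < j) :
    ((j - i : Fin n) : ℕ) = (j : ℕ) - i ∧ ((i - j : Fin n) : ℕ) = n - ((j : ℕ) - i) := by
  have h' : (i : ℕ) < j := h
  have := j.2
  constructor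
  · rw [Fin.sub_def]
    simp only
    rw [show n - (i : ℕ) + j = (j - i) + n by omega, Nat.add_mod_right, Nat.mod_eq_of_lt]
    omega
  · rw [Fin.sub_def]
    simp only
    rw [Nat.mod_eq_of_lt] <;> omega

/-- For an antisymmetric kernel, `cyclicU` is a sum over pairs `i < j` with the sign of
`1 - 2 (j - i) / n` as coefficient. -/
theorem cyclicU_eq_sum_lt {S : Type*} {f : S → S → ℝ} (hf : ∀ x y, f x y = -f y x) {n : ℕ}
    (x : Fin n → S) :
    cyclicU f x = ∑ i : Fin n, ∑ j : Fin n, if i < j then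
      Real.sign (1 - 2 * (((j : ℕ) - (i : ℕ) : ℝ) / n)) * f (x i) (x j) else 0 := by
  rw [cyclicU_eq_sum_sub, sum_sum_eq_sum_lt]
  · refine Finset.sum_congr rfl fun i _ ↦ Finset.sum_congr rfl fun j _ ↦ ?_
    by_cases hij : i < j
    · rw [if_pos hij, if_pos hij]
      have hn : (0 : ℝ) < n := by have := i.2; exact_mod_cast (by omega : 0 < n)
      rw [(val_sub_of_lt hij).1, (val_sub_of_lt hij).2, hf (x j) (x i)]
      have hij' : (i : ℕ) < j := hij
      have hjn := j.2
      obtain ⟨d, hd⟩ : ∃ d : ℕ, (j : ℕ) = i + d := ⟨j - i, by omega⟩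
      have e1 : ((j : ℕ) - (i : ℕ) : ℝ) = d := by rw [hd]; push_cast; ring
      rw [e1, show (j : ℕ) - i = d by omega]
      have e2 : 1 - 2 * ((d : ℝ) / n) = (n - 2 * d) / n := by field_simp
      rw [e2]
      -- The two cyclic shifts joining the pair are `d` and `n - d`. The shorter one is counted, and
      -- it runs from `j` to `i` when `2 d > n`, whence the minus sign. An antipodal pair `2 d = n`
      -- is not counted at all, which matches `sign 0 = 0`.
      rcases lt_trichotomy (2 * d) n with h | h | h
      · have h' : (2 : ℝ) * d < n := by exact_mod_cast h
        rw [Real.sign_of_pos (div_pos (by linarith) hn), if_pos (by omega), if_neg (by omega)]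
        ring
      · have h' : (2 : ℝ) * d = n := by exact_mod_cast h
        rw [h', sub_self, zero_div, Real.sign_zero, if_neg (by omega), if_neg (by omega)]
        ring
      · have h' : (n : ℝ) < 2 * d := by exact_mod_cast h
        rw [Real.sign_of_neg (div_neg_of_neg_of_pos (by linarith) hn), if_neg (by omega),
          if_pos (by omega)]
        ring
    · rw [if_neg hij, if_neg hij]
  · intro i
    have h0 : f (x i) (x i) = 0 := by have := hf (x i) (x i); linarith
    simp [h0]

/-- Kernels `h x - h y` do not contribute to `cyclicU`. -/
theorem cyclicU_add_sub {S : Type*} (f : S → S → ℝ) (h : S → ℝ) {n : ℕ} (x : Fin n → S) :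
    cyclicU (fun a b ↦ f a b + (h a - h b)) x = cyclicU f x := by
  have key : ∑ i : Fin n, ∑ j : Fin n, (if 1 ≤ (j : ℕ) ∧ 2 * (j : ℕ) < n then
      h (x i) - h (x (i + j)) else 0) = 0 := by
    -- For a fixed shift `j`, both `x_i` and `x_{i+j}` run through the whole cycle as `i` does, so
    -- the difference of the sums vanishes.
    rw [Finset.sum_comm]
    refine Finset.sum_eq_zero fun j _ ↦ ?_
    split_ifs
    · rw [Finset.sum_sub_distrib, sum_fin_add_right j fun k ↦ h (x k), sub_self]
    · simp
  unfold cyclicU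
  rw [← add_zero (∑ i : Fin n, ∑ j : Fin n, ite _ (f _ _) _), ← key, ← Finset.sum_add_distrib]
  refine Finset.sum_congr rfl fun i _ ↦ ?_
  rw [← Finset.sum_add_distrib]
  refine Finset.sum_congr rfl fun j _ ↦ ?_
  split_ifs <;> simp

theorem sgnKernel_antisymm (x y : ℝ) : sgnKernel x y = -sgnKernel y x := by
  unfold sgnKernel
  rw [← Real.sign_neg, neg_sub]

/-- Doubling is a permutation of `ℤ/n` for odd `n`. -/
theorem bijective_double {n : ℕ} (hn : Odd n) : Function.Bijective fun i : Fin n ↦ i + i := by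
  refine (Finite.injective_iff_bijective).1 fun i j hij ↦ ?_
  have h := congrArg Fin.val hij
  simp only [Fin.val_add] at h
  obtain ⟨m, rfl⟩ := hn
  ext
  have := i.2
  have := j.2
  rcases lt_or_ge ((i : ℕ) + i) (2 * m + 1) with h1 | h1 <;>
  rcases lt_or_ge ((j : ℕ) + j) (2 * m + 1) with h2 | h2
  · rw [Nat.mod_eq_of_lt h1, Nat.mod_eq_of_lt h2] at h; omega
  · rw [Nat.mod_eq_of_lt h1, Nat.mod_eq_sub_mod h2, Nat.mod_eq_of_lt (by omega)] at h; omega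
  · rw [Nat.mod_eq_of_lt h2, Nat.mod_eq_sub_mod h1, Nat.mod_eq_of_lt (by omega)] at h; omega
  · rw [Nat.mod_eq_sub_mod h1, Nat.mod_eq_of_lt (by omega : (i : ℕ) + i - (2 * m + 1) < 2 * m + 1),
      Nat.mod_eq_sub_mod h2, Nat.mod_eq_of_lt (by omega)] at h
    omega

/-- For odd `n` and an antisymmetric kernel, the bi-alternating statistic is the cyclic statistic
of the sequence re-indexed by doubling. -/
theorem cyclicU_double {S : Type*} {f : S → S → ℝ} (hf : ∀ x y, f x y = -f y x) {n : ℕ}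
    (hn : Odd n) (x : Fin n → S) :
    cyclicU f (fun i ↦ x (i + i)) = biAlternatingU f x := by
  have : NeZero n := ⟨by rintro rfl; simp at hn⟩
  have hb := bijective_double hn
  -- Doubling turns the shift `j` into `2 j` modulo `n`. Since `n` is odd, this residue is even
  -- exactly when there is no wrap-around, that is when `2 j < n`.
  have e1 : cyclicU f (fun i ↦ x (i + i)) = ∑ i : Fin n, ∑ j : Fin n,
      if 1 ≤ ((j - i : Fin n) : ℕ) ∧ Even ((j - i : Fin n) : ℕ) then f (x i) (x j) else 0 := by
    unfold cyclicU
    let e := Equiv.ofBijective _ hb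
    refine Eq.trans (Finset.sum_congr rfl fun i _ ↦ ?_) (Equiv.sum_comp e fun i ↦ ∑ j : Fin n,
      if 1 ≤ ((j - i : Fin n) : ℕ) ∧ Even ((j - i : Fin n) : ℕ) then f (x i) (x j) else 0)
    simp only [e, Equiv.ofBijective_apply]
    refine Eq.trans ?_ ((Equiv.sum_comp e fun j ↦ if 1 ≤ ((i + i + j - (i + i) : Fin n) : ℕ) ∧
      Even ((i + i + j - (i + i) : Fin n) : ℕ) then f (x (i + i)) (x (i + i + j)) else 0).trans
      (sum_fin_add_left (i + i) fun j ↦ if 1 ≤ ((j - (i + i) : Fin n) : ℕ) ∧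
      Even ((j - (i + i) : Fin n) : ℕ) then f (x (i + i)) (x j) else 0))
    refine (Finset.sum_congr rfl fun j _ ↦ ?_)
    simp only [e, Equiv.ofBijective_apply, fin_add_sub_cancel]
    rw [show i + j + (i + j) = i + i + (j + j) by abel]
    refine if_congr ?_ rfl rfl
    rw [Fin.val_add]
    obtain ⟨m, hm⟩ := hn
    have := j.2
    rcases lt_or_ge ((j : ℕ) + j) n with h1 | h1
    · rw [Nat.mod_eq_of_lt h1, Nat.even_iff]; omega
    · rw [Nat.mod_eq_sub_mod h1, Nat.mod_eq_of_lt (by omega), Nat.even_iff]; omega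
  rw [e1, sum_sum_eq_sum_lt]
  · unfold biAlternatingU
    refine Finset.sum_congr rfl fun i _ ↦ Finset.sum_congr rfl fun j _ ↦ ?_
    by_cases hij : i < j
    · rw [if_pos hij, if_pos hij]
      rw [(val_sub_of_lt hij).1, (val_sub_of_lt hij).2, hf (x j) (x i)]
      have hij' : (i : ℕ) < j := hij
      have hjn := j.2
      obtain ⟨d, hd⟩ : ∃ d : ℕ, (j : ℕ) = i + d := ⟨j - i, by omega⟩
      have e2 : (-1 : ℝ) ^ ((i : ℕ) + j) = (-1) ^ d := by
        rw [hd, ← add_assoc, pow_add, ← two_mul, pow_mul]; simp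
      rw [e2, show (j : ℕ) - i = d by omega]
      obtain ⟨m, hm⟩ := hn
      -- As `n` is odd, `d` and `n - d` have opposite parity, so exactly one orientation of the pair
      -- is counted: `i → j` for even `d`, `j → i` for odd `d`. Antisymmetry turns this into the
      -- sign `(-1) ^ d`.
      rcases Nat.even_or_odd d with h | h
      · rw [h.neg_one_pow, if_pos ⟨by omega, h⟩, if_neg]
        · ring
        · rintro ⟨-, h2⟩; rw [Nat.even_iff] at h h2; omega
      · rw [h.neg_one_pow, if_neg, if_pos]
        · ring
        · rw [Nat.even_iff]; rw [Nat.odd_iff] at h; omega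
        · rintro ⟨-, h2⟩; exact (Nat.not_even_iff_odd.2 h) h2
    · rw [if_neg hij, if_neg hij]
  · intro i
    simp


/-! ### I.i.d. uniform variables and uniform random permutations. -/

section Product

variable {α : Type*} [MeasurableSpace α] (ν : Measure α) [IsProbabilityMeasure ν]

theorem map_eval_pi {ι : Type*} [Fintype ι] (i : ι) :
    (Measure.pi fun _ : ι ↦ ν).map (fun x ↦ x i) = ν :=
  (measurePreserving_eval (fun _ : ι ↦ ν) i).map_eq

theorem map_pair_pi {ι : Type*} [Fintype ι] {i j : ι} (hij : i ≠ j) :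
    (Measure.pi fun _ : ι ↦ ν).map (fun x ↦ (x i, x j)) = ν.prod ν := by
  have h : iIndepFun (fun (i : ι) (x : ι → α) ↦ x i) (Measure.pi fun _ : ι ↦ ν) :=
    iIndepFun_pi (X := fun _ (a : α) ↦ a) (fun _ ↦ aemeasurable_id)
  have h2 := (indepFun_iff_map_prod_eq_prod_map_map (measurable_pi_apply i).aemeasurable
    (measurable_pi_apply j).aemeasurable).1 (h.indepFun hij)
  rw [h2, map_eval_pi, map_eval_pi]

theorem measurePreserving_comp_perm {ι : Type*} [Fintype ι] (τ : Equiv.Perm ι) :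
    MeasurePreserving (fun x : ι → α ↦ x ∘ τ) (Measure.pi fun _ : ι ↦ ν)
      (Measure.pi fun _ : ι ↦ ν) := by
  have h := measurePreserving_piCongrLeft (fun _ : ι ↦ ν) τ⁻¹
  convert h using 1
  ext x i
  have : (MeasurableEquiv.piCongrLeft (fun _ : ι ↦ α) τ⁻¹) x (τ⁻¹ (τ i)) = x (τ i) :=
    Equiv.piCongrLeft_apply_apply (fun _ : ι ↦ α) τ⁻¹ x (τ i)
  simpa using this.symm

theorem ae_injective_pi [NullSingletonClass ν] [MeasurableEq α] {ι : Type*} [Fintype ι] :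
    ∀ᵐ x ∂(Measure.pi fun _ : ι ↦ ν), Function.Injective x := by
  have h : ∀ i j : ι, i ≠ j → ∀ᵐ x ∂(Measure.pi fun _ : ι ↦ ν), x i ≠ x j := by
    intro i j hij
    have hd : (ν.prod ν) (Set.diagonal α) = 0 := by
      rw [Measure.measure_prod_null measurableSet_diagonal]
      filter_upwards with x
      have : Prod.mk x ⁻¹' Set.diagonal α = {x} := by ext y; simp [eq_comm]
      rw [this]; simp
    rw [← map_pair_pi ν hij, Measure.map_apply (by fun_prop) measurableSet_diagonal] at hd
    exact measure_eq_zero_iff_ae_notMem.1 hd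
  have h' := ae_all_iff.2 fun i ↦ ae_all_iff.2 fun j ↦ eventually_imp_distrib_left.2 (h i j)
  filter_upwards [h'] with x hx i j hij
  by_contra hne
  exact hx i j hne hij

end Product

theorem map_iid_eq_pi {α : Type*} [MeasurableSpace α] (ν : Measure α) {Ω : Type*}
    [MeasurableSpace Ω] {P : Measure Ω} [IsProbabilityMeasure P]
    {X : ℕ → Ω → α} (hX : ∀ i, HasLaw (X i) ν P) (hi : iIndepFun X P) (n : ℕ) :
    P.map (fun ω (i : Fin n) ↦ X i ω) = Measure.pi fun _ : Fin n ↦ ν := by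
  have h : iIndepFun (fun i : Fin n ↦ X i) P := hi.precomp Fin.val_injective
  rw [(iIndepFun_iff_map_fun_eq_pi_map fun i : Fin n ↦ (hX i).aemeasurable).1 h]
  congr 1
  ext1 i
  exact (hX i).map_eq

instance nullSingletonClass_unif : NullSingletonClass unif := by unfold unif; infer_instance

/-- The inverse of the sorting permutation gives the ranks. -/
theorem exists_rank {n : ℕ} {x : Fin n → ℝ} (hx : Function.Injective x) :
    ∃ ρ : Equiv.Perm (Fin n), ∀ i j, x i < x j ↔ ρ i < ρ j := by
  have hs : StrictMono (x ∘ Tuple.sort x) :=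
    (Tuple.monotone_sort x).strictMono_of_injective (hx.comp (Tuple.sort x).injective)
  refine ⟨(Tuple.sort x)⁻¹, fun i j ↦ ?_⟩
  have := hs.lt_iff_lt (a := (Tuple.sort x)⁻¹ i) (b := (Tuple.sort x)⁻¹ j)
  simpa using this

theorem sgnKernel_congr {a b c d : ℝ} (h1 : a < b ↔ c < d) (h2 : b < a ↔ d < c) :
    sgnKernel a b = sgnKernel c d := by
  unfold sgnKernel
  rcases lt_trichotomy a b with h | h | h
  · rw [Real.sign_of_neg (by linarith), Real.sign_of_neg (by linarith [h1.1 h])]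
  · have e : c = d := by
      refine le_antisymm (not_lt.1 fun h' ↦ ?_) (not_lt.1 fun h' ↦ ?_)
      · exact (h2.2 h').ne h.symm
      · exact (h1.2 h').ne h
    rw [h, e, sub_self, sub_self]
  · rw [Real.sign_of_pos (by linarith), Real.sign_of_pos (by linarith [h2.1 h])]

theorem permValues_lt {n : ℕ} (σ : Equiv.Perm (Fin n)) (i j : Fin n) :
    permValues σ i < permValues σ j ↔ σ i < σ j := by
  simp [permValues]

theorem uniformPerm_apply {n : ℕ} (A : Set (Equiv.Perm (Fin n))) [DecidablePred (· ∈ A)] :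
    uniformPerm n A = (n.factorial : ENNReal)⁻¹ * ∑ τ : Equiv.Perm (Fin n), if τ ∈ A then 1 else 0 := by
  have h : MeasurableSet A := trivial
  rw [uniformPerm, PMF.toMeasure_uniformOfFintype_apply A h, Fintype.card_perm, Fintype.card_fin,
    Finset.sum_boole, ENNReal.div_eq_inv_mul, Fintype.card_subtype]

/-- A statistic of i.i.d. uniform variables that depends only on the signs of their differences
has the law of the same statistic of a uniform permutation. -/
theorem map_pi_eq_map_uniformPerm {n : ℕ} {T : (Fin n → ℝ) → ℝ} (hT : Measurable T)
    (hT' : ∀ x y, (∀ i j, sgnKernel (x i) (x j) = sgnKernel (y i) (y j)) → T x = T y) :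
    (Measure.pi fun _ : Fin n ↦ unif).map T = (uniformPerm n).map fun σ ↦ T (permValues σ) := by
  classical
  ext A hA
  have hmeas : Measurable fun σ : Equiv.Perm (Fin n) ↦ T (permValues σ) := fun _ _ ↦ trivial
  rw [Measure.map_apply hT hA, Measure.map_apply hmeas hA, uniformPerm_apply]
  set μ := Measure.pi fun _ : Fin n ↦ unif
  -- The product measure is exchangeable, so `n! · μ (T ⁻¹' A)` is the mean number of permutations
  -- `τ` with `T (x ∘ τ) ∈ A`. That number is almost surely constant, as shown in `hconst`.
  have hinv : ∀ τ : Equiv.Perm (Fin n), ∫⁻ x, (T ⁻¹' A).indicator 1 (x ∘ τ) ∂μ = μ (T ⁻¹' A) := by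
    intro τ
    rw [(measurePreserving_comp_perm unif τ).lintegral_comp
      (f := (T ⁻¹' A).indicator 1) (measurable_one.indicator (hT hA)),
      lintegral_indicator_one (hT hA)]
  have hsum : ∫⁻ x, ∑ τ : Equiv.Perm (Fin n), (T ⁻¹' A).indicator 1 (x ∘ τ) ∂μ
      = n.factorial * μ (T ⁻¹' A) := by
    rw [lintegral_finsetSum]
    · simp only [hinv, Finset.sum_const, Finset.card_univ, Fintype.card_perm, Fintype.card_fin,
        nsmul_eq_mul]
    · intro τ _
      exact (measurable_one.indicator (hT hA)).comp (measurePreserving_comp_perm unif τ).measurable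
  have hconst : ∫⁻ x, ∑ τ : Equiv.Perm (Fin n), (T ⁻¹' A).indicator (1 : (Fin n → ℝ) → ENNReal)
      (x ∘ τ) ∂μ = ∑ τ : Equiv.Perm (Fin n), if T (permValues τ) ∈ A then 1 else 0 := by
    rw [lintegral_congr_ae (g := fun _ ↦ ∑ τ : Equiv.Perm (Fin n),
      if T (permValues τ) ∈ A then 1 else 0)]
    · simp [μ]
    · filter_upwards [ae_injective_pi unif (ι := Fin n)] with x hx
      obtain ⟨ρ, hρ⟩ := exists_rank hx
      -- If `ρ` is the rank permutation of `x`, then `x ∘ τ` is ordered like `ρ * τ`. As `τ` runs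
      -- through the group so does `ρ * τ`, and the count no longer depends on `x`.
      refine Eq.trans (Finset.sum_congr rfl fun τ _ ↦ ?_) (Equiv.sum_comp (Equiv.mulLeft ρ)
        fun τ ↦ if T (permValues τ) ∈ A then 1 else 0)
      have e : T (x ∘ τ) = T (permValues (ρ * τ)) := by
        refine hT' _ _ fun i j ↦ sgnKernel_congr ?_ ?_ <;>
        · rw [permValues_lt]; exact hρ _ _
      simp only [Set.indicator_apply, Set.mem_preimage, e, Pi.one_apply, Equiv.coe_mulLeft]
      congr
  have hf : (n.factorial : ENNReal) ≠ 0 := by exact_mod_cast n.factorial_ne_zero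
  change μ (T ⁻¹' A) = (n.factorial : ENNReal)⁻¹ * ∑ τ : Equiv.Perm (Fin n),
    if T (permValues τ) ∈ A then 1 else 0
  rw [← hconst, hsum, ← mul_assoc, ENNReal.inv_mul_cancel hf (ENNReal.natCast_ne_top _), one_mul]

theorem measurable_cyclicU {f : ℝ → ℝ → ℝ} (hf : Measurable (Function.uncurry f)) (n : ℕ) :
    Measurable fun x : Fin n → ℝ ↦ cyclicU f x := by
  unfold cyclicU
  refine Finset.measurable_sum _ fun i _ ↦ Finset.measurable_sum _ fun j _ ↦ ?_
  split_ifs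
  · exact hf.comp (show Measurable fun x : Fin n → ℝ ↦ (x i, x (i + j)) by fun_prop)
  · exact measurable_const

theorem measurable_biAlternatingU {f : ℝ → ℝ → ℝ} (hf : Measurable (Function.uncurry f)) (n : ℕ) :
    Measurable fun x : Fin n → ℝ ↦ biAlternatingU f x := by
  unfold biAlternatingU
  refine Finset.measurable_sum _ fun i _ ↦ Finset.measurable_sum _ fun j _ ↦ ?_
  split_ifs
  · exact (hf.comp (show Measurable fun x : Fin n → ℝ ↦ (x i, x j) by fun_prop)).const_mul _
  · exact measurable_const

theorem map_cyclicU (n : ℕ) : (Measure.pi fun _ : Fin n ↦ unif).map (cyclicU sgnKernel) =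
    (uniformPerm n).map (writhe (n := n)) := by
  refine map_pi_eq_map_uniformPerm (measurable_cyclicU measurable_sgnKernel n) fun x y h ↦ ?_
  simp only [cyclicU, h]

theorem map_biAlternatingU (n : ℕ) :
    (Measure.pi fun _ : Fin n ↦ unif).map (biAlternatingU sgnKernel) =
      (uniformPerm n).map (biAlternatingInv (n := n)) := by
  refine map_pi_eq_map_uniformPerm (measurable_biAlternatingU measurable_sgnKernel n)
    fun x y h ↦ ?_
  simp only [biAlternatingU, h]

theorem measurable_perm {n : ℕ} (T : Equiv.Perm (Fin n) → ℝ) : Measurable T := fun _ _ ↦ trivial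

theorem aemeasurable_iid {Ω : Type*} [MeasurableSpace Ω] {P : Measure Ω} {X : ℕ → Ω → ℝ}
    (hX : ∀ i, HasLaw (X i) unif P) (n : ℕ) : AEMeasurable (fun ω (i : Fin n) ↦ X i ω) P :=
  aemeasurable_pi_lambda _ fun i ↦ (hX i).aemeasurable

theorem identDistrib_iid {Ω : Type*} [MeasurableSpace Ω] {P : Measure Ω} [IsProbabilityMeasure P]
    {X : ℕ → Ω → ℝ} (hX : ∀ i, HasLaw (X i) unif P) (hi : iIndepFun X P) (n : ℕ) :
    IdentDistrib (fun ω ↦ cyclicU sgnKernel fun i : Fin n ↦ X i ω)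
      (writhe (n := n)) P (uniformPerm n) ∧
    IdentDistrib (fun ω ↦ biAlternatingU sgnKernel fun i : Fin n ↦ X i ω)
      (biAlternatingInv (n := n)) P (uniformPerm n) := by
  have hm := aemeasurable_iid hX n
  have h1 := measurable_cyclicU measurable_sgnKernel n
  have h2 := measurable_biAlternatingU measurable_sgnKernel n
  refine ⟨⟨h1.comp_aemeasurable hm, (measurable_perm _).aemeasurable, ?_⟩,
    ⟨h2.comp_aemeasurable hm, (measurable_perm _).aemeasurable, ?_⟩⟩
  · rw [← map_cyclicU, ← map_iid_eq_pi unif hX hi, AEMeasurable.map_map_of_aemeasurable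
      h1.aemeasurable hm]
    rfl
  · rw [← map_biAlternatingU, ← map_iid_eq_pi unif hX hi, AEMeasurable.map_map_of_aemeasurable
      h2.aemeasurable hm]
    rfl

/-- The comparison passes through i.i.d. variables: re-indexing by doubling preserves the product
measure, and by `cyclicU_double` it carries one statistic to the other. -/
theorem identDistrib_writhe_biAlternatingInv {n : ℕ} (hn : Odd n) :
    IdentDistrib (writhe (n := n)) (biAlternatingInv (n := n)) (uniformPerm n) (uniformPerm n) := by
  refine ⟨(measurable_perm _).aemeasurable, (measurable_perm _).aemeasurable, ?_⟩
  let e : Equiv.Perm (Fin n) := Equiv.ofBijective _ (bijective_double hn)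
  have h := (measurePreserving_comp_perm unif e).map_eq
  rw [← map_cyclicU, ← map_biAlternatingU]
  conv_lhs => rw [← h]
  rw [Measure.map_map (measurable_cyclicU measurable_sgnKernel n)
    (measurePreserving_comp_perm unif e).measurable]
  congr 1
  ext x
  exact cyclicU_double sgnKernel_antisymm hn x


/-! ### The spectrum of the writhe operator. -/

theorem integral_unif {E : Type*} [NormedAddCommGroup E] [NormedSpace ℝ E] (h : ℝ → E) :
    ∫ y, h y ∂unif = ∫ y in (0 : ℝ)..1, h y := by
  rw [unif, intervalIntegral.integral_of_le zero_le_one, integral_Icc_eq_integral_Ioc]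

theorem integrable_unif_iff {E : Type*} [NormedAddCommGroup E] {h : ℝ → E} :
    Integrable h unif ↔ IntervalIntegrable h volume 0 1 := by
  rw [intervalIntegrable_iff_integrableOn_Icc_of_le zero_le_one]
  rfl

theorem integrable_unif_of_continuous {E : Type*} [NormedAddCommGroup E]
    {h : ℝ → E} (hh : Continuous h) : Integrable h unif :=
  integrable_unif_iff.2 (hh.intervalIntegrable _ _)

theorem ae_unif_mem : ∀ᵐ x ∂unif, x ∈ Set.Icc (0 : ℝ) 1 :=
  ae_restrict_mem measurableSet_Icc

/-- Integration against the kernel `sgn (x - y)` on `[0, 1]`. -/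
theorem integral_sgnKernel_mul {φ : ℝ → ℂ} (hφ : Integrable φ unif) {x : ℝ}
    (hx : x ∈ Set.Icc (0 : ℝ) 1) :
    ∫ y in (0 : ℝ)..1, (sgnKernel x y : ℂ) * φ y
      = 2 * (∫ y in (0 : ℝ)..x, φ y) - ∫ y in (0 : ℝ)..1, φ y := by
  rw [integrable_unif_iff] at hφ
  have i1 : IntervalIntegrable φ volume 0 x := hφ.mono_set (by
    rw [Set.uIcc_of_le hx.1, Set.uIcc_of_le zero_le_one]; exact Set.Icc_subset_Icc le_rfl hx.2)
  have i2 : IntervalIntegrable φ volume x 1 := hφ.mono_set (by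
    rw [Set.uIcc_of_le hx.2, Set.uIcc_of_le zero_le_one]; exact Set.Icc_subset_Icc hx.1 le_rfl)
  have e1 : Set.EqOn (fun y ↦ (sgnKernel x y : ℂ) * φ y) φ (Set.Ioo 0 x) := by
    intro y hy
    simp [sgnKernel, Real.sign_of_pos (sub_pos.2 hy.2)]
  have e2 : Set.EqOn (fun y ↦ (sgnKernel x y : ℂ) * φ y) (fun y ↦ -φ y) (Set.Ioo x 1) := by
    intro y hy
    simp [sgnKernel, Real.sign_of_neg (sub_neg.2 hy.1)]
  have e1' : ∀ᵐ y ∂volume.restrict (Set.uIoc 0 x), φ y = (sgnKernel x y : ℂ) * φ y := by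
    rw [Set.uIoc_of_le hx.1, ← restrict_Ioo_eq_restrict_Ioc]
    exact (ae_restrict_iff' measurableSet_Ioo).2 (ae_of_all _ fun y hy ↦ (e1 hy).symm)
  have e2' : ∀ᵐ y ∂volume.restrict (Set.uIoc x 1), -φ y = (sgnKernel x y : ℂ) * φ y := by
    rw [Set.uIoc_of_le hx.2, ← restrict_Ioo_eq_restrict_Ioc]
    exact (ae_restrict_iff' measurableSet_Ioo).2 (ae_of_all _ fun y hy ↦ (e2 hy).symm)
  rw [← intervalIntegral.integral_add_adjacent_intervals (i1.congr_ae e1')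
    (i2.neg.congr_ae e2'), ← intervalIntegral.integral_congr_ae_restrict e1',
    ← intervalIntegral.integral_congr_ae_restrict e2', intervalIntegral.integral_neg,
    ← intervalIntegral.integral_add_adjacent_intervals i1 i2]
  ring

theorem integral_sgnKernel {x : ℝ} (hx : x ∈ Set.Icc (0 : ℝ) 1) :
    ∫ y, sgnKernel x y ∂unif = 2 * x - 1 := by
  have h := integral_sgnKernel_mul (φ := fun _ ↦ 1) (integrable_const 1) hx
  simp only [mul_one] at h
  rw [← integral_unif, integral_complex_ofReal] at h
  have h' : ((∫ y, sgnKernel x y ∂unif : ℝ) : ℂ) = ((2 * x - 1 : ℝ) : ℂ) := by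
    rw [h]; simp
  exact_mod_cast h'

theorem integral_sgnKernel' {y : ℝ} (hy : y ∈ Set.Icc (0 : ℝ) 1) :
    ∫ x, sgnKernel x y ∂unif = 1 - 2 * y := by
  simp_rw [fun x ↦ sgnKernel_antisymm x y]
  rw [integral_neg, integral_sgnKernel hy]
  ring

theorem hoeffdingMean_sgnKernel : hoeffdingMean unif sgnKernel = 0 := by
  have hi : Integrable (fun p : ℝ × ℝ ↦ sgnKernel p.1 p.2) (unif.prod unif) :=
    Integrable.of_bound measurable_sgnKernel.aestronglyMeasurable 1
      (ae_of_all _ fun p ↦ abs_sgnKernel_le p.1 p.2)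
  rw [hoeffdingMean, integral_prod _ hi, integral_congr_ae (g := fun x ↦ 2 * x - 1)
    (by filter_upwards [ae_unif_mem] with x hx using integral_sgnKernel hx), integral_unif]
  rw [intervalIntegral.integral_sub (Continuous.intervalIntegrable (by fun_prop) _ _)
    (Continuous.intervalIntegrable (by fun_prop) _ _), intervalIntegral.integral_const_mul,
    integral_id]
  norm_num

/-- Here `f₁ (x) = 2 x - 1`, `f₂ (y) = 1 - 2 y` and the mean is zero. -/
theorem hoeffdingTop_sgnKernel {x y : ℝ} (hx : x ∈ Set.Icc (0 : ℝ) 1)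
    (hy : y ∈ Set.Icc (0 : ℝ) 1) :
    hoeffdingTop unif sgnKernel x y = sgnKernel x y - 2 * (x - y) := by
  rw [hoeffdingTop, hoeffdingFst, hoeffdingSnd, hoeffdingMean_sgnKernel, integral_sgnKernel hx,
    integral_sgnKernel' hy]
  ring

/-- The dependence on `x` is reduced to a primitive of `φ` and an affine function, so that the
eigenvalue equation can be differentiated. -/
theorem integral_writheKernel_mul {φ : ℝ → ℂ} (hφ : Integrable φ unif) {x : ℝ}
    (hx : x ∈ Set.Icc (0 : ℝ) 1) :
    ∫ y, writheKernel x y * φ y ∂unif = 2 * (∫ y in (0 : ℝ)..x, φ y)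
      - (1 + 2 * x) * (∫ y in (0 : ℝ)..1, φ y) + 2 * ∫ y in (0 : ℝ)..1, y * φ y := by
  have hs : Integrable (fun y ↦ (sgnKernel x y : ℂ) * φ y) unif := by
    refine hφ.bdd_mul (c := 1) ?_ (ae_of_all _ fun y ↦ ?_)
    · exact (Complex.measurable_ofReal.comp
        (measurable_sgnKernel.comp measurable_prodMk_left)).aestronglyMeasurable
    · rw [Complex.norm_real]; exact abs_sgnKernel_le x y
  have hy : Integrable (fun y : ℝ ↦ (y : ℂ) * φ y) unif := by
    refine hφ.bdd_mul (c := 1) Complex.measurable_ofReal.aestronglyMeasurable ?_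
    filter_upwards [ae_unif_mem] with y hy
    rw [Complex.norm_real, Real.norm_eq_abs, abs_le]
    constructor <;> linarith [hy.1, hy.2]
  have e : ∫ y, writheKernel x y * φ y ∂unif =
      ∫ y, (((sgnKernel x y : ℂ) * φ y - 2 * x * φ y) + 2 * (y * φ y)) ∂unif := by
    refine integral_congr_ae ?_
    filter_upwards [ae_unif_mem] with y hy
    rw [writheKernel, hoeffdingTop_sgnKernel hx hy]
    push_cast
    ring
  have hs' : Integrable (fun y ↦ (sgnKernel x y : ℂ) * φ y - 2 * x * φ y) unif :=
    hs.sub (hφ.const_mul _)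
  rw [e, integral_add hs' (hy.const_mul _), integral_sub hs (hφ.const_mul _), integral_const_mul, integral_const_mul]
  simp only [integral_unif]
  rw [integral_sgnKernel_mul hφ hx]
  ring

theorem integrable_lp (φ : Lp ℂ 2 unif) : Integrable φ unif :=
  (Lp.memLp φ).integrable (by norm_num)

theorem writheOperator_coeFn (φ : Lp ℂ 2 unif) :
    writheOperator φ =ᵐ[unif] fun x ↦ 2 * (∫ y in (0 : ℝ)..x, φ y)
      - (1 + 2 * x) * (∫ y in (0 : ℝ)..1, φ y) + 2 * ∫ y in (0 : ℝ)..1, y * φ y := by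
  have h : writheOperator φ =ᵐ[unif] fun x ↦ ∫ y, writheKernel x y * φ y ∂unif :=
    (memLp_integral memLp_writheKernel φ).coeFn_toLp
  filter_upwards [h, ae_unif_mem] with x hx hx'
  rw [hx, integral_writheKernel_mul (integrable_lp φ) hx']

theorem integral_mul_exp {a : ℂ} (ha : a ≠ 0) (hexp : Complex.exp a = 1) :
    ∫ y in (0 : ℝ)..1, (y : ℂ) * Complex.exp (a * y) = 1 / a := by
  have hd : ∀ y : ℝ, HasDerivAt (fun y : ℝ ↦ ((y : ℂ) / a - 1 / a ^ 2) * Complex.exp (a * y))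
      ((y : ℂ) * Complex.exp (a * y)) y := by
    intro y
    have h1 : HasDerivAt (fun y : ℝ ↦ (y : ℂ)) 1 y := Complex.ofRealCLM.hasDerivAt
    refine (((h1.div_const a).sub_const (1 / a ^ 2)).mul ((h1.const_mul a).cexp)).congr_deriv ?_
    field_simp
    ring
  rw [intervalIntegral.integral_eq_sub_of_hasDerivAt (fun y _ ↦ hd y)
    (Continuous.intervalIntegrable (by fun_prop) _ _)]
  simp [hexp]

theorem integral_exp_mul {a : ℂ} (ha : a ≠ 0) (x : ℝ) :
    ∫ y in (0 : ℝ)..x, Complex.exp (a * y) = (Complex.exp (a * x) - 1) / a := by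
  rw [integral_exp_mul_complex ha]; simp

theorem memLp_exp (a : ℂ) : MemLp (fun x : ℝ ↦ Complex.exp (a * x)) 2 unif := by
  refine MemLp.of_bound (C := Real.exp ‖a‖) (by fun_prop) ?_
  filter_upwards [ae_unif_mem] with x hx
  refine (Complex.norm_exp_le_exp_norm _).trans (Real.exp_le_exp.2 ?_)
  rw [norm_mul, Complex.norm_real, Real.norm_eq_abs, abs_of_nonneg hx.1]
  exact mul_le_of_le_one_right (norm_nonneg _) hx.2

/-- Put `a = 2 / z`. Since `exp a = 1`, the exponential has mean zero and first moment `1 / a`, so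
its image is `2 (exp (a x) - 1) / a + 2 / a = (2 / a) exp (a x)`, and `2 / a = z`. -/
theorem writheOperator_exp {z : ℂ} (hz : z ≠ 0) (hexp : Complex.exp (2 / z) = 1) :
    writheOperator (memLp_exp (2 / z)).toLp = z • (memLp_exp (2 / z)).toLp := by
  have ha : 2 / z ≠ 0 := div_ne_zero two_ne_zero hz
  set φ := (memLp_exp (2 / z)).toLp
  have hφ : φ =ᵐ[unif] fun x ↦ Complex.exp (2 / z * x) := (memLp_exp (2 / z)).coeFn_toLp
  refine Lp.ext ?_
  filter_upwards [writheOperator_coeFn φ, Lp.coeFn_smul z φ, hφ, ae_unif_mem] with x h1 h2 h3 hx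
  have hφ' : ∀ᵐ y ∂volume.restrict (Set.Icc (0 : ℝ) 1), φ y = Complex.exp (2 / z * y) := hφ
  have sub : ∀ b ∈ Set.Icc (0 : ℝ) 1, ∀ᵐ y ∂volume.restrict (Set.uIoc 0 b),
      φ y = Complex.exp (2 / z * y) := fun b hb ↦ ae_restrict_of_ae_restrict_of_subset (by
    rw [Set.uIoc_of_le hb.1]
    exact fun y hy ↦ ⟨hy.1.le, hy.2.trans hb.2⟩) hφ'
  have h4 : ∫ y in (0 : ℝ)..1, (y : ℂ) * φ y =
      ∫ y in (0 : ℝ)..1, (y : ℂ) * Complex.exp (2 / z * y) := by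
    refine intervalIntegral.integral_congr_ae_restrict ?_
    filter_upwards [sub 1 ⟨zero_le_one, le_rfl⟩] with y hy
    rw [hy]
  rw [h1, h2, Pi.smul_apply, h3, h4, intervalIntegral.integral_congr_ae_restrict (sub x hx),
    intervalIntegral.integral_congr_ae_restrict (sub 1 ⟨zero_le_one, le_rfl⟩), integral_mul_exp ha hexp, integral_exp_mul ha, integral_exp_mul ha]
  simp [hexp]
  field_simp
  ring

/-- An eigenfunction for `z ≠ 0` solves a linear differential equation, hence is a multiple of
`exp (2 x / z)`. -/
theorem eq_exp_of_writheOperator_eq {z : ℂ} (hz : z ≠ 0) {φ : Lp ℂ 2 unif}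
    (h : writheOperator φ = z • φ) :
    ∃ c : ℂ, (φ =ᵐ[unif] fun x ↦ c * Complex.exp (2 / z * x)) ∧
      (c ≠ 0 → Complex.exp (2 / z) = 1) := by
  set a : ℂ := 2 / z with ha'
  have ha : a ≠ 0 := div_ne_zero two_ne_zero hz
  have hza : z * a = 2 := by rw [ha']; field_simp
  set B := ∫ y in (0 : ℝ)..1, φ y with hB
  set C := ∫ y in (0 : ℝ)..1, y * φ y with hC
  -- The function `ψ` is `z⁻¹ T φ` written out, a continuous representative of `φ`. Feeding it back
  -- under the integral makes it differentiable inside the interval.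
  set ψ : ℝ → ℂ := fun x ↦ z⁻¹ * (2 * (∫ y in (0 : ℝ)..x, φ y) - (1 + 2 * x) * B + 2 * C) with hψ
  have hφψ : φ =ᵐ[unif] ψ := by
    have h1 := writheOperator_coeFn φ
    rw [h] at h1
    filter_upwards [h1, Lp.coeFn_smul z φ] with x h1 h2
    rw [h2, Pi.smul_apply, smul_eq_mul] at h1
    rw [hψ]
    simp only
    rw [← h1, inv_mul_cancel_left₀ hz]
  have hφ' : ∀ᵐ y ∂volume.restrict (Set.Icc (0 : ℝ) 1), φ y = ψ y := hφψ
  have sub : ∀ b ∈ Set.Icc (0 : ℝ) 1, ∀ᵐ y ∂volume.restrict (Set.uIoc 0 b),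
      φ y = ψ y := fun b hb ↦ ae_restrict_of_ae_restrict_of_subset (by
    rw [Set.uIoc_of_le hb.1]
    exact fun y hy ↦ ⟨hy.1.le, hy.2.trans hb.2⟩) hφ'
  have hint := integrable_unif_iff.1 (integrable_lp φ)
  have hcont : ContinuousOn ψ (Set.Icc 0 1) := by
    have h1 : ContinuousOn (fun x ↦ ∫ y in (0 : ℝ)..x, φ y) (Set.Icc 0 1) := by
      have := intervalIntegral.continuousOn_primitive_interval' hint Set.left_mem_uIcc
      rwa [Set.uIcc_of_le zero_le_one] at this
    rw [hψ]
    fun_prop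
  have hψ0 : ψ 0 = z⁻¹ * (2 * C - B) := by 
    simp only [hψ]
    rw [intervalIntegral.integral_same]
    push_cast
    ring
  -- The values at the two endpoints coincide; this is the periodic boundary condition that
  -- quantizes the eigenvalues.
  have hψ1 : ψ 1 = z⁻¹ * (2 * C - B) := by simp only [hψ]; rw [← hB]; push_cast; ring
  have hψint : ∀ x ∈ Set.Icc (0 : ℝ) 1, ψ x =
      z⁻¹ * (2 * (∫ y in (0 : ℝ)..x, ψ y) - (1 + 2 * x) * B + 2 * C) := by
    intro x hx
    rw [← intervalIntegral.integral_congr_ae_restrict (sub x hx)]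
  have hderiv : ∀ x ∈ Set.Ioo (0 : ℝ) 1, HasDerivAt ψ (a * (ψ x - B)) x := by
    intro x hx
    have hnhds : Set.Icc (0 : ℝ) 1 ∈ 𝓝 x := Icc_mem_nhds hx.1 hx.2
    have h1 : HasDerivAt (fun x ↦ ∫ y in (0 : ℝ)..x, ψ y) (ψ x) x := by
      refine intervalIntegral.integral_hasDerivAt_right ?_ ?_ (hcont.continuousAt hnhds)
      · refine (hcont.mono ?_).intervalIntegrable
        rw [Set.uIcc_of_le hx.1.le]; exact Set.Icc_subset_Icc le_rfl hx.2.le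
      · exact hcont.stronglyMeasurableAtFilter_nhdsWithin measurableSet_Icc x |>.filter_mono
          (by rw [nhdsWithin_eq_nhds.2 hnhds])
    have h2 : HasDerivAt (fun x : ℝ ↦ (x : ℂ)) 1 x := Complex.ofRealCLM.hasDerivAt
    have h3 := ((((h1.const_mul 2).sub (((h2.const_mul 2).const_add 1).mul_const B)).add_const
      (2 * C)).const_mul z⁻¹)
    refine (h3.congr_of_eventuallyEq ?_).congr_deriv ?_
    · filter_upwards [hnhds] with y hy using hψint y hy
    · rw [ha']; field_simp
  -- The integrating factor `exp (-a x)` solves `ψ' = a (ψ - B)`. The derivative is known only in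
  -- the open interval; continuity covers the endpoints.
  have hconst : ∀ x ∈ Set.Icc (0 : ℝ) 1, Complex.exp (-a * x) * (ψ x - B) = ψ 0 - B := by
    have hc : ContinuousOn (fun x : ℝ ↦ Complex.exp (-a * x) * (ψ x - B)) (Set.Icc 0 1) := by
      fun_prop
    have hd : ∀ x ∈ Set.Ico (0 : ℝ) 1 \ {0}, HasDerivAt
        (fun x : ℝ ↦ Complex.exp (-a * x) * (ψ x - B)) 0 x := by
      rintro x ⟨hx, hx0⟩
      have hx' : x ∈ Set.Ioo (0 : ℝ) 1 := ⟨lt_of_le_of_ne hx.1 (Ne.symm hx0), hx.2⟩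
      have h2 : HasDerivAt (fun x : ℝ ↦ (x : ℂ)) 1 x := Complex.ofRealCLM.hasDerivAt
      refine (((h2.const_mul (-a)).cexp).mul ((hderiv x hx').sub_const B)).congr_deriv ?_
      ring
    intro x hx
    have := intervalIntegral.integral_eq_sub_of_hasDerivAt_of_le (f := fun x : ℝ ↦
      Complex.exp (-a * x) * (ψ x - B)) (f' := fun _ ↦ 0) hx.1
      (hc.mono (Set.Icc_subset_Icc le_rfl hx.2))
      (fun y hy ↦ hd y ⟨⟨hy.1.le, hy.2.trans_le hx.2⟩, hy.1.ne'⟩) (by simp)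
    simp at this
    have h' := (sub_eq_zero.1 this.symm)
    simpa using h'
  set c := ψ 0 - B with hc
  have hsol : ∀ x ∈ Set.Icc (0 : ℝ) 1, ψ x = B + c * Complex.exp (a * x) := by
    intro x hx
    have := hconst x hx
    rw [← this]
    have e : Complex.exp (-a * x) * Complex.exp (a * x) = 1 := by
      rw [← Complex.exp_add]; simp
    linear_combination (B - ψ x) * e
  -- From `ψ = B + c exp (a x)` and `ψ 0 = ψ 1`.
  have hexp : c ≠ 0 → Complex.exp a = 1 := by
    intro hc0
    have h1 := hsol 1 ⟨zero_le_one, le_rfl⟩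
    have h0 : ψ 0 = B + c := by rw [hc]; ring
    rw [hψ1, ← hψ0, h0] at h1
    have : c * (Complex.exp a - 1) = 0 := by
      have h1' : B + c = B + c * Complex.exp a := by simpa using h1
      linear_combination -h1'
    rcases mul_eq_zero.1 this with h | h
    · exact absurd h hc0
    · linear_combination h
  have hCval : C = B / 2 + c * (1 / a) := by
    have e1 : C = ∫ y in (0 : ℝ)..1, (B * y + c * (y * Complex.exp (a * y))) := by
      rw [hC]
      refine intervalIntegral.integral_congr_ae_restrict ?_
      filter_upwards [sub 1 ⟨zero_le_one, le_rfl⟩, ae_restrict_mem measurableSet_uIoc] with y hy hy'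
      rw [Set.uIoc_of_le zero_le_one] at hy'
      rw [hy, hsol y ⟨hy'.1.le, hy'.2⟩]
      ring
    rw [e1, intervalIntegral.integral_add (Continuous.intervalIntegrable (by fun_prop) _ _)
      (Continuous.intervalIntegrable (by fun_prop) _ _), intervalIntegral.integral_const_mul,
      intervalIntegral.integral_const_mul]
    have e2 : ∫ y in (0 : ℝ)..1, (y : ℂ) = 1 / 2 := by
      rw [intervalIntegral.integral_ofReal]; simp
    rw [e2]
    by_cases hc0 : c = 0
    · simp [hc0]; ring
    · rw [integral_mul_exp ha (hexp hc0)]; ring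
  -- With `C = B / 2 + c / a` the value `z ψ 0 = 2 C - B` is `2 c / a = z c`, while `ψ 0 = B + c`;
  -- hence `z B = 0`.
  have hB0 : B = 0 := by
    have h0 : ψ 0 = B + c := by rw [hc]; ring
    rw [hψ0, hCval] at h0
    have h1 : z * (B + c) = 2 * (B / 2 + c * (1 / a)) - B := by rw [← h0]; field_simp
    have h2 : 2 * (1 / a) = z := by rw [ha']; field_simp
    have : z * B = 0 := by linear_combination h1 + c * h2
    exact (mul_eq_zero.1 this).resolve_left hz
  refine ⟨c, ?_, hexp⟩
  filter_upwards [hφψ, ae_unif_mem] with x h1 hx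
  rw [h1, hsol x hx, hB0, zero_add]

theorem toLp_exp_ne_zero (a : ℂ) : (memLp_exp a).toLp ≠ 0 := by
  intro h
  have h1 := (memLp_exp a).coeFn_toLp
  rw [h] at h1
  have h2 : ∀ᵐ x ∂unif, False := by
    filter_upwards [h1, Lp.coeFn_zero ℂ 2 unif] with x hx hx'
    rw [hx'] at hx
    exact Complex.exp_ne_zero _ hx.symm
  simp only [eventually_false_iff_eq_bot, ae_eq_bot] at h2
  exact IsProbabilityMeasure.ne_zero unif h2

theorem exp_two_div_eq_one_iff {z : ℂ} (hz : z ≠ 0) :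
    Complex.exp (2 / z) = 1 ↔ ∃ k : ℤ, k ≠ 0 ∧ z = Complex.I / (Real.pi * k) := by
  have hpi : (Real.pi : ℂ) ≠ 0 := by exact_mod_cast Real.pi_ne_zero
  rw [Complex.exp_eq_one_iff]
  constructor
  · rintro ⟨n, hn⟩
    have hn0 : (n : ℂ) ≠ 0 := by
      intro h0
      rw [h0, zero_mul] at hn
      exact div_ne_zero two_ne_zero hz hn
    -- From `2 / z = 2 π i n` one gets `z = 1 / (π i n) = i / (π (-n))`, so the index changes sign.
    refine ⟨-n, by simpa using hn0, ?_⟩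
    have h2 : 2 = n * (2 * Real.pi * Complex.I) * z := by rw [← hn]; field_simp
    push_cast
    rw [eq_div_iff (mul_ne_zero hpi (neg_ne_zero.2 hn0))]
    linear_combination -(Complex.I / 2) * h2 - z * Real.pi * n * Complex.I_sq
  · rintro ⟨k, hk, rfl⟩
    refine ⟨-k, ?_⟩
    have hk' : (k : ℂ) ≠ 0 := by exact_mod_cast hk
    push_cast
    field_simp
    rw [Complex.I_sq]
    ring

theorem hasEigenvalue_writheOperator_iff {z : ℂ} (hz : z ≠ 0) :
    writheOperator.HasEigenvalue z ↔ ∃ k : ℤ, k ≠ 0 ∧ z = Complex.I / (Real.pi * k) := by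
  rw [← exp_two_div_eq_one_iff hz]
  constructor
  · intro h
    obtain ⟨φ, hφ⟩ := h.exists_hasEigenvector
    obtain ⟨c, hc, hexp⟩ := eq_exp_of_writheOperator_eq hz hφ.apply_eq_smul
    refine hexp fun hc0 ↦ hφ.2 ?_
    refine Lp.ext ?_
    filter_upwards [hc, Lp.coeFn_zero ℂ 2 unif] with x h1 h2
    rw [h1, h2, hc0]; simp
  · intro h
    exact Module.End.hasEigenvalue_of_hasEigenvector
      (x := (memLp_exp (2 / z)).toLp) ⟨Module.End.mem_eigenspace_iff.2 (writheOperator_exp hz h),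
        toLp_exp_ne_zero _⟩

theorem finrank_eigenspace_writheOperator {k : ℤ} (hk : k ≠ 0) :
    Module.finrank ℂ (writheOperator.eigenspace (Complex.I / (Real.pi * k))) = 1 := by
  have hz : Complex.I / (Real.pi * k) ≠ 0 := by
    refine div_ne_zero Complex.I_ne_zero (mul_ne_zero ?_ ?_)
    · exact_mod_cast Real.pi_ne_zero
    · exact_mod_cast hk
  set z := Complex.I / (Real.pi * k) with hzdef
  have hexp := (exp_two_div_eq_one_iff hz).2 ⟨k, hk, hzdef⟩
  have : writheOperator.eigenspace z = Submodule.span ℂ {(memLp_exp (2 / z)).toLp} := by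
    refine le_antisymm (fun φ hφ ↦ ?_) ?_
    · obtain ⟨c, hc, -⟩ := eq_exp_of_writheOperator_eq hz (Module.End.mem_eigenspace_iff.1 hφ)
      refine Submodule.mem_span_singleton.2 ⟨c, ?_⟩
      refine Lp.ext ?_
      filter_upwards [hc, Lp.coeFn_smul c (memLp_exp (2 / z)).toLp,
        (memLp_exp (2 / z)).coeFn_toLp] with x h1 h2 h3
      rw [h1, h2, Pi.smul_apply, h3, smul_eq_mul]
    · rw [Submodule.span_singleton_le_iff_mem]
      exact Module.End.mem_eigenspace_iff.2 (writheOperator_exp hz hexp)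
  rw [this, finrank_span_singleton (toLp_exp_ne_zero _)]


/-! Existence and second moment of the stochastic area law. -/

/-- The arcsine law on `(0, 1)`. -/
noncomputable def arcsineLaw : Measure ℝ := betaMeasure (1 / 2) (1 / 2)

instance isProbabilityMeasure_arcsineLaw : IsProbabilityMeasure arcsineLaw :=
  isProbabilityMeasureBeta (by norm_num) (by norm_num)

/-- The log odds `log (x / (1 - x))`. -/
noncomputable def logOdds (x : ℝ) : ℝ := Real.log x - Real.log (1 - x)

theorem measurable_logOdds : Measurable logOdds := by
  unfold logOdds; fun_prop

theorem beta_half_half : beta (1 / 2) (1 / 2) = Real.pi := by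
  rw [beta, ← pow_two, Real.Gamma_one_half_eq, Real.sq_sqrt Real.pi_pos.le]
  norm_num

theorem measurable_betaPDF (a b : ℝ) : Measurable (betaPDF a b) :=
  (measurable_betaPDFReal a b).ennreal_ofReal

/-- The factor `exp (w logOdds x)` is `(x / (1 - x)) ^ w`, which shifts the two beta parameters to
`1/2 + w` and `1/2 - w`. -/
theorem betaPDF_smul_cexp (w : ℂ) :
    (fun x ↦ (betaPDF (1 / 2) (1 / 2) x).toReal • Complex.exp (w * logOdds x)) =
    (Set.Ioo (0 : ℝ) 1).indicator fun x : ℝ ↦ (Real.pi : ℂ)⁻¹ *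
      ((x : ℂ) ^ ((1 / 2 + w) - 1) * (1 - (x : ℂ)) ^ ((1 / 2 - w) - 1)) := by
  ext x
  by_cases hx : x ∈ Set.Ioo (0 : ℝ) 1
  · have hx1 : 0 < 1 - x := by linarith [hx.2]
    rw [Set.indicator_of_mem hx, betaPDF, betaPDFReal, if_pos (show 0 < x ∧ x < 1 from hx), beta_half_half,
      ENNReal.toReal_ofReal (by have := hx.1; have := Real.pi_pos; positivity)]
    rw [Complex.real_smul]
    push_cast
    rw [Complex.ofReal_cpow hx.1.le, Complex.ofReal_cpow hx1.le]
    have hxc : (x : ℂ) ≠ 0 := by exact_mod_cast hx.1.ne'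
    have hxc1 : (1 - x : ℂ) ≠ 0 := by exact_mod_cast hx1.ne'
    push_cast
    rw [Complex.cpow_def_of_ne_zero hxc, Complex.cpow_def_of_ne_zero hxc,
      Complex.cpow_def_of_ne_zero hxc1, Complex.cpow_def_of_ne_zero hxc1]
    have e1 : Complex.log x = (Real.log x : ℂ) := (Complex.ofReal_log hx.1.le).symm
    have e2 : Complex.log (1 - x) = (Real.log (1 - x) : ℂ) := by
      rw [Complex.ofReal_log hx1.le]; push_cast; rfl
    rw [e1, e2, logOdds, one_div, mul_assoc, mul_assoc, ← Complex.exp_add, ← Complex.exp_add,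
      ← Complex.exp_add]
    congr 2
    push_cast
    ring
  · rw [Set.indicator_of_notMem hx, betaPDF, betaPDFReal,
      if_neg (show ¬(0 < x ∧ x < 1) from hx)]
    simp

theorem integrable_cexp_logOdds {w : ℂ} (h1 : -(1 / 2) < w.re) (h2 : w.re < 1 / 2) :
    Integrable (fun x ↦ Complex.exp (w * logOdds x)) arcsineLaw := by
  rw [arcsineLaw, betaMeasure, integrable_withDensity_iff_integrable_smul'
    (measurable_betaPDF _ _) (ae_of_all _ fun _ ↦ ENNReal.ofReal_lt_top),
    betaPDF_smul_cexp, integrable_indicator_iff measurableSet_Ioo]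
  have h := Complex.betaIntegral_convergent (u := 1 / 2 + w) (v := 1 / 2 - w)
    (by simp; linarith) (by simp; linarith)
  rw [intervalIntegrable_iff_integrableOn_Ioo_of_le zero_le_one] at h
  exact h.const_mul _

/-- The beta integral equals `Γ (1/2 + w) Γ (1/2 - w)`, because `Γ 1 = 1`, and the reflection
formula evaluates this as `π / sin (π w + π/2) = π / cos (π w)`. The factor `π` cancels against the
normalization of the arcsine law. -/
theorem integral_cexp_logOdds {w : ℂ} (h1 : -(1 / 2) < w.re) (h2 : w.re < 1 / 2) :
    ∫ x, Complex.exp (w * logOdds x) ∂arcsineLaw = (Complex.cos (Real.pi * w))⁻¹ := by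
  rw [arcsineLaw, betaMeasure, integral_withDensity_eq_integral_toReal_smul
    (measurable_betaPDF _ _) (ae_of_all _ fun _ ↦ ENNReal.ofReal_lt_top),
    betaPDF_smul_cexp, integral_indicator measurableSet_Ioo, integral_const_mul,
    ← integral_Ioc_eq_integral_Ioo, ← intervalIntegral.integral_of_le zero_le_one]
  have h := Complex.Gamma_mul_Gamma_eq_betaIntegral (s := 1 / 2 + w) (t := 1 / 2 - w)
    (by simp; linarith) (by simp; linarith)
  have hg := Complex.Gamma_mul_Gamma_one_sub (1 / 2 + w)
  rw [show (1 : ℂ) - (1 / 2 + w) = 1 / 2 - w by ring, h,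
    show (1 / 2 + w + (1 / 2 - w) : ℂ) = 1 by ring, Complex.Gamma_one, one_mul] at hg
  have hpi : (Real.pi : ℂ) ≠ 0 := by exact_mod_cast Real.pi_ne_zero
  change (Real.pi : ℂ)⁻¹ * Complex.betaIntegral (1 / 2 + w) (1 / 2 - w) = _
  rw [hg, show (Real.pi : ℂ) * (1 / 2 + w) = Real.pi * w + Real.pi / 2 by ring,
    Complex.sin_add_pi_div_two]
  field_simp

/-- The stochastic area law: the law of `log (B / (1 - B)) / π` for an arcsine variable `B`. -/
noncomputable def areaLaw : Measure ℝ := arcsineLaw.map fun x ↦ Real.pi⁻¹ * logOdds x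

instance isProbabilityMeasure_areaLaw : IsProbabilityMeasure areaLaw :=
  Measure.isProbabilityMeasure_map (measurable_logOdds.const_mul _).aemeasurable

/-- Take `w = i t / π` in `integral_cexp_logOdds`; then `cos (π w) = cos (i t) = cosh t`. -/
theorem isStochasticAreaLaw_areaLaw : IsStochasticAreaLaw areaLaw := by
  intro t
  have hpi : (Real.pi : ℂ) ≠ 0 := by exact_mod_cast Real.pi_ne_zero
  rw [charFun_apply_real, areaLaw, integral_map (measurable_logOdds.const_mul _).aemeasurable
    (by fun_prop)]
  have h := integral_cexp_logOdds (w := t * Complex.I / Real.pi)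
    (by rw [Complex.div_ofReal_re]; simp) (by rw [Complex.div_ofReal_re]; simp)
  rw [mul_div_cancel₀ _ hpi, Complex.cos_mul_I] at h
  push_cast
  rw [one_div, ← h]
  congr 1
  ext x
  congr 1
  field_simp

theorem eq_areaLaw {γ : Measure ℝ} [IsFiniteMeasure γ] (h : IsStochasticAreaLaw γ) :
    γ = areaLaw :=
  Measure.ext_of_charFun (by ext t; rw [h t, isStochasticAreaLaw_areaLaw t])

/-- The log odds have exponential moments for `|s| < 1/2`, hence all moments. -/
theorem memLp_areaLaw : MemLp id 2 areaLaw := by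
  have key : ∀ s ∈ Set.Ioo (-(1 / 2) : ℝ) (1 / 2), s ∈ integrableExpSet logOdds arcsineLaw := by
    intro s hs
    have := (integrable_cexp_logOdds (w := s) (by simpa using hs.1) (by simpa using hs.2)).norm
    refine this.congr (ae_of_all _ fun x ↦ ?_)
    simp only [Complex.norm_exp]
    norm_cast
  have h0 : (0 : ℝ) ∈ interior (integrableExpSet logOdds arcsineLaw) :=
    mem_interior.2 ⟨_, key, isOpen_Ioo, by norm_num⟩
  have h := memLp_of_mem_interior_integrableExpSet h0 2
  rw [areaLaw, memLp_map_measure_iff aestronglyMeasurable_id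
    (measurable_logOdds.const_mul _).aemeasurable]
  exact h.const_mul _

/-- The characteristic function is even, so the law is symmetric. -/
theorem integral_areaLaw : ∫ x, x ∂areaLaw = 0 := by
  have hneg : areaLaw.map (fun x ↦ -1 * x) = areaLaw := by
    have : IsProbabilityMeasure (areaLaw.map fun x ↦ -1 * x) :=
      Measure.isProbabilityMeasure_map (by fun_prop)
    refine eq_areaLaw fun t ↦ ?_
    rw [charFun_map_mul, isStochasticAreaLaw_areaLaw]
    simp
  have h : ∫ x, x ∂areaLaw = ∫ x, -1 * x ∂areaLaw := by
    conv_lhs => rw [← hneg]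
    rw [integral_map (by fun_prop) (by fun_prop)]
  rw [integral_const_mul] at h
  linarith

/-! Almost sure convergence of series of independent variables. -/

section Series

variable {Ω : Type*} [MeasurableSpace Ω] {P : Measure Ω} [IsProbabilityMeasure P]

theorem integral_sq_sum_of_iIndepFun {η : ℕ → Ω → ℝ} (hi : iIndepFun η P)
    (hL : ∀ k, MemLp (η k) 2 P) (h0 : ∀ k, ∫ ω, η k ω ∂P = 0) (s : Finset ℕ) :
    ∫ ω, (∑ k ∈ s, η k ω) ^ 2 ∂P = ∑ k ∈ s, ∫ ω, η k ω ^ 2 ∂P := by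
  have h := IndepFun.variance_sum (s := s) (fun i _ ↦ hL i)
    fun i _ j _ hij ↦ hi.indepFun hij
  have hm : AEMeasurable (∑ k ∈ s, η k) P :=
    (memLp_finsetSum' s fun k _ ↦ hL k).aestronglyMeasurable.aemeasurable
  have hz : ∫ ω, (∑ k ∈ s, η k) ω ∂P = 0 := by
    simp only [Finset.sum_apply]
    rw [integral_finsetSum _ fun k _ ↦ (hL k).integrable (by norm_num)]
    simp [h0]
  rw [variance_of_integral_eq_zero hm hz] at h
  simp only [Finset.sum_apply] at h
  rw [h]
  exact Finset.sum_congr rfl fun k _ ↦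
    variance_of_integral_eq_zero (hL k).aestronglyMeasurable.aemeasurable (h0 k)

/-- This is the nonnegativity of the variance of `|Y|`. -/
theorem integral_abs_le_sqrt {Y : Ω → ℝ} (hY : MemLp Y 2 P) :
    ∫ ω, |Y ω| ∂P ≤ √(∫ ω, Y ω ^ 2 ∂P) := by
  refine Real.le_sqrt_of_sq_le ?_
  have h := variance_nonneg |Y| P
  rw [variance_eq_sub hY.abs] at h
  simp only [Pi.pow_apply, Pi.abs_apply, sq_abs] at h
  linarith

/-- A series of independent centred square integrable variables with bounded sums of variances
converges almost surely. -/
theorem ae_exists_tendsto_sum {η : ℕ → Ω → ℝ} (hm : ∀ k, StronglyMeasurable (η k))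
    (hi : iIndepFun η P) (hL : ∀ k, MemLp (η k) 2 P) (h0 : ∀ k, ∫ ω, η k ω ∂P = 0) {C : ℝ}
    (hC : ∀ n, ∑ k ∈ Finset.range n, ∫ ω, η k ω ^ 2 ∂P ≤ C) :
    ∀ᵐ ω ∂P, ∃ c, Tendsto (fun n ↦ ∑ k ∈ Finset.range n, η k ω) atTop (𝓝 c) := by
  let ℱ := Filtration.natural η hm
  -- The partial sums are shifted by one so that `S n` contains `η n` and is measurable for the
  -- natural filtration at time `n`. They form a martingale bounded in `L²`, hence in `L¹`, and the
  -- martingale convergence theorem applies.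
  let S : ℕ → Ω → ℝ := fun n ω ↦ ∑ k ∈ Finset.range (n + 1), η k ω
  have hSL : ∀ n, MemLp (S n) 2 P := fun n ↦ memLp_finsetSum _ fun k _ ↦ hL k
  have hS : Martingale S ℱ P := by
    have hadp : StronglyAdapted ℱ S := fun n ↦ by
      refine Finset.stronglyMeasurable_fun_sum _ fun k hk ↦ ?_
      exact (Filtration.stronglyAdapted_natural hm k).mono
        (ℱ.mono (by simpa [Nat.lt_succ_iff] using hk))
    refine martingale_nat hadp (fun n ↦ (hSL n).integrable (by norm_num)) fun n ↦ ?_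
    have e : S (n + 1) = S n + η (n + 1) := by
      ext ω; simp only [S, Pi.add_apply]; rw [Finset.sum_range_succ]
    have h1 := condExp_add (μ := P) ((hSL n).integrable (by norm_num))
      ((hL (n + 1)).integrable (by norm_num)) (ℱ n)
    have h2 := hi.condExp_natural_ae_eq_of_lt hm (Nat.lt_succ_self n)
    have h3 := condExp_of_stronglyMeasurable (ℱ.le n) (hadp n) ((hSL n).integrable (by norm_num))
    rw [e]
    filter_upwards [h1, h2] with ω h1 h2
    rw [h1, Pi.add_apply, h3, h2, h0, add_zero]
  have hbdd : ∀ n, eLpNorm (S n) 1 P ≤ (√C).toNNReal := by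
    intro n
    rw [eLpNorm_one_eq_lintegral_enorm, ← ofReal_integral_norm_eq_lintegral_enorm
      ((hSL n).integrable (by norm_num))]
    refine ENNReal.ofReal_le_ofReal ?_
    refine (integral_abs_le_sqrt (hSL n)).trans (Real.sqrt_le_sqrt ?_)
    rw [integral_sq_sum_of_iIndepFun hi hL h0]
    exact hC _
  filter_upwards [hS.submartingale.exists_ae_tendsto_of_bdd hbdd] with ω hω
  obtain ⟨c, hc⟩ := hω
  exact ⟨c, (tendsto_add_atTop_iff_nat 1).1 hc⟩

end Series

/-- The weighted series of stochastic area variables converges almost surely, and the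
characteristic function of its sum is the limit of the products. -/
theorem exists_area_series {Ω : Type*} [MeasurableSpace Ω] {P : Measure Ω} [IsProbabilityMeasure P]
    {η : ℕ → Ω → ℝ} (hm : ∀ k, AEMeasurable (η k) P)
    (hlaw : ∀ k, IsStochasticAreaLaw (P.map (η k))) (hi : iIndepFun η P) :
    ∃ W : Ω → ℝ, AEMeasurable W P ∧
      (∀ᵐ ω ∂P, Tendsto (fun K : ℕ ↦ ∑ k ∈ Finset.Icc 1 K, 1 / (Real.pi * (k : ℝ)) * η k ω) atTop
        (𝓝 (W ω))) ∧
      ∀ t : ℝ, Tendsto (fun K : ℕ ↦ ∏ k ∈ Finset.range K,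
        ((1 / Real.cosh (t / (Real.pi * (k + 1))) : ℝ) : ℂ)) atTop (𝓝 (charFun (P.map W) t)) := by
  have hlaw' : ∀ k, P.map (η k) = areaLaw := fun k ↦ by
    have := Measure.isProbabilityMeasure_map (μ := P) (hm k)
    exact eq_areaLaw (hlaw k)
  have hηL : ∀ k, MemLp (η k) 2 P := fun k ↦ by
    have := memLp_areaLaw
    rw [← hlaw' k, memLp_map_measure_iff aestronglyMeasurable_id (hm k)] at this
    exact this
  have hη0 : ∀ k, ∫ ω, η k ω ∂P = 0 := fun k ↦ by
    have := integral_areaLaw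
    rwa [← hlaw' k, integral_map (hm k) (by fun_prop)] at this
  have hη2 : ∀ k, ∫ ω, η k ω ^ 2 ∂P = ∫ x, x ^ 2 ∂areaLaw := fun k ↦ by
    rw [← hlaw' k, integral_map (hm k) (by fun_prop)]
  -- The summation is shifted to start at `0`. Measurable modifications of the `η k` are used
  -- because the natural filtration needs strongly measurable variables.
  let a : ℕ → ℝ := fun k ↦ 1 / (Real.pi * ((k : ℝ) + 1))
  let ξ : ℕ → Ω → ℝ := fun k ω ↦ a k * (hm (k + 1)).mk _ ω
  have hξ : ∀ k, ξ k =ᵐ[P] fun ω ↦ a k * η (k + 1) ω := fun k ↦ by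
    filter_upwards [(hm (k + 1)).ae_eq_mk] with ω hω
    simp only [ξ]; rw [hω]
  have hξm : ∀ k, StronglyMeasurable (ξ k) := fun k ↦
    ((hm (k + 1)).measurable_mk.const_mul _).stronglyMeasurable
  have hi1 : iIndepFun (fun k ω ↦ a k * η (k + 1) ω) P :=
    (hi.precomp (g := fun k : ℕ ↦ k + 1) (add_left_injective 1)).comp (fun k x ↦ a k * x)
      fun k ↦ by fun_prop
  have hξi : iIndepFun ξ P := hi1.congr fun k ↦ (hξ k).symm
  have hξL : ∀ k, MemLp (ξ k) 2 P := fun k ↦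
    (memLp_congr_ae (hξ k)).2 ((hηL (k + 1)).const_mul _)
  have hξ0 : ∀ k, ∫ ω, ξ k ω ∂P = 0 := fun k ↦ by
    rw [integral_congr_ae (hξ k), integral_const_mul, hη0, mul_zero]
  set v := ∫ x, x ^ 2 ∂areaLaw
  have hv : 0 ≤ v := integral_nonneg fun x ↦ sq_nonneg x
  have hξ2 : ∀ k, ∫ ω, ξ k ω ^ 2 ∂P = v / Real.pi ^ 2 * (1 / ((k : ℝ) + 1) ^ 2) := fun k ↦ by
    have : (fun ω ↦ ξ k ω ^ 2) =ᵐ[P] fun ω ↦ a k ^ 2 * η (k + 1) ω ^ 2 := by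
      filter_upwards [hξ k] with ω hω
      rw [hω, mul_pow]
    rw [integral_congr_ae this, integral_const_mul, hη2]
    simp only [a]
    field_simp
  have hsum : Summable fun k : ℕ ↦ 1 / ((k : ℝ) + 1) ^ 2 := by
    have := (summable_nat_add_iff 1).2 hasSum_zeta_two.summable
    simpa using this
  have hC : ∀ n, ∑ k ∈ Finset.range n, ∫ ω, ξ k ω ^ 2 ∂P
      ≤ v / Real.pi ^ 2 * ∑' k : ℕ, 1 / ((k : ℝ) + 1) ^ 2 := by
    intro n
    simp only [hξ2]
    rw [← Finset.mul_sum]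
    exact mul_le_mul_of_nonneg_left (hsum.sum_le_tsum _ fun k _ ↦ by positivity) (by positivity)
  have hconv := ae_exists_tendsto_sum hξm hξi hξL hξ0 hC
  let W : Ω → ℝ := fun ω ↦ limUnder atTop fun n ↦ ∑ k ∈ Finset.range n, ξ k ω
  have hW : ∀ᵐ ω ∂P, Tendsto (fun n ↦ ∑ k ∈ Finset.range n, ξ k ω) atTop (𝓝 (W ω)) := by
    filter_upwards [hconv] with ω hω using tendsto_nhds_limUnder hω
  have hSm : ∀ n, AEMeasurable (fun ω ↦ ∑ k ∈ Finset.range n, ξ k ω) P := fun n ↦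
    (Finset.measurable_fun_sum _ fun k _ ↦ (hξm k).measurable).aemeasurable
  have hWm : AEMeasurable W P := aemeasurable_of_tendsto_metrizable_ae atTop hSm hW
  refine ⟨W, hWm, ?_, fun t ↦ ?_⟩
  · filter_upwards [hW, ae_all_iff.2 hξ] with ω h1 h2
    refine h1.congr fun n ↦ ?_
    have e : ∑ k ∈ Finset.range n, 1 / (Real.pi * ((k + 1 : ℕ) : ℝ)) * η (k + 1) ω =
        ∑ k ∈ Finset.Icc 1 n, 1 / (Real.pi * (k : ℝ)) * η k ω := by
      rw [Finset.range_eq_Ico,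
        Finset.sum_Ico_add' (fun k : ℕ ↦ 1 / (Real.pi * (k : ℝ)) * η k ω) 0 n 1]
      rfl
    rw [← e]
    refine Finset.sum_congr rfl fun k _ ↦ ?_
    rw [h2 k]
    push_cast
    rfl
  · have h1 : ∀ K : ℕ, ∏ k ∈ Finset.range K, ((1 / Real.cosh (t / (Real.pi * (k + 1))) : ℝ) : ℂ)
        = charFun (P.map fun ω ↦ ∑ k ∈ Finset.range K, ξ k ω) t := by
      intro K
      rw [(hξi.precomp Subtype.val_injective).charFun_map_fun_finsetSum_eq_prod
        fun k _ ↦ (hξm k).measurable.aemeasurable, Finset.prod_apply]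
      refine Finset.prod_congr rfl fun k _ ↦ ?_
      rw [Measure.map_congr (hξ k), charFun_map_mul_comp (hm (k + 1)), hlaw (k + 1)]
      simp only [a]
      congr 3
      ring_nf
    simp only [h1]
    simp only [charFun_apply_real]
    rw [integral_map hWm (by fun_prop)]
    simp only [fun K ↦ integral_map (hSm K)
      (show AEStronglyMeasurable (fun x : ℝ ↦ Complex.exp (t * x * Complex.I)) _ by fun_prop)]
    refine tendsto_integral_of_dominated_convergence (fun _ ↦ 1) (fun K ↦ ?_)
      (integrable_const 1) (fun K ↦ ae_of_all _ fun ω ↦ ?_) ?_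
    · exact ((show Continuous fun x : ℝ ↦ Complex.exp (t * x * Complex.I) by
        fun_prop).comp_aestronglyMeasurable (hSm K).aestronglyMeasurable)
    · rw [← Complex.ofReal_mul, Complex.norm_exp_ofReal_mul_I]
    · filter_upwards [hW] with ω hω
      exact ((show Continuous fun x : ℝ ↦ Complex.exp (t * x * Complex.I) by
        fun_prop).tendsto _).comp hω


/-! ### Orthogonality and second moments of degenerate statistics. -/

/-- A function whose integral over one coordinate vanishes has integral zero. -/
theorem integral_pi_eq_zero {α : Type*} [MeasurableSpace α] {ν : Measure α}
    [IsProbabilityMeasure ν] {n : ℕ} (i : Fin n) {F : (Fin n → α) → ℝ}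
    (hF : Integrable F (Measure.pi fun _ ↦ ν))
    (h : ∀ x, ∫ t, F (Function.update x i t) ∂ν = 0) :
    ∫ x, F x ∂(Measure.pi fun _ ↦ ν) = 0 := by
  cases n with
  | zero => exact i.elim0
  | succ m =>
    have hmp := measurePreserving_piFinSuccAbove (fun _ : Fin (m + 1) ↦ ν) i
    set e := MeasurableEquiv.piFinSuccAbove (fun _ : Fin (m + 1) ↦ α) i
    have h1 : ∫ x, F x ∂(Measure.pi fun _ ↦ ν) =
        ∫ p, F (e.symm p) ∂(ν.prod (Measure.pi fun _ : Fin m ↦ ν)) := by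
      rw [← hmp.integral_comp e.measurableEmbedding]
      simp
    have h2 : Integrable (fun p ↦ F (e.symm p)) (ν.prod (Measure.pi fun _ : Fin m ↦ ν)) := by
      rw [← hmp.integrable_comp_emb e.measurableEmbedding]
      simpa [Function.comp_def] using hF
    -- An arbitrary value for slot `i`; the update in the hypothesis overwrites it.
    obtain ⟨t0⟩ : Nonempty α := ν.nonempty_of_neZero
    rw [h1, integral_prod_symm _ h2]
    refine integral_eq_zero_of_ae (ae_of_all _ fun y ↦ ?_)
    have h3 := h (i.insertNth t0 y)
    simp only [Fin.update_insertNth] at h3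
    exact h3

section Orthogonal

variable {n : ℕ} {ν : Measure ℝ} [IsProbabilityMeasure ν] {g h : ℝ → ℝ → ℝ} {B : ℝ}

theorem measurable_kernel_eval (hg : Measurable (Function.uncurry g)) (i j : Fin n) :
    Measurable fun x : Fin n → ℝ ↦ g (x i) (x j) :=
  hg.comp (show Measurable fun x : Fin n → ℝ ↦ (x i, x j) by fun_prop)

theorem memLp_kernel_eval (hg : Measurable (Function.uncurry g)) (hgB : ∀ x y, |g x y| ≤ B)
    (i j : Fin n) (p : ENNReal) :
    MemLp (fun x : Fin n → ℝ ↦ g (x i) (x j)) p (Measure.pi fun _ ↦ ν) :=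
  MemLp.of_bound (measurable_kernel_eval hg i j).aestronglyMeasurable B
    (ae_of_all _ fun _ ↦ hgB _ _)

/-- The coordinate `i` occurs only in the first slot of `g`, so integrating it out first gives zero.
Degeneracy in the second slot is used by swapping the arguments of the kernel. -/
theorem integral_kernel_mul_eq_zero (hg : Measurable (Function.uncurry g))
    (hh : Measurable (Function.uncurry h)) (hgB : ∀ x y, |g x y| ≤ B) (hhB : ∀ x y, |h x y| ≤ B)
    (hg0 : ∀ y, ∫ t, g t y ∂ν = 0) {i j k l : Fin n} (hj : j ≠ i) (hk : k ≠ i) (hl : l ≠ i) :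
    ∫ x, g (x i) (x j) * h (x k) (x l) ∂(Measure.pi fun _ ↦ ν) = 0 := by
  refine integral_pi_eq_zero i ((memLp_kernel_eval hg hgB i j 2).integrable_mul
    (memLp_kernel_eval hh hhB k l 2)) fun x ↦ ?_
  simp only [Function.update_self, Function.update_of_ne hj, Function.update_of_ne hk,
    Function.update_of_ne hl]
  rw [integral_mul_const, hg0, zero_mul]

end Orthogonal

theorem integral_sq_sum_of_orthogonal {Ω ι : Type*} [MeasurableSpace Ω] {P : Measure Ω}
    (s : Finset ι) {G : ι → Ω → ℝ} (hG : ∀ p, MemLp (G p) 2 P)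
    (h0 : ∀ p ∈ s, ∀ q ∈ s, p ≠ q → ∫ ω, G p ω * G q ω ∂P = 0) :
    ∫ ω, (∑ p ∈ s, G p ω) ^ 2 ∂P = ∑ p ∈ s, ∫ ω, G p ω ^ 2 ∂P := by
  classical
  have hi : ∀ p q, Integrable (fun ω ↦ G p ω * G q ω) P := fun p q ↦ (hG p).integrable_mul (hG q)
  simp only [sq, Finset.sum_mul_sum]
  rw [integral_finsetSum _ fun p _ ↦ integrable_finsetSum _ fun q _ ↦ hi p q]
  refine Finset.sum_congr rfl fun p hp ↦ ?_
  rw [integral_finsetSum _ fun q _ ↦ hi p q, Finset.sum_eq_single p]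
  · intro q hq hqp
    exact h0 p hp q hq hqp.symm
  · intro h; exact absurd hp h

theorem sum_lt_eq_sum_filter {n : ℕ} (G : Fin n → Fin n → ℝ) :
    ∑ i, ∑ j, (if i < j then G i j else 0) =
      ∑ p ∈ Finset.univ.filter fun p : Fin n × Fin n ↦ p.1 < p.2, G p.1 p.2 := by
  rw [Finset.sum_filter, Fintype.sum_prod_type]

/-- The second moment of a weighted `U`-statistic with a completely degenerate kernel. -/
theorem integral_sq_degenerate {n : ℕ} {ν : Measure ℝ} [IsProbabilityMeasure ν] {g : ℝ → ℝ → ℝ}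
    {B : ℝ} (hg : Measurable (Function.uncurry g)) (hgB : ∀ x y, |g x y| ≤ B)
    (h1 : ∀ y, ∫ x, g x y ∂ν = 0) (h2 : ∀ x, ∫ y, g x y ∂ν = 0) (a : Fin n → Fin n → ℝ) :
    ∫ x, (∑ i, ∑ j, if i < j then a i j * g (x i) (x j) else 0) ^ 2 ∂(Measure.pi fun _ ↦ ν) =
      (∑ i, ∑ j, if i < j then a i j ^ 2 else 0) * ∫ p : ℝ × ℝ, g p.1 p.2 ^ 2 ∂(ν.prod ν) := by
  have hsw : Measurable (Function.uncurry fun x y ↦ g y x) := hg.comp measurable_swap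
  simp only [fun x : Fin n → ℝ ↦ sum_lt_eq_sum_filter fun i j ↦ a i j * g (x i) (x j)]
  rw [sum_lt_eq_sum_filter, integral_sq_sum_of_orthogonal
    (G := fun (p : Fin n × Fin n) (x : Fin n → ℝ) ↦ a p.1 p.2 * g (x p.1) (x p.2)), Finset.sum_mul]
  · refine Finset.sum_congr rfl fun p hp ↦ ?_
    have hp' : p.1 ≠ p.2 := (Finset.mem_filter.1 hp).2.ne
    simp only [mul_pow]
    rw [integral_const_mul, ← map_pair_pi ν hp', integral_map (f := fun p : ℝ × ℝ ↦ g p.1 p.2 ^ 2)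
      (by fun_prop) ((hg.pow_const 2).aestronglyMeasurable)]
  · exact fun p ↦ (memLp_kernel_eval hg hgB p.1 p.2 2).const_mul _
  · rintro ⟨i, j⟩ hp ⟨k, l⟩ hq hne
    have hij : i < j := (Finset.mem_filter.1 hp).2
    have hkl : k < l := (Finset.mem_filter.1 hq).2
    have e : ∀ x : Fin n → ℝ, a i j * g (x i) (x j) * (a k l * g (x k) (x l)) =
      (a i j * a k l) * (g (x i) (x j) * g (x k) (x l)) := fun x ↦ by ring
    simp only [e]
    rw [integral_const_mul]
    refine mul_eq_zero_of_right _ ?_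
    -- Two different increasing pairs share at most one index, so `i` or `j` is absent from the pair
    -- `(k, l)`.
    by_cases hi : k ≠ i ∧ l ≠ i
    · exact integral_kernel_mul_eq_zero hg hg hgB hgB h1 hij.ne' hi.1 hi.2
    · have hj : k ≠ j ∧ l ≠ j := by
        by_contra hj
        rw [not_and_or, not_not, not_not] at hi hj
        apply hne
        rcases hi with rfl | rfl <;> rcases hj with rfl | rfl
        · exact absurd hij (lt_irrefl _)
        · rfl
        · exact absurd (hij.trans hkl) (lt_irrefl _)
        · exact absurd hij (lt_irrefl _)
      exact integral_kernel_mul_eq_zero hsw hg (fun x y ↦ hgB y x) hgB h2 hij.ne hj.1 hj.2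

/-! Removing the last variable from the bi-alternating statistic. -/

theorem biAlternatingU_castSucc {n : ℕ} (f : ℝ → ℝ → ℝ) (x : Fin (n + 1) → ℝ) :
    biAlternatingU f x = biAlternatingU f (fun i : Fin n ↦ x i.castSucc) +
      ∑ i : Fin n, (-1 : ℝ) ^ ((i : ℕ) + n) * f (x i.castSucc) (x (Fin.last n)) := by
  unfold biAlternatingU
  rw [Fin.sum_univ_castSucc]
  have h0 : ∑ j : Fin (n + 1), (if Fin.last n < j then
      (-1 : ℝ) ^ (((Fin.last n : Fin (n + 1)) : ℕ) + (j : ℕ)) * f (x (Fin.last n)) (x j) else 0)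
      = 0 := Finset.sum_eq_zero fun j _ ↦ if_neg (Fin.le_last j).not_gt
  rw [h0, add_zero, ← Finset.sum_add_distrib]
  refine Finset.sum_congr rfl fun i _ ↦ ?_
  rw [Fin.sum_univ_castSucc, if_pos (Fin.castSucc_lt_last i)]
  simp

theorem abs_sum_neg_one_pow_le (n c : ℕ) : |∑ i : Fin n, (-1 : ℝ) ^ ((i : ℕ) + c)| ≤ 1 := by
  have h : ∑ i : Fin n, (-1 : ℝ) ^ ((i : ℕ) + c) = (-1) ^ c * ∑ i ∈ Finset.range n, (-1 : ℝ) ^ i := by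
    rw [Finset.mul_sum, Finset.sum_range]
    exact Finset.sum_congr rfl fun i _ ↦ by rw [pow_add, mul_comm]
  rw [h, neg_one_geom_sum, abs_mul, abs_pow, abs_neg, abs_one, one_pow, one_mul]
  split_ifs <;> simp

/-- Given the last variable `y`, the summands are independent with common mean `m y` up to sign. The
centred parts are orthogonal, so their sum is at most `2 √n` in `L²`. The alternating signs reduce
the means to a contribution of at most `1`. The bound is `o (n)`, which makes the last variable
negligible after division by `n`. -/
theorem integral_abs_last_le (n : ℕ) :
    ∫ x, |∑ i : Fin n, (-1 : ℝ) ^ ((i : ℕ) + n) * sgnKernel (x i.castSucc) (x (Fin.last n))|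
      ∂(Measure.pi fun _ : Fin (n + 1) ↦ unif) ≤ 1 + 2 * √n := by
  set μ := Measure.pi fun _ : Fin (n + 1) ↦ unif
  set m : ℝ → ℝ := fun y ↦ ∫ t, sgnKernel t y ∂unif with hm
  have hmm : Measurable m :=
    (measurable_sgnKernel.stronglyMeasurable.integral_prod_left' (μ := unif)).measurable
  have hmB : ∀ y, |m y| ≤ 1 := fun y ↦ by
    have := norm_integral_le_of_norm_le_const (μ := unif) (f := fun t ↦ sgnKernel t y)
      (ae_of_all _ fun t ↦ abs_sgnKernel_le t y)
    simpa using this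
  set h : ℝ → ℝ → ℝ := fun x y ↦ sgnKernel x y - m y with hh
  have hhm : Measurable (Function.uncurry h) := measurable_sgnKernel.sub (hmm.comp measurable_snd)
  have hhB : ∀ x y, |h x y| ≤ 2 := fun x y ↦ by
    have h1 := abs_sgnKernel_le x y
    rw [Real.norm_eq_abs] at h1
    have h2 := abs_sub (sgnKernel x y) (m y)
    have h3 := hmB y
    simp only [hh]
    linarith
  have hh0 : ∀ y, ∫ t, h t y ∂unif = 0 := fun y ↦ by
    have hi : Integrable (fun t ↦ sgnKernel t y) unif := Integrable.of_bound
      (measurable_sgnKernel.comp measurable_prodMk_right).aestronglyMeasurable 1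
      (ae_of_all _ fun t ↦ abs_sgnKernel_le t y)
    simp only [hh]
    rw [integral_sub hi (integrable_const _)]
    simp [hm]
  let G : Fin n → (Fin (n + 1) → ℝ) → ℝ := fun i x ↦
    (-1 : ℝ) ^ ((i : ℕ) + n) * h (x i.castSucc) (x (Fin.last n))
  have hGL : ∀ i, MemLp (G i) 2 μ := fun i ↦ (memLp_kernel_eval hhm hhB _ _ 2).const_mul _
  have hsq : ∫ x, (∑ i, G i x) ^ 2 ∂μ ≤ 4 * n := by
    rw [integral_sq_sum_of_orthogonal Finset.univ hGL]
    · calc ∑ i, ∫ x, G i x ^ 2 ∂μ ≤ ∑ i : Fin n, 4 := by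
            refine Finset.sum_le_sum fun i _ ↦ ?_
            have := norm_integral_le_of_norm_le_const (μ := μ) (f := fun x ↦ G i x ^ 2) (C := 4)
              (ae_of_all _ fun x ↦ by
                simp only [G, mul_pow, ← pow_mul, mul_comm _ 2]
                rw [pow_mul, neg_one_sq, one_pow, one_mul, Real.norm_eq_abs, abs_pow]
                calc |h _ _| ^ 2 ≤ 2 ^ 2 := pow_le_pow_left₀ (abs_nonneg _) (hhB _ _) 2
                  _ = 4 := by norm_num)
            have h2 := le_abs_self (∫ x, G i x ^ 2 ∂μ)
            simp only [Real.norm_eq_abs, probReal_univ, mul_one] at this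
            linarith
        _ = 4 * n := by simp; ring
    · intro i _ j _ hij
      have e : ∀ x, G i x * G j x = ((-1 : ℝ) ^ ((i : ℕ) + n) * (-1 : ℝ) ^ ((j : ℕ) + n)) *
        (h (x i.castSucc) (x (Fin.last n)) * h (x j.castSucc) (x (Fin.last n))) :=
        fun x ↦ by simp only [G]; ring
      simp only [e]
      rw [integral_const_mul]
      refine mul_eq_zero_of_right _ (integral_kernel_mul_eq_zero hhm hhm hhB hhB hh0
        (Fin.castSucc_lt_last i).ne' ?_ (Fin.castSucc_lt_last i).ne')
      exact fun h' ↦ hij (Fin.castSucc_injective n h').symm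
  have hGS : MemLp (fun x ↦ ∑ i, G i x) 2 μ := memLp_finsetSum _ fun i _ ↦ hGL i
  have hint : ∀ i : Fin n, Integrable (fun x : Fin (n + 1) → ℝ ↦
      (-1 : ℝ) ^ ((i : ℕ) + n) * sgnKernel (x i.castSucc) (x (Fin.last n))) μ := fun i ↦
    ((memLp_kernel_eval measurable_sgnKernel abs_sgnKernel_le _ _ 1).integrable le_rfl).const_mul _
  calc _ ≤ ∫ x, (|∑ i, G i x| + 1) ∂μ := by
        refine integral_mono (integrable_finsetSum _ fun i _ ↦ hint i).abs
          ((hGS.integrable (by norm_num)).abs.add (integrable_const 1)) fun x ↦ ?_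
        have e : ∑ i : Fin n, (-1 : ℝ) ^ ((i : ℕ) + n) * sgnKernel (x i.castSucc) (x (Fin.last n))
            = ∑ i, G i x + (∑ i : Fin n, (-1 : ℝ) ^ ((i : ℕ) + n)) * m (x (Fin.last n)) := by
          rw [Finset.sum_mul, ← Finset.sum_add_distrib]
          exact Finset.sum_congr rfl fun i _ ↦ by simp only [G, hh]; ring
        simp only [e]
        refine (abs_add_le _ _).trans (add_le_add le_rfl ?_)
        rw [abs_mul]
        exact mul_le_one₀ (abs_sum_neg_one_pow_le n n) (abs_nonneg _) (hmB _)
    _ = ∫ x, |∑ i, G i x| ∂μ + 1 := by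
        rw [integral_add (hGS.integrable (by norm_num)).abs (integrable_const 1)]
        simp
    _ ≤ √(4 * n) + 1 := by
        have := (integral_abs_le_sqrt hGS).trans (Real.sqrt_le_sqrt hsq)
        linarith
    _ = 1 + 2 * √n := by
        rw [Real.sqrt_mul (by norm_num), show (4 : ℝ) = 2 ^ 2 by norm_num,
          Real.sqrt_sq (by norm_num)]
        ring


/-! Fourier series of the sawtooth and of the square wave. -/

theorem integral_cos_add {p : ℤ} (hp : p ≠ 0) (d : ℝ) :
    ∫ v in (0 : ℝ)..1, Real.cos (2 * Real.pi * p * v + d) = 0 := by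
  have ha : 2 * Real.pi * p ≠ 0 :=
    mul_ne_zero (by positivity) (by exact_mod_cast hp)
  rw [intervalIntegral.integral_comp_mul_add (fun v ↦ Real.cos v) ha, integral_cos, mul_zero,
    zero_add, mul_one, show 2 * Real.pi * p + d = d + p * (2 * Real.pi) by ring,
    Real.sin_add_int_mul_two_pi, sub_self, smul_zero]

theorem cos_mul_cos_eq (a b : ℝ) :
    Real.cos a * Real.cos b = (Real.cos (a - b) + Real.cos (a + b)) / 2 := by
  rw [Real.cos_sub, Real.cos_add]; ring

theorem sin_mul_sin_eq (a b : ℝ) :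
    Real.sin a * Real.sin b = (Real.cos (a - b) - Real.cos (a + b)) / 2 := by
  rw [Real.cos_sub, Real.cos_add]; ring

theorem integral_sin_mul_sin {m n : ℕ} (hm : 0 < m) :
    ∫ v in (0 : ℝ)..1, Real.sin (2 * Real.pi * m * v) * Real.sin (2 * Real.pi * n * v) =
      if m = n then 1 / 2 else 0 := by
  have e : ∀ v : ℝ, Real.sin (2 * Real.pi * m * v) * Real.sin (2 * Real.pi * n * v) =
      (1 / 2) * Real.cos (2 * Real.pi * ((m - n : ℤ) : ℝ) * v + 0) -
        (1 / 2) * Real.cos (2 * Real.pi * ((m + n : ℤ) : ℝ) * v + 0) := by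
    intro v
    rw [sin_mul_sin_eq]
    push_cast
    ring_nf
  simp only [e]
  rw [intervalIntegral.integral_sub (Continuous.intervalIntegrable (by fun_prop) _ _)
    (Continuous.intervalIntegrable (by fun_prop) _ _), intervalIntegral.integral_const_mul,
    intervalIntegral.integral_const_mul, integral_cos_add (p := m + n) (by omega)]
  split_ifs with h
  · subst h; simp
  · rw [integral_cos_add (by omega)]; simp

/-- The mean square distance from a function to a partial sum of its sine series. -/
theorem integral_sq_sub_sin_sum {f : ℝ → ℝ} (hf : MemLp f 2 unif) {m : ℕ → ℕ}
    (hm : Function.Injective m) (hm0 : ∀ k, 0 < m k) {b : ℕ → ℝ}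
    (hb : ∀ k, ∫ v in (0 : ℝ)..1, f v * Real.sin (2 * Real.pi * m k * v) = b k / 2) (K : ℕ) :
    ∫ v in (0 : ℝ)..1, (f v - ∑ k ∈ Finset.range K, b k * Real.sin (2 * Real.pi * m k * v)) ^ 2 =
      (∫ v in (0 : ℝ)..1, f v ^ 2) - (∑ k ∈ Finset.range K, b k ^ 2) / 2 ∧
    ∫ v in (0 : ℝ)..1, (∑ k ∈ Finset.range K, b k * Real.sin (2 * Real.pi * m k * v)) ^ 2 =
      (∑ k ∈ Finset.range K, b k ^ 2) / 2 := by
  simp only [← integral_unif] at *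
  set e : ℕ → ℝ → ℝ := fun k v ↦ Real.sin (2 * Real.pi * m k * v) with he
  have heL : ∀ k, MemLp (e k) 2 unif := fun k ↦
    MemLp.of_bound (Continuous.aestronglyMeasurable (by fun_prop)) 1
      (ae_of_all _ fun v ↦ Real.abs_sin_le_one _)
  have hGL : ∀ k, MemLp (fun v ↦ b k * e k v) 2 unif := fun k ↦ (heL k).const_mul _
  have hS : MemLp (fun v ↦ ∑ k ∈ Finset.range K, b k * e k v) 2 unif :=
    memLp_finsetSum _ fun k _ ↦ hGL k
  have h2 : ∫ v, (∑ k ∈ Finset.range K, b k * e k v) ^ 2 ∂unif =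
      (∑ k ∈ Finset.range K, b k ^ 2) / 2 := by
    rw [integral_sq_sum_of_orthogonal _ hGL, Finset.sum_div]
    · refine Finset.sum_congr rfl fun k _ ↦ ?_
      simp only [mul_pow]
      rw [integral_const_mul, integral_unif]
      have := integral_sin_mul_sin (n := m k) (hm0 k)
      simp only [he, sq]
      rw [this, if_pos rfl]
      ring
    · intro p _ q _ hpq
      have e1 : ∀ v, b p * e p v * (b q * e q v) = b p * b q * (e p v * e q v) := fun v ↦ by ring
      simp only [e1]
      rw [integral_const_mul, integral_unif]
      simp only [he]
      rw [integral_sin_mul_sin (hm0 p), if_neg fun h ↦ hpq (hm h), mul_zero]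
  refine ⟨?_, h2⟩
  -- Bessel's identity: the cross term equals the squared norm of the partial sum. The factors `1/2`
  -- are the squared norms of the sines.
  have h1 : ∫ v, f v * (∑ k ∈ Finset.range K, b k * e k v) ∂unif =
      (∑ k ∈ Finset.range K, b k ^ 2) / 2 := by
    simp only [Finset.mul_sum]
    have hi : ∀ k, Integrable (fun v ↦ f v * (b k * e k v)) unif := fun k ↦
      hf.integrable_mul (hGL k)
    rw [integral_finsetSum _ fun k _ ↦ hi k, Finset.sum_div]
    refine Finset.sum_congr rfl fun k _ ↦ ?_
    have e1 : ∀ v, f v * (b k * e k v) = b k * (f v * e k v) := fun v ↦ by ring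
    simp only [e1]
    rw [integral_const_mul, hb k]
    ring
  have e2 : ∀ v, (f v - ∑ k ∈ Finset.range K, b k * e k v) ^ 2 =
      (f v ^ 2 - 2 * (f v * ∑ k ∈ Finset.range K, b k * e k v)) +
        (∑ k ∈ Finset.range K, b k * e k v) ^ 2 := fun v ↦ by ring
  have i1 := hf.integrable_sq
  have i2 : Integrable (fun v ↦ 2 * (f v * ∑ k ∈ Finset.range K, b k * e k v)) unif :=
    (hf.integrable_mul hS).const_mul 2
  have i3 := hS.integrable_sq
  have i12 : Integrable (fun v ↦ f v ^ 2 - 2 * (f v * ∑ k ∈ Finset.range K, b k * e k v)) unif :=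
    i1.sub i2
  change ∫ v, (f v - ∑ k ∈ Finset.range K, b k * e k v) ^ 2 ∂unif = _
  simp only [e2]
  rw [integral_add i12 i3, integral_sub i1 i2, integral_const_mul, h1, h2]
  ring

/-- The sawtooth function, `1 - 2 v` on `(0, 1)`, of period one and odd. -/
noncomputable def sawtooth (v : ℝ) : ℝ := if Int.fract v = 0 then 0 else 1 - 2 * Int.fract v

theorem sawtooth_of_mem {v : ℝ} (hv : v ∈ Set.Ioo (0 : ℝ) 1) : sawtooth v = 1 - 2 * v := by
  have : Int.fract v = v := Int.fract_eq_self.2 ⟨hv.1.le, hv.2⟩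
  rw [sawtooth, this, if_neg hv.1.ne']

theorem sawtooth_neg (v : ℝ) : sawtooth (-v) = -sawtooth v := by
  unfold sawtooth
  by_cases h : Int.fract v = 0
  · rw [if_pos h, if_pos (Int.fract_neg_eq_zero.2 h), neg_zero]
  · rw [if_neg h, if_neg (fun h' ↦ h (Int.fract_neg_eq_zero.1 h')), Int.fract_neg h]
    ring

theorem sawtooth_periodic : Function.Periodic sawtooth 1 := fun v ↦ by
  unfold sawtooth; rw [Int.fract_add_one]

theorem abs_sawtooth_le (v : ℝ) : |sawtooth v| ≤ 1 := by
  unfold sawtooth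
  have h1 := Int.fract_nonneg v
  have h2 := Int.fract_lt_one v
  split_ifs
  · simp
  · rw [abs_le]; constructor <;> linarith

theorem measurable_sawtooth : Measurable sawtooth :=
  Measurable.ite (measurable_fract (measurableSet_singleton 0)) measurable_const
    ((measurable_fract.const_mul 2).const_sub 1)

/-- On `[0, 1)` the sign kernel is the sawtooth of the difference, up to a cocycle. -/
theorem sgnKernel_eq_sawtooth {x y : ℝ} (hx : x ∈ Set.Ico (0 : ℝ) 1) (hy : y ∈ Set.Ico (0 : ℝ) 1) :
    sgnKernel x y = sawtooth (x - y) + (2 * x - 2 * y) := by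
  have key : ∀ a ∈ Set.Ico (0 : ℝ) 1, ∀ b ∈ Set.Ico (0 : ℝ) 1, a < b →
      sgnKernel b a = sawtooth (b - a) + (2 * b - 2 * a) := fun a ha b hb hab ↦ by
    rw [sgnKernel, Real.sign_of_pos (by linarith),
      sawtooth_of_mem ⟨by linarith, by linarith [ha.1, hb.2]⟩]
    ring
  rcases lt_trichotomy x y with h | h | h
  · rw [sgnKernel_antisymm, key x hx y hy h, ← neg_sub y x, sawtooth_neg]
    ring
  · subst h; simp [sgnKernel, sawtooth]
  · exact key y hy x hx h

theorem ae_unif_mem_Ioo : ∀ᵐ v ∂unif, v ∈ Set.Ioo (0 : ℝ) 1 := by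
  have : unif = volume.restrict (Set.Ioo (0 : ℝ) 1) := by
    rw [unif, restrict_Ioo_eq_restrict_Icc]
  rw [this]
  exact ae_restrict_mem measurableSet_Ioo

theorem integral_congr_Ioo {f g : ℝ → ℝ} (h : ∀ v ∈ Set.Ioo (0 : ℝ) 1, f v = g v) :
    ∫ v in (0 : ℝ)..1, f v = ∫ v in (0 : ℝ)..1, g v := by
  rw [← integral_unif, ← integral_unif]
  refine integral_congr_ae ?_
  filter_upwards [ae_unif_mem_Ioo] with v hv using h v hv

theorem integral_sawtooth : ∫ v in (0 : ℝ)..1, sawtooth v = 0 := by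
  rw [integral_congr_Ioo fun v hv ↦ sawtooth_of_mem hv,
    intervalIntegral.integral_sub (Continuous.intervalIntegrable (by fun_prop) _ _)
    (Continuous.intervalIntegrable (by fun_prop) _ _), intervalIntegral.integral_const_mul,
    integral_id]
  norm_num

theorem integral_sawtooth_sq : ∫ v in (0 : ℝ)..1, sawtooth v ^ 2 = 1 / 3 := by
  rw [integral_congr_Ioo (g := fun v ↦ (1 - 2 * v) ^ 2) fun v hv ↦ by rw [sawtooth_of_mem hv]]
  have hd : ∀ v : ℝ, HasDerivAt (fun v : ℝ ↦ -(1 - 2 * v) ^ 3 / 6) ((1 - 2 * v) ^ 2) v := by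
    intro v
    refine (((((hasDerivAt_id v).const_mul 2).const_sub 1).pow 3).neg.div_const 6).congr_deriv ?_
    simp
    ring
  rw [intervalIntegral.integral_eq_sub_of_hasDerivAt (fun v _ ↦ hd v)
    (Continuous.intervalIntegrable (by fun_prop) _ _)]
  norm_num

theorem integral_sawtooth_mul_sin {m : ℕ} (hm : 0 < m) :
    ∫ v in (0 : ℝ)..1, sawtooth v * Real.sin (2 * Real.pi * m * v) = 2 / (Real.pi * m) / 2 := by
  set a : ℝ := 2 * Real.pi * m with ha'
  have hm' : (0 : ℝ) < m := by exact_mod_cast hm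
  have ha : a ≠ 0 := by have := Real.pi_pos; positivity
  rw [integral_congr_Ioo (g := fun v ↦ (1 - 2 * v) * Real.sin (a * v))
    fun v hv ↦ by rw [sawtooth_of_mem hv]]
  have hd : ∀ v : ℝ, HasDerivAt
      (fun v : ℝ ↦ -((1 - 2 * v) * Real.cos (a * v)) / a - 2 * Real.sin (a * v) / a ^ 2)
      ((1 - 2 * v) * Real.sin (a * v)) v := by
    intro v
    have h1 : HasDerivAt (fun v : ℝ ↦ a * v) (a * 1) v := (hasDerivAt_id v).const_mul a
    have h2 : HasDerivAt (fun v : ℝ ↦ 1 - 2 * v) (-(2 * 1)) v :=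
      ((hasDerivAt_id v).const_mul 2).const_sub 1
    refine (((h2.mul h1.cos).neg.div_const a).sub ((h1.sin.const_mul 2).div_const
      (a ^ 2))).congr_deriv ?_
    field_simp
    ring
  rw [intervalIntegral.integral_eq_sub_of_hasDerivAt (fun v _ ↦ hd v)
    (Continuous.intervalIntegrable (by fun_prop) _ _)]
  have hc : Real.cos a = 1 := by
    rw [ha', mul_comm]; exact Real.cos_nat_mul_two_pi m
  have hs : Real.sin a = 0 := by
    rw [ha', mul_comm, ← Real.sin_zero, ← Real.sin_add_nat_mul_two_pi 0 m, zero_add]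
  simp only [mul_one, mul_zero, hc, hs, Real.cos_zero, Real.sin_zero]
  rw [ha']
  field_simp
  ring

/-- Partial sums of the Fourier series of the sawtooth. -/
noncomputable def sawtoothSum (K : ℕ) (v : ℝ) : ℝ :=
  ∑ k ∈ Finset.range K, 2 / (Real.pi * (k + 1 : ℕ)) * Real.sin (2 * Real.pi * (k + 1 : ℕ) * v)

/-- The square wave `sgn (1 - 2 v)` on `(0, 1)`. -/
noncomputable def squareWave (v : ℝ) : ℝ := Real.sign (1 - 2 * v)

/-- Partial sums of the Fourier series of the square wave. -/
noncomputable def squareWaveSum (L : ℕ) (v : ℝ) : ℝ :=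
  ∑ l ∈ Finset.range L,
    4 / (Real.pi * (2 * l + 1 : ℕ)) * Real.sin (2 * Real.pi * (2 * l + 1 : ℕ) * v)

theorem memLp_sawtooth : MemLp sawtooth 2 unif :=
  MemLp.of_bound measurable_sawtooth.aestronglyMeasurable 1 (ae_of_all _ abs_sawtooth_le)

/-- No completeness theorem is needed: the squared norms match exactly, `1/3 = (2 / π²) ∑ 1 / k²`,
by the Basel sum. The uniform bound `1` on the partial sums later keeps the time truncation error
independent of `K`. -/
theorem tendsto_sawtoothSum :
    (∀ K, ∫ v in (0 : ℝ)..1, sawtoothSum K v ^ 2 ≤ 1) ∧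
    Tendsto (fun K ↦ ∫ v in (0 : ℝ)..1, (sawtooth v - sawtoothSum K v) ^ 2) atTop (𝓝 0) := by
  have h := integral_sq_sub_sin_sum memLp_sawtooth (m := fun k ↦ k + 1) (add_left_injective 1)
    (fun k ↦ Nat.succ_pos k) (b := fun k ↦ 2 / (Real.pi * (k + 1 : ℕ)))
    fun k ↦ integral_sawtooth_mul_sin (Nat.succ_pos k)
  rw [integral_sawtooth_sq] at h
  constructor
  · intro K
    have h1 := (h K).1
    have h2 : 0 ≤ ∫ v in (0 : ℝ)..1, (sawtooth v - sawtoothSum K v) ^ 2 :=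
      intervalIntegral.integral_nonneg zero_le_one fun v _ ↦ sq_nonneg _
    simp only [sawtoothSum] at h2 ⊢
    rw [(h K).2]
    linarith
  · have hs : HasSum (fun k : ℕ ↦ 1 / ((k + 1 : ℕ) : ℝ) ^ 2) (Real.pi ^ 2 / 6) := by
      have := (hasSum_nat_add_iff' 1).2 hasSum_zeta_two
      simpa using this
    have ht := ((hs.tendsto_sum_nat.const_mul (2 / Real.pi ^ 2)).const_sub (1 / 3))
    have e0 : (1 : ℝ) / 3 - 2 / Real.pi ^ 2 * (Real.pi ^ 2 / 6) = 0 := by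
      field_simp [Real.pi_ne_zero]; ring
    rw [e0] at ht
    refine ht.congr fun K ↦ ?_
    simp only [sawtoothSum]
    rw [(h K).1, Finset.mul_sum, Finset.sum_div]
    congr 1
    refine Finset.sum_congr rfl fun k _ ↦ ?_
    field_simp

theorem measurable_squareWave : Measurable squareWave :=
  (measurable_sgnKernel.comp (measurable_const.prodMk measurable_id) : Measurable fun v ↦
    sgnKernel 1 v).comp (measurable_const_mul 2)

theorem abs_squareWave_le (v : ℝ) : |squareWave v| ≤ 1 := abs_sgnKernel_le 1 (2 * v)

theorem memLp_squareWave : MemLp squareWave 2 unif :=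
  MemLp.of_bound measurable_squareWave.aestronglyMeasurable 1 (ae_of_all _ abs_squareWave_le)

theorem integral_squareWave_mul (g : ℝ → ℝ) (hg : Continuous g) :
    ∫ v in (0 : ℝ)..1, squareWave v * g v =
      (∫ v in (0 : ℝ)..(1 / 2), g v) - ∫ v in (1 / 2 : ℝ)..1, g v := by
  have h1 : ∀ᵐ v ∂volume.restrict (Set.uIoc (0 : ℝ) (1 / 2)), g v = squareWave v * g v := by
    rw [Set.uIoc_of_le (by norm_num), ← restrict_Ioo_eq_restrict_Ioc]
    refine (ae_restrict_iff' measurableSet_Ioo).2 (ae_of_all _ fun v hv ↦ ?_)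
    rw [squareWave, Real.sign_of_pos (by linarith [hv.2]), one_mul]
  have h2 : ∀ᵐ v ∂volume.restrict (Set.uIoc (1 / 2 : ℝ) 1), -g v = squareWave v * g v := by
    rw [Set.uIoc_of_le (by norm_num), ← restrict_Ioo_eq_restrict_Ioc]
    refine (ae_restrict_iff' measurableSet_Ioo).2 (ae_of_all _ fun v hv ↦ ?_)
    rw [squareWave, Real.sign_of_neg (by linarith [hv.1]), neg_one_mul]
  rw [← intervalIntegral.integral_add_adjacent_intervals
    ((hg.intervalIntegrable 0 (1 / 2)).congr_ae h1)
    ((hg.neg.intervalIntegrable (1 / 2) 1).congr_ae h2),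
    ← intervalIntegral.integral_congr_ae_restrict h1,
    ← intervalIntegral.integral_congr_ae_restrict h2, intervalIntegral.integral_neg]
  ring

theorem integral_squareWave_sq : ∫ v in (0 : ℝ)..1, squareWave v ^ 2 = 1 := by
  have h : ∀ᵐ v ∂unif, squareWave v ^ 2 = 1 := by
    have h0 : ∀ᵐ v ∂unif, v ≠ 1 / 2 := by
      simp [ae_iff]
    filter_upwards [h0] with v hv
    rcases Real.sign_apply_eq_of_ne_zero (1 - 2 * v) (fun h ↦ hv (by linarith)) with h | h <;>
    simp [squareWave, h]
  rw [← integral_unif, integral_congr_ae h]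
  simp

theorem integral_squareWave_mul_sin (l : ℕ) :
    ∫ v in (0 : ℝ)..1, squareWave v * Real.sin (2 * Real.pi * (2 * l + 1 : ℕ) * v) =
      4 / (Real.pi * (2 * l + 1 : ℕ)) / 2 := by
  rw [integral_squareWave_mul _ (by fun_prop)]
  have ha : 2 * Real.pi * ((2 * l + 1 : ℕ) : ℝ) ≠ 0 := by have := Real.pi_pos; positivity
  simp only [intervalIntegral.integral_comp_mul_left (fun v ↦ Real.sin v) ha, integral_sin]
  have e1 : Real.cos (2 * Real.pi * ((2 * l + 1 : ℕ) : ℝ) * (1 / 2)) = -1 := by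
    rw [show 2 * Real.pi * ((2 * l + 1 : ℕ) : ℝ) * (1 / 2) = Real.pi + l * (2 * Real.pi) by
      push_cast; ring, Real.cos_add_nat_mul_two_pi, Real.cos_pi]
  have e2 : Real.cos (2 * Real.pi * ((2 * l + 1 : ℕ) : ℝ) * 1) = 1 := by
    rw [mul_one, mul_comm]; exact Real.cos_nat_mul_two_pi _
  rw [e1, e2, mul_zero, Real.cos_zero, smul_eq_mul, smul_eq_mul]
  field_simp
  norm_num

/-- The even terms make up a quarter of `π² / 6`; the odd terms are the rest. -/
theorem hasSum_odd_sq : HasSum (fun l : ℕ ↦ 1 / ((2 * l + 1 : ℕ) : ℝ) ^ 2) (Real.pi ^ 2 / 8) := by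
  have h := hasSum_zeta_two
  have he : HasSum (fun l : ℕ ↦ 1 / ((2 * l : ℕ) : ℝ) ^ 2) (1 / 4 * (Real.pi ^ 2 / 6)) := by
    refine (h.mul_left (1 / 4)).congr_fun ?_
    intro l
    push_cast
    rw [mul_pow, one_div, one_div, one_div, mul_inv]
    norm_num
  have ho : Summable (fun l : ℕ ↦ 1 / ((2 * l + 1 : ℕ) : ℝ) ^ 2) :=
    h.summable.comp_injective (i := fun l : ℕ ↦ 2 * l + 1) fun a b hab ↦ by
      simpa using hab
  have h3 := HasSum.even_add_odd (f := fun n : ℕ ↦ 1 / (n : ℝ) ^ 2) he ho.hasSum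
  have h4 := h3.unique h
  have h5 := ho.hasSum
  rwa [show ∑' l : ℕ, 1 / ((2 * l + 1 : ℕ) : ℝ) ^ 2 = Real.pi ^ 2 / 8 by linarith] at h5

/-- As for the sawtooth, the norms match: `1 = (8 / π²) ∑ 1 / (2 l + 1)²`. -/
theorem tendsto_squareWaveSum :
    Tendsto (fun L ↦ ∫ v in (0 : ℝ)..1, (squareWave v - squareWaveSum L v) ^ 2) atTop (𝓝 0) := by
  have h := integral_sq_sub_sin_sum memLp_squareWave (m := fun l ↦ 2 * l + 1)
    (fun a b hab ↦ by simpa using hab)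
    (fun l ↦ Nat.succ_pos _) (b := fun l ↦ 4 / (Real.pi * (2 * l + 1 : ℕ)))
    integral_squareWave_mul_sin
  rw [integral_squareWave_sq] at h
  have ht := ((hasSum_odd_sq.tendsto_sum_nat.const_mul (8 / Real.pi ^ 2)).const_sub 1)
  have e0 : (1 : ℝ) - 8 / Real.pi ^ 2 * (Real.pi ^ 2 / 8) = 0 := by
    field_simp [Real.pi_ne_zero]; ring
  rw [e0] at ht
  refine ht.congr fun L ↦ ?_
  simp only [squareWaveSum]
  rw [(h L).1, Finset.mul_sum, Finset.sum_div]
  congr 1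
  refine Finset.sum_congr rfl fun l _ ↦ ?_
  field_simp
  ring


/-! ### Riemann sums. -/

/-- Left Riemann sums of a bounded, almost everywhere continuous function. -/
theorem tendsto_riemann_sum {h : ℝ → ℝ} (hm : Measurable h) {C : ℝ} (hC : ∀ v, |h v| ≤ C)
    (hc : ∀ᵐ u ∂unif, ContinuousAt h u) :
    Tendsto (fun n : ℕ ↦ (n : ℝ)⁻¹ * ∑ d ∈ Finset.range n, h (d / n)) atTop
      (𝓝 (∫ v in (0 : ℝ)..1, h v)) := by
  have hsm : ∀ n : ℕ, Measurable fun u : ℝ ↦ h (⌊u * n⌋₊ / n) := fun n ↦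
    hm.comp (((measurable_from_top (f := fun k : ℕ ↦ (k : ℝ))).comp
      (Nat.measurable_floor.comp (measurable_mul_const _))).div_const _)
  have hii : ∀ (n : ℕ) (a b : ℝ),
      IntervalIntegrable (fun u : ℝ ↦ h (⌊u * n⌋₊ / n)) volume a b := fun n a b ↦ by
    rw [intervalIntegrable_iff]
    exact Measure.integrableOn_of_bounded (M := C) (by simp) (hsm n).aestronglyMeasurable
      (ae_of_all _ fun u ↦ hC _)
  -- The Riemann sum is the integral of the step function `h (⌊u n⌋ / n)`, which is bounded and
  -- converges to `h u` at every continuity point; dominated convergence does the rest.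
  have key : ∀ n : ℕ, 0 < n → ∫ u in (0 : ℝ)..1, h (⌊u * n⌋₊ / n) =
      (n : ℝ)⁻¹ * ∑ d ∈ Finset.range n, h (d / n) := by
    intro n hn
    have hn' : (0 : ℝ) < n := by exact_mod_cast hn
    have h1 := intervalIntegral.sum_integral_adjacent_intervals
      (a := fun k : ℕ ↦ (k : ℝ) / n) (n := n) (μ := volume)
      (f := fun u : ℝ ↦ h (⌊u * n⌋₊ / n)) fun k _ ↦ hii n _ _
    simp only [Nat.cast_zero, zero_div, div_self hn'.ne'] at h1
    rw [← h1, Finset.mul_sum]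
    refine Finset.sum_congr rfl fun d _ ↦ ?_
    have hle : (d : ℝ) / n ≤ ((d + 1 : ℕ) : ℝ) / n := by
      gcongr; exact_mod_cast Nat.le_succ d
    have h2 : ∀ᵐ u : ℝ ∂volume.restrict (Set.uIoc ((d : ℝ) / n) (((d + 1 : ℕ) : ℝ) / n)),
        h (⌊u * n⌋₊ / n) = h (d / n) := by
      rw [Set.uIoc_of_le hle, ← restrict_Ioo_eq_restrict_Ioc]
      refine (ae_restrict_iff' measurableSet_Ioo).2 (ae_of_all _ fun u hu ↦ ?_)
      have e : ⌊u * n⌋₊ = d := by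
        have h3 := (div_lt_iff₀ hn').1 hu.1
        have h4 := (lt_div_iff₀ hn').1 hu.2
        push_cast at h4
        exact (Nat.floor_eq_iff (by linarith [(Nat.cast_nonneg d : (0 : ℝ) ≤ d)])).2
          ⟨h3.le, h4⟩
      rw [e]
    rw [intervalIntegral.integral_congr_ae_restrict h2, intervalIntegral.integral_const,
      smul_eq_mul]
    push_cast
    field_simp
    ring
  have hlim : Tendsto (fun n : ℕ ↦ ∫ u, h (⌊u * n⌋₊ / n) ∂unif) atTop (𝓝 (∫ u, h u ∂unif)) := by
    refine tendsto_integral_of_dominated_convergence (fun _ ↦ C)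
      (fun n ↦ (hsm n).aestronglyMeasurable) (integrable_const C)
      (fun n ↦ ae_of_all _ fun u ↦ hC _) ?_
    filter_upwards [hc, ae_unif_mem] with u hu hu'
    exact hu.tendsto.comp
      ((tendsto_nat_floor_mul_div_atTop hu'.1).comp tendsto_natCast_atTop_atTop)
  rw [← integral_unif]
  refine hlim.congr' ?_
  filter_upwards [eventually_gt_atTop 0] with n hn
  rw [integral_unif, key n hn]

/-! Periodic kernels. -/

section Periodic

variable {ψ : ℝ → ℝ}

theorem integral_periodic_sub (hp : Function.Periodic ψ 1) (y : ℝ) :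
    ∫ x, ψ (x - y) ∂unif = ∫ v in (0 : ℝ)..1, ψ v := by
  rw [integral_unif, intervalIntegral.integral_comp_sub_right, zero_sub,
    show (1 : ℝ) - y = -y + 1 by ring, hp.intervalIntegral_add_eq (-y) 0, zero_add]

theorem integral_periodic_sub' (hp : Function.Periodic ψ 1) (x : ℝ) :
    ∫ y, ψ (x - y) ∂unif = ∫ v in (0 : ℝ)..1, ψ v := by
  rw [integral_unif, intervalIntegral.integral_comp_sub_left, sub_zero]
  have := hp.intervalIntegral_add_eq (x - 1) 0
  rwa [sub_add_cancel, zero_add] at this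

/-- Period one and mean zero make `ψ (x - y)` integrate to zero in each variable separately, so
distinct pairs are orthogonal and the second moment is the sum of squared weights times `∫ ψ²`. -/
theorem integral_abs_periodic_le (hp : Function.Periodic ψ 1) (hm : Measurable ψ) {B : ℝ}
    (hB : ∀ v, |ψ v| ≤ B) (h0 : ∫ v in (0 : ℝ)..1, ψ v = 0) {n : ℕ} (a : Fin n → Fin n → ℝ) :
    MemLp (fun x : Fin n → ℝ ↦ ∑ i, ∑ j, if i < j then a i j * ψ (x i - x j) else 0) 2
      (Measure.pi fun _ ↦ unif) ∧
    ∫ x : Fin n → ℝ, |∑ i, ∑ j, if i < j then a i j * ψ (x i - x j) else 0|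
      ∂(Measure.pi fun _ ↦ unif) ≤
    √((∑ i, ∑ j, if i < j then a i j ^ 2 else 0) * ∫ v in (0 : ℝ)..1, ψ v ^ 2) := by
  have hg : Measurable (Function.uncurry fun x y ↦ ψ (x - y)) :=
    hm.comp (measurable_fst.sub measurable_snd)
  have hgB : ∀ x y : ℝ, |ψ (x - y)| ≤ B := fun x y ↦ hB _
  have hL : MemLp (fun x : Fin n → ℝ ↦ ∑ i, ∑ j, if i < j then a i j * ψ (x i - x j) else 0) 2
      (Measure.pi fun _ ↦ unif) := by
    refine memLp_finsetSum _ fun i _ ↦ memLp_finsetSum _ fun j _ ↦ ?_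
    split_ifs
    · exact (memLp_kernel_eval hg hgB i j 2).const_mul _
    · exact MemLp.zero'
  have h2 := integral_sq_degenerate (n := n) (ν := unif) hg hgB
    (fun y ↦ by rw [integral_periodic_sub hp, h0]) (fun x ↦ by rw [integral_periodic_sub' hp, h0]) a
  have hint : Integrable (fun p : ℝ × ℝ ↦ ψ (p.1 - p.2) ^ 2) (unif.prod unif) :=
    Integrable.of_bound (hg.pow_const 2).aestronglyMeasurable (B ^ 2) (ae_of_all _ fun p ↦ by
      rw [Real.norm_eq_abs, abs_pow]
      exact pow_le_pow_left₀ (abs_nonneg _) (hB _) 2)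
  have h3 : ∫ p : ℝ × ℝ, ψ (p.1 - p.2) ^ 2 ∂(unif.prod unif) = ∫ v in (0 : ℝ)..1, ψ v ^ 2 := by
    rw [integral_prod _ hint]
    have hp2 : Function.Periodic (fun v ↦ ψ v ^ 2) 1 := fun v ↦ by simp only [hp v]
    simp only [fun x ↦ integral_periodic_sub' hp2 x]
    simp
  rw [h3] at h2
  refine ⟨hL, (integral_abs_le_sqrt hL).trans (le_of_eq ?_)⟩
  rw [h2]

end Periodic

/-! ### Truncation of the statistic in both Fourier expansions. -/

theorem sum_lt_sub_le {n : ℕ} {h : ℝ → ℝ} (hh : ∀ v, 0 ≤ h v) :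
    ∑ i : Fin n, ∑ j : Fin n, (if i < j then h (((j : ℕ) - (i : ℕ) : ℝ) / n) else 0) ≤
      n * ∑ d ∈ Finset.range n, h (d / n) := by
  have key : ∀ i : Fin n, ∑ j : Fin n, (if i < j then h (((j : ℕ) - (i : ℕ) : ℝ) / n) else 0) ≤
      ∑ d ∈ Finset.range n, h (d / n) := by
    intro i
    -- For a fixed `i` the cyclic differences `j - i` run through `0, …, n - 1` once each. The pairs
    -- `i < j` contribute only some of these terms, and all terms are nonnegative.
    have e : ∑ j : Fin n, h (((j - i : Fin n) : ℕ) / n) = ∑ d ∈ Finset.range n, h (d / n) := by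
      rw [Finset.sum_range, ← sum_fin_add_left i]
      simp only [fin_add_sub_cancel]
    rw [← e]
    refine Finset.sum_le_sum fun j _ ↦ ?_
    split_ifs with hij
    · rw [(val_sub_of_lt hij).1, Nat.cast_sub (by exact_mod_cast hij.le)]
    · exact hh _
  calc _ ≤ ∑ _i : Fin n, ∑ d ∈ Finset.range n, h (d / n) := Finset.sum_le_sum fun i _ ↦ key i
    _ = _ := by simp

/-- The bilinear truncation of the cyclic statistic of the sawtooth kernel. -/
noncomputable def truncU (K L : ℕ) {n : ℕ} (x : Fin n → ℝ) : ℝ :=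
  ∑ i : Fin n, ∑ j : Fin n, if i < j then
    squareWaveSum L (((j : ℕ) - (i : ℕ) : ℝ) / n) * sawtoothSum K (x i - x j) else 0

theorem continuous_sawtoothSum (K : ℕ) : Continuous (sawtoothSum K) := by
  unfold sawtoothSum; fun_prop

theorem continuous_squareWaveSum (L : ℕ) : Continuous (squareWaveSum L) := by
  unfold squareWaveSum; fun_prop

theorem abs_sum_mul_sin_le (s : Finset ℕ) (b c : ℕ → ℝ) :
    |∑ k ∈ s, b k * Real.sin (c k)| ≤ ∑ k ∈ s, |b k| := by
  refine (Finset.abs_sum_le_sum_abs _ _).trans (Finset.sum_le_sum fun k _ ↦ ?_)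
  rw [abs_mul]
  exact mul_le_of_le_one_right (abs_nonneg _) (Real.abs_sin_le_one _)

theorem exists_abs_sawtoothSum_le (K : ℕ) : ∃ B, ∀ v, |sawtoothSum K v| ≤ B :=
  ⟨_, fun _ ↦ abs_sum_mul_sin_le _ _ _⟩

theorem exists_abs_squareWaveSum_le (L : ℕ) : ∃ B, ∀ v, |squareWaveSum L v| ≤ B :=
  ⟨_, fun _ ↦ abs_sum_mul_sin_le _ _ _⟩

theorem sawtoothSum_periodic (K : ℕ) : Function.Periodic (sawtoothSum K) 1 := fun v ↦ by
  unfold sawtoothSum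
  refine Finset.sum_congr rfl fun k _ ↦ ?_
  rw [show 2 * Real.pi * ((k + 1 : ℕ) : ℝ) * (v + 1) =
    2 * Real.pi * ((k + 1 : ℕ) : ℝ) * v + ((k + 1 : ℕ) : ℝ) * (2 * Real.pi) by ring,
    Real.sin_add_nat_mul_two_pi]

theorem integral_sawtoothSum (K : ℕ) : ∫ v in (0 : ℝ)..1, sawtoothSum K v = 0 := by
  unfold sawtoothSum
  rw [intervalIntegral.integral_finsetSum fun k _ ↦
    Continuous.intervalIntegrable (by fun_prop) _ _]
  refine Finset.sum_eq_zero fun k _ ↦ ?_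
  have h := integral_cos_add (p := k + 1) (by omega) (-(Real.pi / 2))
  simp only [← sub_eq_add_neg, Real.cos_sub_pi_div_two] at h
  rw [intervalIntegral.integral_const_mul]
  push_cast at h ⊢
  rw [h, mul_zero]

/-- The mean distance between the statistic and its truncation. -/
theorem integral_abs_sub_truncU_le (K L : ℕ) {n : ℕ} :
    Integrable (fun x : Fin n → ℝ ↦ cyclicU (fun a b ↦ sawtooth (a - b)) x)
      (Measure.pi fun _ ↦ unif) ∧
    Integrable (fun x : Fin n → ℝ ↦ truncU K L x) (Measure.pi fun _ ↦ unif) ∧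
    (n : ℝ)⁻¹ * ∫ x : Fin n → ℝ, |cyclicU (fun a b ↦ sawtooth (a - b)) x - truncU K L x|
      ∂(Measure.pi fun _ ↦ unif) ≤
    √(∫ v in (0 : ℝ)..1, (sawtooth v - sawtoothSum K v) ^ 2) +
      √((n : ℝ)⁻¹ * ∑ d ∈ Finset.range n,
        (squareWave (d / n) - squareWaveSum L (d / n)) ^ 2) := by
  rcases Nat.eq_zero_or_pos n with rfl | hn
  · refine ⟨?_, ?_, ?_⟩
    · simp [cyclicU]
    · simp [truncU]
    · simp only [Nat.cast_zero, inv_zero, zero_mul]; positivity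
  have hn' : (0 : ℝ) < n := by exact_mod_cast hn
  obtain ⟨B, hB⟩ := exists_abs_sawtoothSum_le K
  let s : Fin n → Fin n → ℝ := fun i j ↦ squareWave (((j : ℕ) - (i : ℕ) : ℝ) / n)
  let r : Fin n → Fin n → ℝ := fun i j ↦ squareWaveSum L (((j : ℕ) - (i : ℕ) : ℝ) / n)
  have hU : ∀ x : Fin n → ℝ, cyclicU (fun a b ↦ sawtooth (a - b)) x =
      ∑ i, ∑ j, if i < j then s i j * sawtooth (x i - x j) else 0 := fun x ↦
    cyclicU_eq_sum_lt (fun a b ↦ by rw [← neg_sub b a, sawtooth_neg]) x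
  have h1 := integral_abs_periodic_le (ψ := fun v ↦ sawtooth v - sawtoothSum K v)
    (fun v ↦ by simp only [sawtooth_periodic v, sawtoothSum_periodic K v])
    (measurable_sawtooth.sub (continuous_sawtoothSum K).measurable) (B := 1 + B)
    (fun v ↦ (abs_sub _ _).trans (add_le_add (abs_sawtooth_le v) (hB v)))
    (by
      rw [intervalIntegral.integral_sub, integral_sawtooth, integral_sawtoothSum, sub_zero]
      · exact integrable_unif_iff.1 (memLp_sawtooth.integrable (by norm_num))
      · exact (continuous_sawtoothSum K).intervalIntegrable _ _) s
  have h2 := integral_abs_periodic_le (sawtoothSum_periodic K)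
    (continuous_sawtoothSum K).measurable hB (integral_sawtoothSum K) fun i j ↦ s i j - r i j
  have h3 := integral_abs_periodic_le (sawtoothSum_periodic K)
    (continuous_sawtoothSum K).measurable hB (integral_sawtoothSum K) r
  have h4 := integral_abs_periodic_le sawtooth_periodic measurable_sawtooth abs_sawtooth_le
    integral_sawtooth s
  -- First the sawtooth is truncated with the exact weights, then the weights are truncated with the
  -- kernel already truncated. Both errors have a degenerate periodic kernel.
  have e : ∀ x : Fin n → ℝ, cyclicU (fun a b ↦ sawtooth (a - b)) x - truncU K L x =
      (∑ i, ∑ j, if i < j then s i j * (sawtooth (x i - x j) - sawtoothSum K (x i - x j)) else 0)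
      + ∑ i, ∑ j, if i < j then (s i j - r i j) * sawtoothSum K (x i - x j) else 0 := by
    intro x
    rw [hU, truncU]
    simp only [← Finset.sum_sub_distrib, ← Finset.sum_add_distrib]
    refine Finset.sum_congr rfl fun i _ ↦ Finset.sum_congr rfl fun j _ ↦ ?_
    split_ifs
    · simp only [s, r]; ring
    · simp
  have i1 := (h1.1.integrable (by norm_num)).abs
  have i2 := (h2.1.integrable (by norm_num)).abs
  refine ⟨?_, h3.1.integrable (by norm_num), ?_⟩
  · simp only [hU]; exact h4.1.integrable (by norm_num)
  have hs : ∑ i, ∑ j, (if i < j then s i j ^ 2 else 0) ≤ (n : ℝ) ^ 2 := by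
    calc _ ≤ ∑ i : Fin n, ∑ j : Fin n, (1 : ℝ) := by
          refine Finset.sum_le_sum fun i _ ↦ Finset.sum_le_sum fun j _ ↦ ?_
          split_ifs
          · exact (sq_le_one_iff_abs_le_one _).2 (abs_squareWave_le _)
          · exact zero_le_one
      _ = _ := by simp [sq]
  -- The squared weight errors form a Riemann sum for the mean square error of the square wave
  -- series.
  have hr : ∑ i, ∑ j, (if i < j then (s i j - r i j) ^ 2 else 0) ≤
      (n : ℝ) ^ 2 * ((n : ℝ)⁻¹ * ∑ d ∈ Finset.range n,
        (squareWave (d / n) - squareWaveSum L (d / n)) ^ 2) := by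
    refine (sum_lt_sub_le (n := n) (h := fun v : ℝ ↦ (squareWave v - squareWaveSum L v) ^ 2)
      fun v ↦ sq_nonneg _).trans (le_of_eq ?_)
    field_simp
  have hA : 0 ≤ ∫ v in (0 : ℝ)..1, (sawtooth v - sawtoothSum K v) ^ 2 :=
    intervalIntegral.integral_nonneg zero_le_one fun v _ ↦ sq_nonneg _
  have hK : 0 ≤ ∫ v in (0 : ℝ)..1, sawtoothSum K v ^ 2 :=
    intervalIntegral.integral_nonneg zero_le_one fun v _ ↦ sq_nonneg _
  have hR : 0 ≤ (n : ℝ)⁻¹ * ∑ d ∈ Finset.range n,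
      (squareWave (d / n) - squareWaveSum L (d / n)) ^ 2 :=
    mul_nonneg (by positivity) (Finset.sum_nonneg fun _ _ ↦ sq_nonneg _)
  have hsqrt : ∀ c : ℝ, n * √c = √((n : ℝ) ^ 2 * c) := fun c ↦ by
    rw [Real.sqrt_mul (sq_nonneg _), Real.sqrt_sq hn'.le]
  have hbound : ∫ x : Fin n → ℝ, |cyclicU (fun a b ↦ sawtooth (a - b)) x - truncU K L x|
      ∂(Measure.pi fun _ ↦ unif) ≤
      n * √(∫ v in (0 : ℝ)..1, (sawtooth v - sawtoothSum K v) ^ 2) +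
      n * √((n : ℝ)⁻¹ * ∑ d ∈ Finset.range n,
        (squareWave (d / n) - squareWaveSum L (d / n)) ^ 2) := by
    calc _ ≤ ∫ x : Fin n → ℝ,
          (|∑ i, ∑ j, if i < j then s i j * (sawtooth (x i - x j) - sawtoothSum K (x i - x j))
            else 0| + |∑ i, ∑ j, if i < j then (s i j - r i j) * sawtoothSum K (x i - x j) else 0|)
          ∂(Measure.pi fun _ ↦ unif) := by
          refine integral_mono_of_nonneg (ae_of_all _ fun x ↦ abs_nonneg _) (i1.add i2)
            (ae_of_all _ fun x ↦ ?_)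
          simp only [e x]
          exact abs_add_le _ _
      _ ≤ _ := by
          rw [integral_add i1 i2]
          refine add_le_add (h1.2.trans ?_) (h2.2.trans ?_)
          · rw [hsqrt]
            exact Real.sqrt_le_sqrt (mul_le_mul_of_nonneg_right hs hA)
          · rw [hsqrt]
            refine Real.sqrt_le_sqrt ?_
            calc _ ≤ _ * 1 := mul_le_mul hr (tendsto_sawtoothSum.1 K) hK
                  (mul_nonneg (sq_nonneg _) hR)
              _ = _ := mul_one _
  rw [inv_mul_le_iff₀ hn', mul_add]
  exact hbound

theorem tendsto_riemann_squareWave (L : ℕ) :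
    Tendsto (fun n : ℕ ↦ (n : ℝ)⁻¹ * ∑ d ∈ Finset.range n,
      (squareWave (d / n) - squareWaveSum L (d / n)) ^ 2) atTop
      (𝓝 (∫ v in (0 : ℝ)..1, (squareWave v - squareWaveSum L v) ^ 2)) := by
  obtain ⟨B, hB⟩ := exists_abs_squareWaveSum_le L
  refine tendsto_riemann_sum (h := fun v : ℝ ↦ (squareWave v - squareWaveSum L v) ^ 2)
    (C := (1 + B) ^ 2) ?_ (fun v ↦ ?_) ?_
  · exact (measurable_squareWave.sub (continuous_squareWaveSum L).measurable).pow_const 2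
  · rw [abs_pow]
    exact pow_le_pow_left₀ (abs_nonneg _)
      ((abs_sub _ _).trans (add_le_add (abs_squareWave_le v) (hB v))) 2
  · have h0 : ∀ᵐ v ∂unif, v ≠ 1 / 2 := by
      simp [ae_iff]
    filter_upwards [h0] with v hv
    refine ContinuousAt.pow (ContinuousAt.sub ?_ (continuous_squareWaveSum L).continuousAt) 2
    rcases lt_or_gt_of_ne hv with h | h
    · refine (continuousAt_const (y := (1 : ℝ))).congr ?_
      filter_upwards [Iio_mem_nhds h] with u hu
      have hu' : u < 1 / 2 := hu
      rw [squareWave, Real.sign_of_pos (by linarith)]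
    · refine (continuousAt_const (y := (-1 : ℝ))).congr ?_
      filter_upwards [Ioi_mem_nhds h] with u hu
      have hu' : 1 / 2 < u := hu
      rw [squareWave, Real.sign_of_neg (by linarith)]


/-! A central limit theorem for vectors of trigonometric sums. -/

theorem norm_prod_sub_prod_le {ι : Type*} (s : Finset ι) {a b : ι → ℂ} (ha : ∀ i, ‖a i‖ ≤ 1)
    (hb : ∀ i, ‖b i‖ ≤ 1) : ‖∏ i ∈ s, a i - ∏ i ∈ s, b i‖ ≤ ∑ i ∈ s, ‖a i - b i‖ := by
  classical
  induction s using Finset.induction_on with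
  | empty => simp
  | insert i s hi ih =>
    rw [Finset.prod_insert hi, Finset.prod_insert hi, Finset.sum_insert hi]
    have h1 : ‖∏ j ∈ s, a j‖ ≤ 1 := by
      rw [norm_prod]; exact Finset.prod_le_one (fun _ _ ↦ norm_nonneg _) fun j _ ↦ ha j
    calc ‖a i * ∏ j ∈ s, a j - b i * ∏ j ∈ s, b j‖
        = ‖(a i - b i) * ∏ j ∈ s, a j + b i * (∏ j ∈ s, a j - ∏ j ∈ s, b j)‖ := by ring_nf
      _ ≤ ‖a i - b i‖ * ‖∏ j ∈ s, a j‖ + ‖b i‖ * ‖∏ j ∈ s, a j - ∏ j ∈ s, b j‖ := by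
        refine (norm_add_le _ _).trans ?_
        rw [norm_mul, norm_mul]
      _ ≤ ‖a i - b i‖ * 1 + 1 * ∑ j ∈ s, ‖a j - b j‖ := by
        gcongr
        exact hb i
      _ = _ := by ring

/-- Second order expansion of the characteristic function of a bounded centred variable. -/
theorem norm_integral_exp_sub_exp_le {Ω : Type*} [MeasurableSpace Ω] {P : Measure Ω}
    [IsProbabilityMeasure P] {Y : Ω → ℝ} (hm : Measurable Y) {B : ℝ} (hB : ∀ ω, |Y ω| ≤ B)
    (h0 : ∫ ω, Y ω ∂P = 0) {ε : ℝ} (hε0 : 0 ≤ ε) (hε1 : ε ≤ 1) :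
    ‖∫ ω, Complex.exp ((ε * Y ω : ℝ) * Complex.I) ∂P -
      Complex.exp ((-(ε ^ 2 * ∫ ω, Y ω ^ 2 ∂P) / 2 : ℝ))‖ ≤
      (B ^ 3 * Real.exp B + B ^ 4 * Real.exp (B ^ 2)) * ε ^ 3 := by
  obtain ⟨ω0⟩ : Nonempty Ω := P.nonempty_of_neZero
  have hB0 : 0 ≤ B := (abs_nonneg _).trans (hB ω0)
  set v := ∫ ω, Y ω ^ 2 ∂P with hv
  have hv0 : 0 ≤ v := integral_nonneg fun _ ↦ sq_nonneg _
  have hY : Integrable Y P := Integrable.of_bound hm.aestronglyMeasurable B (ae_of_all _ hB)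
  have hY2 : Integrable (fun ω ↦ Y ω ^ 2) P :=
    Integrable.of_bound (hm.pow_const 2).aestronglyMeasurable (B ^ 2) (ae_of_all _ fun ω ↦ by
      rw [Real.norm_eq_abs, abs_pow]; exact pow_le_pow_left₀ (abs_nonneg _) (hB ω) 2)
  have hvB : v ≤ B ^ 2 := by
    calc v ≤ ∫ _, B ^ 2 ∂P := integral_mono hY2 (integrable_const _) fun ω ↦ by
          rw [← sq_abs]; exact pow_le_pow_left₀ (abs_nonneg _) (hB ω) 2
      _ = B ^ 2 := by simp
  have hE : Integrable (fun ω ↦ Complex.exp ((ε * Y ω : ℝ) * Complex.I)) P :=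
    Integrable.of_bound (Measurable.aestronglyMeasurable (by fun_prop)) 1
      (ae_of_all _ fun ω ↦ by rw [Complex.norm_exp_ofReal_mul_I])
  -- The second order Taylor polynomial. Its mean `1 - ε² v / 2` is also the first order expansion
  -- of the Gaussian factor, so both terms are compared with it. The remainders are of order `ε³`
  -- and `ε⁴`, and `ε ≤ 1`.
  let T : Ω → ℂ := fun ω ↦ 1 + ((ε * Y ω : ℝ) : ℂ) * Complex.I - ((ε ^ 2 / 2 * Y ω ^ 2 : ℝ) : ℂ)
  have i1 : Integrable (fun ω ↦ ((ε * Y ω : ℝ) : ℂ) * Complex.I) P :=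
    ((hY.const_mul ε).ofReal).mul_const _
  have i2 : Integrable (fun ω ↦ ((ε ^ 2 / 2 * Y ω ^ 2 : ℝ) : ℂ)) P := (hY2.const_mul _).ofReal
  have i12 : Integrable (fun ω ↦ 1 + ((ε * Y ω : ℝ) : ℂ) * Complex.I) P :=
    (integrable_const 1).add i1
  have hT : Integrable T P := i12.sub i2
  have hTint : ∫ ω, T ω ∂P = ((1 - ε ^ 2 * v / 2 : ℝ) : ℂ) := by
    simp only [T]
    rw [integral_sub i12 i2, integral_add (integrable_const 1) i1, integral_mul_const,
      integral_complex_ofReal, integral_complex_ofReal, integral_const_mul, integral_const_mul, h0,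
      ← hv]
    simp
    ring
  have h1 : ‖∫ ω, Complex.exp ((ε * Y ω : ℝ) * Complex.I) ∂P - ∫ ω, T ω ∂P‖ ≤
      B ^ 3 * Real.exp B * ε ^ 3 := by
    rw [← integral_sub hE hT]
    have := norm_integral_le_of_norm_le_const (μ := P) (C := B ^ 3 * Real.exp B * ε ^ 3)
      (f := fun ω ↦ Complex.exp ((ε * Y ω : ℝ) * Complex.I) - T ω) (ae_of_all _ fun ω ↦ ?_)
    · simpa using this
    · have h := Complex.norm_exp_sub_sum_le_norm_mul_exp (((ε * Y ω : ℝ) : ℂ) * Complex.I) 3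
      have hn : ‖((ε * Y ω : ℝ) : ℂ) * Complex.I‖ ≤ ε * B := by
        rw [norm_mul, Complex.norm_I, mul_one, Complex.norm_real, Real.norm_eq_abs, abs_mul,
          abs_of_nonneg hε0]
        exact mul_le_mul_of_nonneg_left (hB ω) hε0
      have hn' : ‖((ε * Y ω : ℝ) : ℂ) * Complex.I‖ ≤ B :=
        hn.trans (mul_le_of_le_one_left hB0 hε1)
      have e : ∑ m ∈ Finset.range 3, (((ε * Y ω : ℝ) : ℂ) * Complex.I) ^ m / (m.factorial : ℂ)
          = T ω := by
        simp only [Finset.sum_range_succ, Finset.sum_range_zero, T]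
        simp [Nat.factorial, mul_pow, Complex.I_sq]
        ring
      rw [e] at h
      refine h.trans ?_
      calc _ ≤ (ε * B) ^ 3 * Real.exp B :=
            mul_le_mul (pow_le_pow_left₀ (norm_nonneg _) hn 3) (Real.exp_le_exp.2 hn')
              (Real.exp_pos _).le (by positivity)
        _ = _ := by ring
  have h2 : ‖∫ ω, T ω ∂P - Complex.exp ((-(ε ^ 2 * v) / 2 : ℝ))‖ ≤
      B ^ 4 * Real.exp (B ^ 2) * ε ^ 3 := by
    have h := Complex.norm_exp_sub_sum_le_norm_mul_exp ((-(ε ^ 2 * v) / 2 : ℝ) : ℂ) 2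
    have e : ∑ m ∈ Finset.range 2, ((-(ε ^ 2 * v) / 2 : ℝ) : ℂ) ^ m / (m.factorial : ℂ)
        = ∫ ω, T ω ∂P := by
      rw [hTint]
      simp only [Finset.sum_range_succ, Finset.sum_range_zero]
      simp
      ring
    rw [e, norm_sub_rev] at h
    have hn : ‖((-(ε ^ 2 * v) / 2 : ℝ) : ℂ)‖ = ε ^ 2 * v / 2 := by
      rw [Complex.norm_real, Real.norm_eq_abs, neg_div, abs_neg, abs_of_nonneg (by positivity)]
    rw [hn] at h
    refine h.trans ?_
    have h3 : ε ^ 2 * v / 2 ≤ ε ^ 2 * B ^ 2 := by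
      have := mul_le_mul_of_nonneg_left hvB (sq_nonneg ε)
      have : 0 ≤ ε ^ 2 * v := by positivity
      linarith
    have h4 : ε ^ 2 * v / 2 ≤ B ^ 2 :=
      h3.trans (mul_le_of_le_one_left (sq_nonneg _) (pow_le_one₀ hε0 hε1))
    calc _ ≤ (ε ^ 2 * B ^ 2) ^ 2 * Real.exp (B ^ 2) :=
          mul_le_mul (pow_le_pow_left₀ (by positivity) h3 2) (Real.exp_le_exp.2 h4)
            (Real.exp_pos _).le (by positivity)
      _ = B ^ 4 * Real.exp (B ^ 2) * (ε ^ 3 * ε) := by ring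
      _ ≤ B ^ 4 * Real.exp (B ^ 2) * (ε ^ 3 * 1) := by gcongr
      _ = _ := by ring
  calc _ ≤ _ := norm_sub_le_norm_sub_add_norm_sub _ (∫ ω, T ω ∂P) _
    _ ≤ _ := add_le_add h1 h2
    _ = _ := by ring

section TrigVector

variable {ι : Type*} (p q : ι → ℤ) (c : ι → ℝ)

/-- The wave `√2 cos (2π (p x + q t) + c)`. -/
noncomputable def wave (α : ι) (t x : ℝ) : ℝ :=
  √2 * Real.cos (2 * Real.pi * p α * x + (2 * Real.pi * q α * t + c α))

/-- The normalized sums of the waves `√2 cos (2π (p xᵢ + q i / n) + c)`. -/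
noncomputable def waveSum (n : ℕ) (x : Fin n → ℝ) : EuclideanSpace ℝ ι :=
  WithLp.toLp 2 fun α ↦ (√n)⁻¹ * ∑ i : Fin n, wave p q c α ((i : ℕ) / n) (x i)

theorem abs_wave_le (α : ι) (t x : ℝ) : |wave p q c α t x| ≤ √2 := by
  rw [wave, abs_mul, abs_of_nonneg (Real.sqrt_nonneg _)]
  exact mul_le_of_le_one_right (Real.sqrt_nonneg _) (Real.abs_cos_le_one _)

variable {p q c}

theorem continuous_wave_right (α : ι) (t : ℝ) : Continuous (wave p q c α t) := by
  unfold wave; fun_prop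

theorem measurable_waveSum (n : ℕ) : Measurable (waveSum p q c n) := by
  refine (MeasurableEquiv.toLp 2 (ι → ℝ)).measurable.comp (measurable_pi_lambda _ fun α ↦ ?_)
  refine (Finset.measurable_fun_sum _ fun i _ ↦ ?_).const_mul _
  exact (continuous_wave_right α _).measurable.comp (measurable_pi_apply i)

theorem integral_wave (hp : ∀ α, 0 < p α) (α : ι) (t : ℝ) : ∫ x, wave p q c α t x ∂unif = 0 := by
  rw [integral_unif]
  unfold wave
  rw [intervalIntegral.integral_const_mul, integral_cos_add (hp α).ne', mul_zero]

/-- In the product-to-sum formula the sum frequency is positive and integrates to zero; the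
difference frequency survives only when the space frequencies agree. The factor `√2` in `wave`
cancels the `1/2`. -/
theorem integral_wave_mul_wave (hp : ∀ α, 0 < p α) (α β : ι) (t : ℝ) :
    ∫ x, wave p q c α t x * wave p q c β t x ∂unif = if p α = p β then
      Real.cos (2 * Real.pi * ((q α - q β : ℤ) : ℝ) * t + (c α - c β)) else 0 := by
  have e : ∀ x, wave p q c α t x * wave p q c β t x =
      Real.cos (2 * Real.pi * ((p α - p β : ℤ) : ℝ) * x +
        (2 * Real.pi * ((q α - q β : ℤ) : ℝ) * t + (c α - c β))) +
      Real.cos (2 * Real.pi * ((p α + p β : ℤ) : ℝ) * x +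
        (2 * Real.pi * ((q α + q β : ℤ) : ℝ) * t + (c α + c β))) := by
    intro x
    have h2 : √2 * √2 = (2 : ℝ) := Real.mul_self_sqrt (by norm_num)
    rw [wave, wave, mul_mul_mul_comm, h2, cos_mul_cos_eq, mul_div_cancel₀ _ two_ne_zero]
    push_cast
    congr 2 <;> ring
  simp only [e]
  rw [integral_add (integrable_unif_of_continuous (by fun_prop))
    (integrable_unif_of_continuous (by fun_prop)), integral_unif, integral_unif,
    integral_cos_add (p := p α + p β) (by have := hp α; have := hp β; omega), add_zero]
  split_ifs with h
  · rw [h]; simp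
  · rw [integral_cos_add (by omega)]

variable [Fintype ι]

/-- The variance of a linear combination of the waves averages to the sum of the squares of the
coefficients. -/
theorem tendsto_average_variance (hp : ∀ α, 0 < p α)
    (hc : ∀ α β, α ≠ β → p α ≠ p β ∨ q α ≠ q β ∨ Real.cos (c α - c β) = 0) (θ : ι → ℝ) :
    Tendsto (fun n : ℕ ↦ (n : ℝ)⁻¹ * ∑ d ∈ Finset.range n,
      ∫ x, (∑ α, θ α * wave p q c α (d / n) x) ^ 2 ∂unif) atTop (𝓝 (∑ α, θ α ^ 2)) := by
  have hv : ∀ t, ∫ x, (∑ α, θ α * wave p q c α t x) ^ 2 ∂unif = ∑ α, ∑ β, θ α * θ β *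
      if p α = p β then Real.cos (2 * Real.pi * ((q α - q β : ℤ) : ℝ) * t + (c α - c β)) else 0 := by
    intro t
    have hi : ∀ α β, Integrable (fun x ↦ θ α * wave p q c α t x * (θ β * wave p q c β t x)) unif :=
      fun α β ↦ integrable_unif_of_continuous
        (((continuous_wave_right α t).const_mul _).mul ((continuous_wave_right β t).const_mul _))
    simp only [sq, Finset.sum_mul_sum]
    rw [integral_finsetSum _ fun α _ ↦ integrable_finsetSum _ fun β _ ↦ hi α β]
    refine Finset.sum_congr rfl fun α _ ↦ ?_
    rw [integral_finsetSum _ fun β _ ↦ hi α β]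
    refine Finset.sum_congr rfl fun β _ ↦ ?_
    rw [← integral_wave_mul_wave hp, ← integral_const_mul]
    exact integral_congr_ae (ae_of_all _ fun x ↦ by ring)
  simp only [hv]
  have hcont : Continuous fun t : ℝ ↦ ∑ α, ∑ β, θ α * θ β *
      if p α = p β then Real.cos (2 * Real.pi * ((q α - q β : ℤ) : ℝ) * t + (c α - c β)) else 0 := by
    refine continuous_finsetSum _ fun α _ ↦ continuous_finsetSum _ fun β _ ↦ ?_
    split_ifs <;> fun_prop
  have hr := tendsto_riemann_sum hcont.measurable (C := ∑ α, ∑ β, |θ α * θ β|) (fun t ↦ ?_)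
    (ae_of_all _ fun t ↦ hcont.continuousAt)
  · convert hr using 2
    rw [intervalIntegral.integral_finsetSum fun α _ ↦ Continuous.intervalIntegrable
      (continuous_finsetSum _ fun β _ ↦ by split_ifs <;> fun_prop) _ _]
    refine Finset.sum_congr rfl fun α _ ↦ ?_
    rw [intervalIntegral.integral_finsetSum fun β _ ↦ Continuous.intervalIntegrable
      (by split_ifs <;> fun_prop) _ _, Finset.sum_eq_single α]
    · simp [sq]
    · intro β _ hβ
      rw [intervalIntegral.integral_const_mul]
      refine mul_eq_zero_of_right _ ?_
      split_ifs with h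
      · by_cases hq : q α = q β
        · have := ((hc α β hβ.symm).resolve_left (not_not.2 h)).resolve_left (not_not.2 hq)
          simp [hq, this]
        · exact integral_cos_add (by omega) _
      · simp
    · intro h; exact absurd (Finset.mem_univ α) h
  · refine (Finset.abs_sum_le_sum_abs _ _).trans (Finset.sum_le_sum fun α _ ↦
      (Finset.abs_sum_le_sum_abs _ _).trans (Finset.sum_le_sum fun β _ ↦ ?_))
    rw [abs_mul]
    refine mul_le_of_le_one_right (abs_nonneg _) ?_
    split_ifs
    · exact Real.abs_cos_le_one _
    · simp

/-- The inner product with `θ` is a sum over `i` of functions of `x i` alone, so independence gives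
a product. -/
theorem charFun_map_waveSum (n : ℕ) (θ : EuclideanSpace ℝ ι) :
    charFun ((Measure.pi fun _ : Fin n ↦ unif).map (waveSum p q c n)) θ =
      ∏ i : Fin n, ∫ x, Complex.exp (((√n)⁻¹ *
        ∑ α, θ α * wave p q c α ((i : ℕ) / n) x : ℝ) * Complex.I) ∂unif := by
  rw [charFun_apply, integral_map (measurable_waveSum n).aemeasurable
    (Continuous.aestronglyMeasurable (by fun_prop)), ← integral_fintype_prod_eq_prod]
  refine integral_congr_ae (ae_of_all _ fun x ↦ ?_)
  simp only
  rw [← Complex.exp_sum, ← Finset.sum_mul, ← Complex.ofReal_sum]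
  congr 3
  rw [PiLp.inner_apply, ← Finset.mul_sum, Finset.sum_comm, Finset.mul_sum]
  refine Finset.sum_congr rfl fun α _ ↦ ?_
  simp only [waveSum, RCLike.inner_apply, conj_trivial]
  rw [← Finset.mul_sum]
  ring

/-- The central limit theorem for `waveSum`. -/
theorem tendsto_charFun_waveSum (hp : ∀ α, 0 < p α)
    (hc : ∀ α β, α ≠ β → p α ≠ p β ∨ q α ≠ q β ∨ Real.cos (c α - c β) = 0)
    (θ : EuclideanSpace ℝ ι) :
    Tendsto (fun n : ℕ ↦ charFun ((Measure.pi fun _ : Fin n ↦ unif).map (waveSum p q c n)) θ) atTop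
      (𝓝 (Complex.exp ((-(∑ α, θ α ^ 2) / 2 : ℝ)))) := by
  let Y : ℝ → ℝ → ℝ := fun t x ↦ ∑ α, θ α * wave p q c α t x
  have hYm : ∀ t, Measurable (Y t) := fun t ↦ (continuous_finsetSum _ fun α _ ↦
    (continuous_wave_right α t).const_mul _).measurable
  set B : ℝ := ∑ α, |θ α| * √2 with hBdef
  have hB : ∀ t x, |Y t x| ≤ B := fun t x ↦
    (Finset.abs_sum_le_sum_abs _ _).trans (Finset.sum_le_sum fun α _ ↦ by
      rw [abs_mul]; exact mul_le_mul_of_nonneg_left (abs_wave_le p q c α t x) (abs_nonneg _))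
  have hY0 : ∀ t, ∫ x, Y t x ∂unif = 0 := fun t ↦ by
    simp only [Y]
    rw [integral_finsetSum _ fun α _ ↦
      integrable_unif_of_continuous ((continuous_wave_right α t).const_mul _)]
    refine Finset.sum_eq_zero fun α _ ↦ ?_
    rw [integral_const_mul, integral_wave hp, mul_zero]
  set C := B ^ 3 * Real.exp B + B ^ 4 * Real.exp (B ^ 2)
  let a : (n : ℕ) → Fin n → ℂ := fun n i ↦
    ∫ x, Complex.exp (((√n)⁻¹ * Y ((i : ℕ) / n) x : ℝ) * Complex.I) ∂unif
  let b : (n : ℕ) → Fin n → ℂ := fun n i ↦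
    Complex.exp ((-((√n)⁻¹ ^ 2 * ∫ x, Y ((i : ℕ) / n) x ^ 2 ∂unif) / 2 : ℝ))
  have ha : ∀ n i, ‖a n i‖ ≤ 1 := fun n i ↦ by
    have := norm_integral_le_of_norm_le_const (μ := unif) (C := 1)
      (f := fun x ↦ Complex.exp (((√n)⁻¹ * Y ((i : ℕ) / n) x : ℝ) * Complex.I))
      (ae_of_all _ fun x ↦ by rw [Complex.norm_exp_ofReal_mul_I])
    simpa [a] using this
  have hb : ∀ n i, ‖b n i‖ ≤ 1 := fun n i ↦ by
    simp only [b]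
    rw [Complex.norm_exp_ofReal, Real.exp_le_one_iff]
    have : 0 ≤ ∫ x, Y ((i : ℕ) / n) x ^ 2 ∂unif := integral_nonneg fun _ ↦ sq_nonneg _
    have : 0 ≤ (√n)⁻¹ ^ 2 * ∫ x, Y ((i : ℕ) / n) x ^ 2 ∂unif := by positivity
    linarith
  -- There are `n` factors, each replaced by its Gaussian counterpart at cost `C n ^ (-3/2)`.
  have hab : ∀ n : ℕ, 0 < n → ‖∏ i, a n i - ∏ i, b n i‖ ≤ C * (√n)⁻¹ := by
    intro n hn
    have hn' : (1 : ℝ) ≤ n := by exact_mod_cast hn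
    have hs : 1 ≤ √n := Real.one_le_sqrt.2 hn'
    refine (norm_prod_sub_prod_le _ (ha n) (hb n)).trans ?_
    calc ∑ i, ‖a n i - b n i‖ ≤ ∑ _i : Fin n, C * (√n)⁻¹ ^ 3 :=
          Finset.sum_le_sum fun i _ ↦ norm_integral_exp_sub_exp_le (hYm _) (hB _) (hY0 _)
            (by positivity) (inv_le_one_of_one_le₀ hs)
      _ = C * (√n)⁻¹ := by
          rw [Finset.sum_const, Finset.card_univ, Fintype.card_fin, nsmul_eq_mul]
          have h2 : (n : ℝ) = √n * √n := (Real.mul_self_sqrt (by positivity)).symm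
          have h0 : √n ≠ 0 := by positivity
          nth_rewrite 1 [h2]
          field_simp
  -- The Gaussian factors multiply to an exponential of the averaged variance, whose limit is `∑ θ α
  -- ^ 2` by `tendsto_average_variance`.
  have hbprod : ∀ n : ℕ, ∏ i, b n i = Complex.exp ((-((n : ℝ)⁻¹ * ∑ d ∈ Finset.range n,
      ∫ x, Y (d / n) x ^ 2 ∂unif) / 2 : ℝ)) := by
    intro n
    simp only [b]
    rw [← Complex.exp_sum, ← Complex.ofReal_sum, Finset.sum_range, ← Finset.sum_div,
      Finset.sum_neg_distrib, ← Finset.mul_sum, inv_pow, Real.sq_sqrt (by positivity)]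
  have hblim : Tendsto (fun n : ℕ ↦ ∏ i, b n i) atTop
      (𝓝 (Complex.exp ((-(∑ α, θ α ^ 2) / 2 : ℝ)))) := by
    simp only [hbprod]
    have h := ((tendsto_average_variance hp hc θ).neg.div_const 2)
    exact ((Complex.continuous_exp.comp Complex.continuous_ofReal).tendsto _).comp h
  have hz : Tendsto (fun n : ℕ ↦ ∏ i, a n i - ∏ i, b n i) atTop (𝓝 0) := by
    refine squeeze_zero_norm' (a := fun n : ℕ ↦ C * (√n)⁻¹) ?_ ?_
    · filter_upwards [eventually_gt_atTop 0] with n hn using hab n hn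
    · have h := (tendsto_inv_atTop_zero.comp
        (Real.tendsto_sqrt_atTop.comp tendsto_natCast_atTop_atTop)).const_mul C
      simpa using h
  have := hz.add hblim
  simp only [sub_add_cancel, zero_add] at this
  refine this.congr fun n ↦ ?_
  rw [charFun_map_waveSum]

/-- Bounded continuous functionals of `waveSum` converge to Gaussian integrals. -/
theorem tendsto_integral_waveSum (hp : ∀ α, 0 < p α)
    (hc : ∀ α β, α ≠ β → p α ≠ p β ∨ q α ≠ q β ∨ Real.cos (c α - c β) = 0)
    {F : EuclideanSpace ℝ ι → ℂ} (hF : Continuous F) {C : ℝ} (hFC : ∀ v, ‖F v‖ ≤ C) :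
    Tendsto (fun n : ℕ ↦ ∫ x, F (waveSum p q c n x) ∂(Measure.pi fun _ : Fin n ↦ unif)) atTop
      (𝓝 (∫ z : ι → ℝ, F (WithLp.toLp 2 z) ∂(Measure.pi fun _ ↦ gaussianReal 0 1))) := by
  let μs : ℕ → ProbabilityMeasure (EuclideanSpace ℝ ι) := fun n ↦
    ⟨(Measure.pi fun _ : Fin n ↦ unif).map (waveSum p q c n),
      Measure.isProbabilityMeasure_map (measurable_waveSum n).aemeasurable⟩
  let μ0 : ProbabilityMeasure (EuclideanSpace ℝ ι) :=
    ⟨(Measure.pi fun _ : ι ↦ gaussianReal 0 1).map (WithLp.toLp 2),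
      Measure.isProbabilityMeasure_map (MeasurableEquiv.toLp 2 (ι → ℝ)).measurable.aemeasurable⟩
  have h : Tendsto μs atTop (𝓝 μ0) := by
    refine ProbabilityMeasure.tendsto_of_tendsto_charFun fun θ ↦ ?_
    have e : charFun (μ0 : Measure (EuclideanSpace ℝ ι)) θ =
        Complex.exp ((-(∑ α, θ α ^ 2) / 2 : ℝ)) := by
      change charFun ((Measure.pi fun _ : ι ↦ gaussianReal 0 1).map (WithLp.toLp 2)) θ = _
      rw [charFun_pi]
      simp only [charFun_gaussianReal]
      rw [← Complex.exp_sum]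
      congr 1
      simp [Finset.sum_div, neg_div]
    rw [e]
    exact tendsto_charFun_waveSum hp hc θ
  have h2 := (ProbabilityMeasure.tendsto_iff_forall_integral_rclike_tendsto ℂ).1 h
    (BoundedContinuousFunction.ofNormedAddCommGroup F hF C hFC)
  simp only [BoundedContinuousFunction.coe_ofNormedAddCommGroup] at h2
  have e1 : ∀ n, ∫ v, F v ∂(μs n : Measure (EuclideanSpace ℝ ι)) =
      ∫ x, F (waveSum p q c n x) ∂(Measure.pi fun _ : Fin n ↦ unif) := fun n ↦
    integral_map (measurable_waveSum n).aemeasurable hF.aestronglyMeasurable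
  have e2 : ∫ v, F v ∂(μ0 : Measure (EuclideanSpace ℝ ι)) =
      ∫ z : ι → ℝ, F (WithLp.toLp 2 z) ∂(Measure.pi fun _ ↦ gaussianReal 0 1) :=
    integral_map (MeasurableEquiv.toLp 2 (ι → ℝ)).measurable.aemeasurable hF.aestronglyMeasurable
  simpa only [e1, e2] using h2

end TrigVector


/-! The truncated statistic as a quadratic form, and its Gaussian limit. -/

/-- The Gaussian integral carries a complex square root, which squaring removes. The square is all
that is needed, since each weight occurs for both phases. -/
theorem sq_integral_gaussianReal_exp (a : ℝ) :
    (∫ z, Complex.exp ((a * z ^ 2 : ℝ) * Complex.I) ∂(gaussianReal 0 1)) ^ 2 =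
      1 / (1 - 2 * a * Complex.I) := by
  rw [integral_gaussianReal_eq_integral_smul (by norm_num)]
  set b : ℂ := (1 - 2 * a * Complex.I) / 2 with hb
  have hbre : 0 < b.re := by
    have : b.re = 1 / 2 := by simp [hb]
    rw [this]; norm_num
  have hb0 : b ≠ 0 := by intro h; rw [h] at hbre; simp at hbre
  have e : ∀ z : ℝ, gaussianPDFReal 0 1 z • Complex.exp ((a * z ^ 2 : ℝ) * Complex.I) =
      ((√(2 * Real.pi))⁻¹ : ℝ) * Complex.exp (-b * (z : ℂ) ^ 2) := by
    intro z
    rw [gaussianPDFReal, Complex.real_smul]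
    push_cast
    rw [mul_assoc, ← Complex.exp_add]
    simp only [mul_one]
    congr 2
    rw [hb]
    ring
  simp only [e]
  rw [integral_const_mul, integral_gaussian_complex hbre, mul_pow, ← Complex.cpow_nat_mul]
  have hpi : (Real.pi : ℂ) ≠ 0 := by exact_mod_cast Real.pi_ne_zero
  rw [← Complex.ofReal_pow, inv_pow, Real.sq_sqrt (by positivity)]
  have h1 : ((2 : ℕ) : ℂ) * (1 / 2) = 1 := by norm_num
  rw [h1, Complex.cpow_one]
  have h2 : (1 - 2 * a * Complex.I : ℂ) = 2 * b := by rw [hb]; ring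
  rw [h2]
  push_cast
  field_simp

/-- Indices of the waves: frequency in space, frequency in time, sign of the latter, phase. -/
abbrev WaveIndex (K L : ℕ) : Type := (Fin K × Fin L) × Bool × Bool

/-- The space frequency. -/
def spaceFreq {K L : ℕ} (α : WaveIndex K L) : ℤ := (α.1.1 : ℕ) + 1

/-- The time frequency. -/
def timeFreq {K L : ℕ} (α : WaveIndex K L) : ℤ :=
  if α.2.1 then 2 * (α.1.2 : ℕ) + 1 else -(2 * (α.1.2 : ℕ) + 1)

/-- The phase. -/
noncomputable def phase {K L : ℕ} (α : WaveIndex K L) : ℝ := if α.2.2 then 0 else -(Real.pi / 2)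

/-- The coefficient of the square of a wave sum in the truncated statistic. -/
noncomputable def waveWeight {K L : ℕ} (α : WaveIndex K L) : ℝ :=
  (if α.2.1 then 1 else -1) * (1 / (Real.pi ^ 2 * ((α.1.1 : ℕ) + 1) * (2 * (α.1.2 : ℕ) + 1)))

theorem spaceFreq_pos {K L : ℕ} (α : WaveIndex K L) : 0 < spaceFreq α := by
  unfold spaceFreq; omega

/-- The time frequency is plus or minus an odd positive number, so it determines both its sign and
`l`. Indices with the same frequencies thus differ only in the phase, `0` against `-π/2`, that is
cosine against sine. -/
theorem waveIndex_orthogonal {K L : ℕ} (α β : WaveIndex K L) (h : α ≠ β) :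
    spaceFreq α ≠ spaceFreq β ∨ timeFreq α ≠ timeFreq β ∨ Real.cos (phase α - phase β) = 0 := by
  by_contra! hc
  obtain ⟨h1, h2, h3⟩ := hc
  obtain ⟨⟨k, l⟩, s, e⟩ := α
  obtain ⟨⟨k', l'⟩, s', e'⟩ := β
  simp only [spaceFreq, timeFreq, phase] at h1 h2 h3
  have hk : k = k' := by ext; omega
  have hs : s = s' := by
    cases s <;> cases s' <;> simp at h2 ⊢ <;> omega
  have hl : l = l' := by
    subst hs; ext; cases s <;> simp at h2 ⊢ <;> omega
  have he : e = e' := by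
    cases e <;> cases e' <;> simp at h3 ⊢
  exact h (by rw [hk, hs, hl, he])

theorem sum_waveIndex {K L : ℕ} (f : WaveIndex K L → ℝ) :
    ∑ α, f α = ∑ k : Fin K, ∑ l : Fin L, ((f ((k, l), true, true) + f ((k, l), true, false)) +
      (f ((k, l), false, true) + f ((k, l), false, false))) := by
  rw [Fintype.sum_prod_type, Fintype.sum_prod_type]
  simp only [Fintype.sum_prod_type, Fintype.sum_bool]

theorem prod_waveIndex {K L : ℕ} (f : WaveIndex K L → ℂ) :
    ∏ α, f α = ∏ k : Fin K, ∏ l : Fin L, ((f ((k, l), true, true) * f ((k, l), true, false)) *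
      (f ((k, l), false, true) * f ((k, l), false, false))) := by
  rw [Fintype.prod_prod_type, Fintype.prod_prod_type]
  simp only [Fintype.prod_prod_type, Fintype.prod_bool]

/-- The left side is `|∑ exp (i (u + v))|² - |∑ exp (i (u - v))|²`. Expanding gives the double sum
of `cos (Δu + Δv) - cos (Δu - Δv) = -2 sin Δu sin Δv`, where each pair appears in both orders. This
writes the bilinear form as a combination of squares. -/
theorem sum_sq_sub_sum_sq {n : ℕ} (u v : Fin n → ℝ) :
    ((∑ i, Real.cos (u i + v i)) ^ 2 + (∑ i, Real.sin (u i + v i)) ^ 2) -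
      ((∑ i, Real.cos (u i - v i)) ^ 2 + (∑ i, Real.sin (u i - v i)) ^ 2) =
    4 * ∑ i, ∑ j, if i < j then Real.sin (u i - u j) * Real.sin (v j - v i) else 0 := by
  have h1 : ∀ a : Fin n → ℝ, (∑ i, Real.cos (a i)) ^ 2 + (∑ i, Real.sin (a i)) ^ 2 =
      ∑ i, ∑ j, Real.cos (a i - a j) := by
    intro a
    simp only [sq, Finset.sum_mul_sum, ← Finset.sum_add_distrib, Real.cos_sub]
  rw [h1, h1, ← Finset.sum_sub_distrib]
  simp only [← Finset.sum_sub_distrib]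
  rw [sum_sum_eq_sum_lt _ fun i ↦ by simp, Finset.mul_sum]
  refine Finset.sum_congr rfl fun i _ ↦ ?_
  rw [Finset.mul_sum]
  refine Finset.sum_congr rfl fun j _ ↦ ?_
  have h2 : ∀ s t : ℝ, Real.cos (s + t) - Real.cos (s - t) = -2 * (Real.sin s * Real.sin t) :=
    fun s t ↦ by rw [Real.cos_add, Real.cos_sub]; ring
  split_ifs
  · rw [show u i + v i - (u j + v j) = (u i - u j) + (v i - v j) by ring,
      show u i - v i - (u j - v j) = (u i - u j) - (v i - v j) by ring,
      show u j + v j - (u i + v i) = (u j - u i) + (v j - v i) by ring,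
      show u j - v j - (u i - v i) = (u j - u i) - (v j - v i) by ring, h2, h2,
      ← neg_sub (u i) (u j), ← neg_sub (v i) (v j), Real.sin_neg, Real.sin_neg]
    ring
  · simp

/-- Apply `sum_sq_sub_sum_sq` for each pair of frequencies, with `u_i = 2π (k + 1) x_i` and `v_i =
2π (2 l + 1) i / n`. The product `8 / (π² (k + 1) (2 l + 1))` of the Fourier coefficients is divided
by the `4` of that identity and by the `2` from squaring the `√2` in `wave`, which leaves
`waveWeight`. -/
theorem truncU_eq_sum_sq (K L n : ℕ) (x : Fin n → ℝ) :
    (n : ℝ)⁻¹ * truncU K L x = ∑ α : WaveIndex K L,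
      waveWeight α * waveSum spaceFreq timeFreq phase n x α ^ 2 := by
  have hterm : ∀ (k : Fin K) (l : Fin L), ((waveWeight ((k, l), true, true) *
      waveSum spaceFreq timeFreq phase n x ((k, l), true, true) ^ 2 +
      waveWeight ((k, l), true, false) *
      waveSum spaceFreq timeFreq phase n x ((k, l), true, false) ^ 2) +
      (waveWeight ((k, l), false, true) *
      waveSum spaceFreq timeFreq phase n x ((k, l), false, true) ^ 2 +
      waveWeight ((k, l), false, false) *
      waveSum spaceFreq timeFreq phase n x ((k, l), false, false) ^ 2)) =
      (n : ℝ)⁻¹ * ∑ i : Fin n, ∑ j : Fin n, if i < j then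
        (4 / (Real.pi * (2 * l + 1 : ℕ)) *
          Real.sin (2 * Real.pi * (2 * l + 1 : ℕ) * (((j : ℕ) - (i : ℕ) : ℝ) / n))) *
        (2 / (Real.pi * (k + 1 : ℕ)) *
          Real.sin (2 * Real.pi * (k + 1 : ℕ) * (x i - x j))) else 0 := by
    intro k l
    have h := sum_sq_sub_sum_sq (fun i ↦ 2 * Real.pi * ((k : ℕ) + 1) * x i)
      fun i : Fin n ↦ 2 * Real.pi * (2 * (l : ℕ) + 1) * (((i : ℕ) : ℝ) / n)
    have hsq : (√n)⁻¹ ^ 2 = (n : ℝ)⁻¹ := by rw [inv_pow, Real.sq_sqrt (by positivity)]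
    have hV : ∀ s e : Bool, waveSum spaceFreq timeFreq phase n x ((k, l), s, e) ^ 2 =
        (n : ℝ)⁻¹ * 2 * (∑ i : Fin n, Real.cos (2 * Real.pi * ((k : ℕ) + 1) * x i +
          (if s then 1 else -1) * (2 * Real.pi * (2 * (l : ℕ) + 1) * (((i : ℕ) : ℝ) / n)) +
          if e then 0 else -(Real.pi / 2))) ^ 2 := by
      intro s e
      simp only [waveSum, wave]
      rw [← Finset.mul_sum, mul_pow, mul_pow, hsq, Real.sq_sqrt (by norm_num), ← mul_assoc]
      congr 2
      refine Finset.sum_congr rfl fun i _ ↦ ?_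
      congr 1
      simp only [spaceFreq, timeFreq, phase]
      cases s <;> push_cast <;> simp <;> ring
    simp only [hV, waveWeight]
    simp only [if_true, Bool.false_eq_true, if_false, add_zero, one_mul, neg_one_mul,
      ← sub_eq_add_neg, Real.cos_sub_pi_div_two]
    have e2 : ∑ i : Fin n, ∑ j : Fin n, (if i < j then
        (4 / (Real.pi * (2 * l + 1 : ℕ)) *
          Real.sin (2 * Real.pi * (2 * l + 1 : ℕ) * (((j : ℕ) - (i : ℕ) : ℝ) / n))) *
        (2 / (Real.pi * (k + 1 : ℕ)) *
          Real.sin (2 * Real.pi * (k + 1 : ℕ) * (x i - x j))) else 0) =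
        (2 / (Real.pi ^ 2 * ((k : ℕ) + 1) * (2 * (l : ℕ) + 1))) * (4 * ∑ i : Fin n, ∑ j : Fin n,
        if i < j then
          Real.sin (2 * Real.pi * ((k : ℕ) + 1) * x i - 2 * Real.pi * ((k : ℕ) + 1) * x j) *
          Real.sin (2 * Real.pi * (2 * (l : ℕ) + 1) * (((j : ℕ) : ℝ) / n) -
            2 * Real.pi * (2 * (l : ℕ) + 1) * (((i : ℕ) : ℝ) / n)) else 0) := by
      simp only [Finset.mul_sum]
      refine Finset.sum_congr rfl fun i _ ↦ Finset.sum_congr rfl fun j _ ↦ ?_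
      split_ifs
      · push_cast
        rw [sub_div, mul_sub, mul_sub]
        field_simp
      · simp
    rw [e2, ← h]
    ring
  rw [sum_waveIndex]
  simp only [hterm]
  simp only [← Finset.mul_sum]
  congr 1
  have hsum : ∀ i j : Fin n, (if i < j then
      squareWaveSum L (((j : ℕ) - (i : ℕ) : ℝ) / n) * sawtoothSum K (x i - x j) else 0) =
      ∑ k : Fin K, ∑ l : Fin L, if i < j then
        (4 / (Real.pi * (2 * l + 1 : ℕ)) *
          Real.sin (2 * Real.pi * (2 * l + 1 : ℕ) * (((j : ℕ) - (i : ℕ) : ℝ) / n))) *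
        (2 / (Real.pi * (k + 1 : ℕ)) *
          Real.sin (2 * Real.pi * (k + 1 : ℕ) * (x i - x j))) else 0 := by
    intro i j
    split_ifs
    · rw [squareWaveSum, sawtoothSum, Finset.sum_range, Finset.sum_range, Finset.sum_mul_sum,
        Finset.sum_comm]
    · simp
  rw [truncU]
  simp only [hsum]
  calc _ = ∑ i : Fin n, ∑ k : Fin K, ∑ j : Fin n, ∑ l : Fin L, _ :=
        Finset.sum_congr rfl fun i _ ↦ Finset.sum_comm
    _ = ∑ k : Fin K, ∑ i : Fin n, ∑ j : Fin n, ∑ l : Fin L, _ := Finset.sum_comm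
    _ = ∑ k : Fin K, ∑ i : Fin n, ∑ l : Fin L, ∑ j : Fin n, _ :=
        Finset.sum_congr rfl fun k _ ↦ Finset.sum_congr rfl fun i _ ↦ Finset.sum_comm
    _ = _ := Finset.sum_congr rfl fun k _ ↦ Finset.sum_comm

/-- The characteristic function of the Gaussian limit of the truncated statistic. -/
noncomputable def truncCharFun (K L : ℕ) (t : ℝ) : ℝ :=
  ∏ k ∈ Finset.range K, ∏ l ∈ Finset.range L,
    (1 + 4 * (t / (Real.pi * (k + 1))) ^ 2 / (Real.pi ^ 2 * (2 * l + 1) ^ 2))⁻¹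

/-- In the limit each `(k, l)` carries four independent standard Gaussians, two with weight `w` and
two with `-w`. Their squares contribute `1 / ((1 - 2 i t w) (1 + 2 i t w)) = 1 / (1 + 4 t² w²)`. -/
theorem tendsto_charFun_truncU (K L : ℕ) (t : ℝ) :
    Tendsto (fun n : ℕ ↦ ∫ x, Complex.exp ((t * ((n : ℝ)⁻¹ * truncU K L x) : ℝ) * Complex.I)
      ∂(Measure.pi fun _ : Fin n ↦ unif)) atTop (𝓝 (truncCharFun K L t : ℂ)) := by
  let F : EuclideanSpace ℝ (WaveIndex K L) → ℂ := fun v ↦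
    Complex.exp ((t * ∑ α, waveWeight α * v α ^ 2 : ℝ) * Complex.I)
  have hF : Continuous F := by fun_prop
  have h := tendsto_integral_waveSum (p := spaceFreq) (q := timeFreq) (c := phase) spaceFreq_pos
    waveIndex_orthogonal hF (C := 1) fun v ↦ by rw [Complex.norm_exp_ofReal_mul_I]
  simp only [F, ← truncU_eq_sum_sq] at h
  convert h using 2
  have e : ∀ z : WaveIndex K L → ℝ,
      Complex.exp ((t * ∑ α, waveWeight α * z α ^ 2 : ℝ) * Complex.I) =
      ∏ α, Complex.exp (((t * waveWeight α) * z α ^ 2 : ℝ) * Complex.I) := by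
    intro z
    rw [← Complex.exp_sum, ← Finset.sum_mul, ← Complex.ofReal_sum, Finset.mul_sum]
    simp only [mul_assoc]
  simp only [e]
  rw [integral_fintype_prod_eq_prod
    (f := fun α z ↦ Complex.exp (((t * waveWeight α) * z ^ 2 : ℝ) * Complex.I)), prod_waveIndex,
    truncCharFun, Finset.prod_range]
  rw [Complex.ofReal_prod]
  refine Finset.prod_congr rfl fun k _ ↦ ?_
  rw [Finset.prod_range, Complex.ofReal_prod]
  refine Finset.prod_congr rfl fun l _ ↦ ?_
  simp only [waveWeight, if_true, Bool.false_eq_true, if_false, ← pow_two]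
  rw [sq_integral_gaussianReal_exp, sq_integral_gaussianReal_exp]
  set w : ℝ := 1 / (Real.pi ^ 2 * (((k : ℕ) : ℝ) + 1) * (2 * ((l : ℕ) : ℝ) + 1)) with hw
  have h1 : (1 : ℝ) + 4 * (t / (Real.pi * (((k : ℕ) : ℝ) + 1))) ^ 2 /
      (Real.pi ^ 2 * (2 * ((l : ℕ) : ℝ) + 1) ^ 2) = 1 + 4 * (t * w) ^ 2 := by
    rw [hw]
    field_simp
  rw [h1, div_mul_div_comm, one_mul, ← one_div, Complex.ofReal_div, Complex.ofReal_one]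
  congr 1
  push_cast
  linear_combination (4 * (t * w : ℂ) ^ 2) * Complex.I_sq

/-! The product formula for `cosh`. -/

theorem prod_range_two_mul (f : ℕ → ℂ) (L : ℕ) :
    ∏ j ∈ Finset.range (2 * L), f j =
      (∏ l ∈ Finset.range L, f (2 * l)) * ∏ l ∈ Finset.range L, f (2 * l + 1) := by
  induction L with
  | zero => simp
  | succ L ih =>
    rw [show 2 * (L + 1) = 2 * L + 1 + 1 by ring, Finset.prod_range_succ, Finset.prod_range_succ,
      ih, Finset.prod_range_succ, Finset.prod_range_succ]
    ring

/-- With `π z = i u` one has `cosh u = cos (π z) = sin (2π z) / (2 sin (π z))`. In Euler's product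
for `sin (2π z)` with `2 L` factors, those with even denominator cancel the product for `sin (π z)`,
and those with odd denominator remain. The case `u = 0` is separate because of the division. -/
theorem tendsto_prod_cosh (u : ℝ) :
    Tendsto (fun L : ℕ ↦ ∏ l ∈ Finset.range L, (1 + 4 * u ^ 2 / (Real.pi ^ 2 * (2 * l + 1) ^ 2)))
      atTop (𝓝 (Real.cosh u)) := by
  rcases eq_or_ne u 0 with rfl | hu
  · simp
  have hpi : (Real.pi : ℂ) ≠ 0 := by exact_mod_cast Real.pi_ne_zero
  have hu' : (u : ℂ) ≠ 0 := by exact_mod_cast hu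
  set z : ℂ := u * Complex.I / Real.pi with hz
  have hpz : (Real.pi : ℂ) * z = u * Complex.I := by rw [hz]; field_simp
  have hpz0 : (Real.pi : ℂ) * z ≠ 0 := by rw [hpz]; exact mul_ne_zero hu' Complex.I_ne_zero
  have hz2 : z ^ 2 = -(u ^ 2 / Real.pi ^ 2) := by
    rw [hz, div_pow, mul_pow, Complex.I_sq]; ring
  have h1 := Complex.tendsto_euler_sin_prod z
  have h2 := (Complex.tendsto_euler_sin_prod (2 * z)).comp
    (tendsto_id.const_mul_atTop' (two_pos : 0 < 2))
  have hs : Complex.sin (Real.pi * z) ≠ 0 := by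
    rw [hpz, Complex.sin_mul_I, ← Complex.ofReal_sinh]
    exact mul_ne_zero (by exact_mod_cast Real.sinh_ne_zero.2 hu) Complex.I_ne_zero
  have h3 := (h2.div h1 hs).div_const 2
  have e1 : Complex.sin (Real.pi * (2 * z)) / Complex.sin (Real.pi * z) / 2 =
      ((Real.cosh u : ℝ) : ℂ) := by
    rw [show (Real.pi : ℂ) * (2 * z) = 2 * (Real.pi * z) by ring, Complex.sin_two_mul,
      Complex.ofReal_cosh, ← Complex.cos_mul_I, ← hpz]
    field_simp
  rw [e1] at h3
  have h4 : Tendsto (fun L : ℕ ↦ ((∏ l ∈ Finset.range L,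
      (1 + 4 * u ^ 2 / (Real.pi ^ 2 * (2 * l + 1) ^ 2)) : ℝ) : ℂ)) atTop
      (𝓝 ((Real.cosh u : ℝ) : ℂ)) := by
    refine h3.congr fun L ↦ ?_
    have hne : ∏ j ∈ Finset.range L, (1 - z ^ 2 / ((j : ℂ) + 1) ^ 2) ≠ 0 := by
      refine Finset.prod_ne_zero_iff.2 fun j _ ↦ ?_
      have : (1 - z ^ 2 / ((j : ℂ) + 1) ^ 2) =
          ((1 + u ^ 2 / Real.pi ^ 2 / ((j : ℝ) + 1) ^ 2 : ℝ) : ℂ) := by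
        rw [hz2]; push_cast; ring
      rw [this]
      exact_mod_cast (by positivity : (0 : ℝ) < 1 + u ^ 2 / Real.pi ^ 2 / ((j : ℝ) + 1) ^ 2).ne'
    simp only [Function.comp_apply, id, Pi.div_apply]
    rw [prod_range_two_mul]
    have o : ∏ l ∈ Finset.range L, (1 - (2 * z) ^ 2 / (((2 * l + 1 : ℕ) : ℂ) + 1) ^ 2) =
        ∏ j ∈ Finset.range L, (1 - z ^ 2 / ((j : ℂ) + 1) ^ 2) := by
      refine Finset.prod_congr rfl fun j _ ↦ ?_
      have : (((2 * j + 1 : ℕ) : ℂ) + 1) = 2 * (j + 1) := by push_cast; ring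
      rw [this, mul_pow, mul_pow, mul_div_mul_left _ _ (by norm_num)]
    have e : ∏ l ∈ Finset.range L, (1 - (2 * z) ^ 2 / (((2 * l : ℕ) : ℂ) + 1) ^ 2) =
        ((∏ l ∈ Finset.range L,
          (1 + 4 * u ^ 2 / (Real.pi ^ 2 * (2 * l + 1) ^ 2)) : ℝ) : ℂ) := by
      rw [Complex.ofReal_prod]
      refine Finset.prod_congr rfl fun j _ ↦ ?_
      rw [mul_pow, hz2]
      push_cast
      rw [sub_eq_add_neg, ← neg_div, div_mul_eq_div_div]
      congr 2
      ring
    rw [o, e, div_eq_iff two_ne_zero, div_eq_iff (mul_ne_zero hpz0 hne)]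
    ring
  exact (Complex.continuous_re.tendsto _).comp h4


/-! The limit theorems. -/

theorem norm_exp_sub_exp_le (a b : ℝ) :
    ‖Complex.exp (a * Complex.I) - Complex.exp (b * Complex.I)‖ ≤ |a - b| := by
  have h : Complex.exp (a * Complex.I) - Complex.exp (b * Complex.I) =
      Complex.exp (b * Complex.I) * (Complex.exp (Complex.I * ((a - b : ℝ) : ℂ)) - 1) := by
    rw [mul_sub, ← Complex.exp_add, mul_one]
    congr 2
    push_cast
    ring
  rw [h, norm_mul, Complex.norm_exp_ofReal_mul_I, one_mul]
  exact Real.norm_exp_I_mul_ofReal_sub_one_le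

theorem charFun_map_real {Ω : Type*} [MeasurableSpace Ω] {μ : Measure Ω} {f : Ω → ℝ}
    (hf : AEMeasurable f μ) (t : ℝ) :
    charFun (μ.map f) t = ∫ ω, Complex.exp ((t * f ω : ℝ) * Complex.I) ∂μ := by
  rw [charFun_apply_real, integral_map hf (by fun_prop)]
  simp only [Complex.ofReal_mul]

/-- The map `s ↦ exp (i t s)` is Lipschitz with constant `|t|`, so variables on one space that are
close in `L¹` have close characteristic functions. -/
theorem norm_charFun_map_sub_le {Ω : Type*} [MeasurableSpace Ω] {μ : Measure Ω}
    [IsProbabilityMeasure μ] {f g : Ω → ℝ} (hf : AEMeasurable f μ) (hg : AEMeasurable g μ)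
    (hi : Integrable (fun ω ↦ f ω - g ω) μ) (t : ℝ) :
    ‖charFun (μ.map f) t - charFun (μ.map g) t‖ ≤ |t| * ∫ ω, |f ω - g ω| ∂μ := by
  have hint : ∀ {h : Ω → ℝ}, AEMeasurable h μ →
      Integrable (fun ω ↦ Complex.exp ((t * h ω : ℝ) * Complex.I)) μ := fun hh ↦
    Integrable.of_bound (by fun_prop) 1
      (ae_of_all _ fun ω ↦ (Complex.norm_exp_ofReal_mul_I _).le)
  rw [charFun_map_real hf, charFun_map_real hg, ← integral_sub (hint hf) (hint hg),
    ← integral_const_mul]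
  refine norm_integral_le_of_norm_le (hi.abs.const_mul _) (ae_of_all _ fun ω ↦ ?_)
  rw [← abs_mul, mul_sub]
  exact norm_exp_sub_exp_le _ _

/-- The sign and the sawtooth differ by the cocycle `2 x - 2 y`, which a cyclic sum does not see. -/
theorem cyclicU_sgnKernel_ae_eq (n : ℕ) :
    (fun x : Fin n → ℝ ↦ cyclicU sgnKernel x) =ᵐ[Measure.pi fun _ ↦ unif]
      fun x ↦ cyclicU (fun a b ↦ sawtooth (a - b)) x := by
  have h : ∀ i : Fin n, ∀ᵐ x ∂(Measure.pi fun _ : Fin n ↦ unif), x i ∈ Set.Ioo (0 : ℝ) 1 :=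
    fun i ↦ (measurePreserving_eval (fun _ : Fin n ↦ unif) i).quasiMeasurePreserving.ae
      ae_unif_mem_Ioo
  filter_upwards [ae_all_iff.2 h] with x hx
  rw [← cyclicU_add_sub (fun a b ↦ sawtooth (a - b)) fun a ↦ 2 * a]
  unfold cyclicU
  refine Finset.sum_congr rfl fun i _ ↦ Finset.sum_congr rfl fun j _ ↦ ?_
  rw [sgnKernel_eq_sawtooth (Set.Ioo_subset_Ico_self (hx i)) (Set.Ioo_subset_Ico_self (hx (i + j)))]

/-- A crude first moment bound; it later controls the change of normalization between consecutive
`n` for the bi-alternating statistic. -/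
theorem integral_abs_cyclicU_le (n : ℕ) :
    Integrable (fun x : Fin n → ℝ ↦ cyclicU sgnKernel x) (Measure.pi fun _ ↦ unif) ∧
    ∫ x : Fin n → ℝ, |cyclicU sgnKernel x| ∂(Measure.pi fun _ ↦ unif) ≤ n := by
  have hae := cyclicU_sgnKernel_ae_eq n
  let s : Fin n → Fin n → ℝ := fun i j ↦ squareWave (((j : ℕ) - (i : ℕ) : ℝ) / n)
  have hU : ∀ x : Fin n → ℝ, cyclicU (fun a b ↦ sawtooth (a - b)) x =
      ∑ i, ∑ j, if i < j then s i j * sawtooth (x i - x j) else 0 := fun x ↦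
    cyclicU_eq_sum_lt (fun a b ↦ by rw [← neg_sub b a, sawtooth_neg]) x
  have h := integral_abs_periodic_le sawtooth_periodic measurable_sawtooth abs_sawtooth_le
    integral_sawtooth s
  simp only [← hU] at h
  refine ⟨(integrable_congr hae).2 (h.1.integrable (by norm_num)), ?_⟩
  rw [integral_congr_ae (show (fun x : Fin n → ℝ ↦ |cyclicU sgnKernel x|) =ᵐ[_] _ from
    hae.fun_comp abs)]
  simp only [Function.comp_apply]
  refine h.2.trans ?_
  rw [integral_sawtooth_sq]
  have hs : ∑ i, ∑ j, (if i < j then s i j ^ 2 else 0) ≤ (n : ℝ) ^ 2 := by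
    calc _ ≤ ∑ i : Fin n, ∑ j : Fin n, (1 : ℝ) := by
          refine Finset.sum_le_sum fun i _ ↦ Finset.sum_le_sum fun j _ ↦ ?_
          split_ifs
          · exact (sq_le_one_iff_abs_le_one _).2 (abs_squareWave_le _)
          · exact zero_le_one
      _ = _ := by simp [sq]
  refine Real.sqrt_le_iff.2 ⟨by positivity, ?_⟩
  nlinarith [sq_nonneg (n : ℝ)]

theorem tendsto_truncCharFun (K : ℕ) (t : ℝ) :
    Tendsto (fun L ↦ (truncCharFun K L t : ℂ)) atTop
      (𝓝 (∏ k ∈ Finset.range K, ((1 / Real.cosh (t / (Real.pi * (k + 1))) : ℝ) : ℂ))) := by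
  rw [← Complex.ofReal_prod]
  refine (Complex.continuous_ofReal.tendsto _).comp (tendsto_finsetProd _ fun k _ ↦ ?_)
  simp only [Finset.prod_inv_distrib, one_div]
  exact (tendsto_prod_cosh _).inv₀ (Real.cosh_pos _).ne'

/-- Convergence of the characteristic functions of the normalized cyclic statistic. -/
theorem tendsto_charFun_cyclicU {t : ℝ} {c : ℂ}
    (hc : Tendsto (fun K : ℕ ↦ ∏ k ∈ Finset.range K,
      ((1 / Real.cosh (t / (Real.pi * (k + 1))) : ℝ) : ℂ)) atTop (𝓝 c)) :
    Tendsto (fun n : ℕ ↦ charFun ((Measure.pi fun _ : Fin n ↦ unif).map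
      fun x ↦ (n : ℝ)⁻¹ * cyclicU sgnKernel x) t) atTop (𝓝 c) := by
  have h1 : Tendsto (fun K ↦ |t| * √(∫ v in (0 : ℝ)..1, (sawtooth v - sawtoothSum K v) ^ 2)) atTop
      (𝓝 0) := by
    simpa using (((Real.continuous_sqrt.tendsto _).comp tendsto_sawtoothSum.2).const_mul |t|)
  have h2 : Tendsto (fun L ↦ |t| * √(∫ v in (0 : ℝ)..1, (squareWave v - squareWaveSum L v) ^ 2))
      atTop (𝓝 0) := by
    simpa using (((Real.continuous_sqrt.tendsto _).comp tendsto_squareWaveSum).const_mul |t|)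
  refine Metric.tendsto_nhds.2 fun ε hε ↦ ?_
  have hε5 : 0 < ε / 5 := by positivity
  -- The order of choice is `K`, then `L`, then `n`. The five errors are the two truncation errors,
  -- the Gaussian limit in `n`, the `cosh` product in `L`, and the product over `k` in `K`.
  obtain ⟨K, hK1, hK2⟩ := ((h1.eventually_lt_const hε5).and
    (hc.eventually (Metric.ball_mem_nhds _ hε5))).exists
  obtain ⟨L, hL1, hL2⟩ := ((h2.eventually_lt_const hε5).and
    ((tendsto_truncCharFun K t).eventually (Metric.ball_mem_nhds _ hε5))).exists
  have h3 := ((Real.continuous_sqrt.tendsto _).comp (tendsto_riemann_squareWave L)).const_mul |t|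
  filter_upwards [h3.eventually_lt_const hL1,
    (tendsto_charFun_truncU K L t).eventually (Metric.ball_mem_nhds _ hε5)] with n hn1 hn2
  have hT := integral_abs_sub_truncU_le K L (n := n)
  have hC := integral_abs_cyclicU_le n
  have hae := cyclicU_sgnKernel_ae_eq n
  rw [← charFun_map_real (hT.2.1.const_mul _).aemeasurable] at hn2
  have hd := norm_charFun_map_sub_le (hC.1.const_mul (n : ℝ)⁻¹).aemeasurable
    (hT.2.1.const_mul (n : ℝ)⁻¹).aemeasurable
    ((hC.1.const_mul (n : ℝ)⁻¹).sub (hT.2.1.const_mul (n : ℝ)⁻¹)) t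
  have hI : ∫ x : Fin n → ℝ, |(n : ℝ)⁻¹ * cyclicU sgnKernel x - (n : ℝ)⁻¹ * truncU K L x|
      ∂(Measure.pi fun _ ↦ unif) = (n : ℝ)⁻¹ *
      ∫ x : Fin n → ℝ, |cyclicU (fun a b ↦ sawtooth (a - b)) x - truncU K L x|
        ∂(Measure.pi fun _ ↦ unif) := by
    rw [← integral_const_mul]
    refine integral_congr_ae ?_
    filter_upwards [hae] with x hx
    rw [hx, ← mul_sub, abs_mul, abs_of_nonneg (by positivity : (0 : ℝ) ≤ (n : ℝ)⁻¹)]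
  rw [hI] at hd
  have hd' := hd.trans (mul_le_mul_of_nonneg_left hT.2.2 (abs_nonneg t))
  rw [mul_add] at hd'
  rw [← dist_eq_norm] at hd'
  simp only [Function.comp_apply] at hn1
  have e1 := dist_triangle _ _ _ |>.trans_lt (add_lt_add hn2 hL2)
  have e2 := dist_triangle _ _ _ |>.trans_lt (add_lt_add e1 hK2)
  have e3 := dist_triangle _ _ _ |>.trans_lt (add_lt_add_of_le_of_lt hd' e2)
  linarith

theorem map_biAlternatingU_eq_map_cyclicU {n : ℕ} (hn : Odd n) :
    (Measure.pi fun _ : Fin n ↦ unif).map (biAlternatingU sgnKernel) =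
      (Measure.pi fun _ : Fin n ↦ unif).map (cyclicU sgnKernel) := by
  rw [map_biAlternatingU, map_cyclicU, (identDistrib_writhe_biAlternatingInv hn).map_eq]

theorem measurePreserving_castSucc (m : ℕ) :
    MeasurePreserving (fun (x : Fin (m + 1) → ℝ) (i : Fin m) ↦ x i.castSucc)
      (Measure.pi fun _ ↦ unif) (Measure.pi fun _ ↦ unif) := by
  have h := measurePreserving_snd.comp
    (measurePreserving_piFinSuccAbove (fun _ : Fin (m + 1) ↦ unif) (Fin.last m))
  convert h using 1
  funext x i
  simp [Fin.init]

/-- Both statistics are realized on `m + 1` variables, the smaller one ignoring the last. The terms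
with the last variable cost `(1 + 2 √m) / (m + 1)`. The change of normalization costs at most `(1 /
m - 1 / (m + 1)) m = 1 / (m + 1)`, using for odd `m` the first moment bound of the cyclic statistic.
-/
theorem norm_charFun_biAlternatingU_sub_le {m : ℕ} (hm : Odd m) (t : ℝ) :
    ‖charFun ((Measure.pi fun _ : Fin (m + 1) ↦ unif).map
        fun x ↦ ((m + 1 : ℕ) : ℝ)⁻¹ * biAlternatingU sgnKernel x) t -
      charFun ((Measure.pi fun _ : Fin m ↦ unif).map
        fun x ↦ (m : ℝ)⁻¹ * biAlternatingU sgnKernel x) t‖ ≤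
    |t| * (((m + 1 : ℕ) : ℝ)⁻¹ * (2 + 2 * √m)) := by
  set φ : (Fin (m + 1) → ℝ) → Fin m → ℝ := fun x i ↦ x i.castSucc with hφ
  have hmp : MeasurePreserving φ _ _ := measurePreserving_castSucc m
  have hB := measurable_biAlternatingU measurable_sgnKernel
  have hid : IdentDistrib (biAlternatingU sgnKernel) (cyclicU sgnKernel)
      (Measure.pi fun _ : Fin m ↦ unif) (Measure.pi fun _ : Fin m ↦ unif) :=
    ⟨(hB m).aemeasurable, (measurable_cyclicU measurable_sgnKernel m).aemeasurable,
      map_biAlternatingU_eq_map_cyclicU hm⟩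
  have hC := integral_abs_cyclicU_le m
  have hBi : Integrable (fun x ↦ biAlternatingU sgnKernel (φ x)) (Measure.pi fun _ ↦ unif) :=
    hmp.integrable_comp_of_integrable (hid.integrable_iff.2 hC.1)
  have hBl : ∫ x, |biAlternatingU sgnKernel (φ x)| ∂(Measure.pi fun _ ↦ unif) ≤ m := by
    have e1 := (hid.comp measurable_norm).integral_eq
    have e2 := integral_map (μ := Measure.pi fun _ : Fin (m + 1) ↦ unif) (φ := φ)
      (f := fun y ↦ |biAlternatingU sgnKernel y|) hmp.measurable.aemeasurable
      (hB m).norm.aestronglyMeasurable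
    rw [hmp.map_eq] at e2
    rw [← e2]
    exact e1.trans_le hC.2
  let l : (Fin (m + 1) → ℝ) → ℝ := fun x ↦ ∑ i : Fin m,
    (-1 : ℝ) ^ ((i : ℕ) + m) * sgnKernel (x i.castSucc) (x (Fin.last m))
  have hl : Integrable l (Measure.pi fun _ ↦ unif) := by
    refine integrable_finsetSum _ fun i _ ↦ Integrable.const_mul ?_ _
    exact Integrable.of_bound (measurable_sgnKernel.comp (show Measurable
      fun x : Fin (m + 1) → ℝ ↦ (x i.castSucc, x (Fin.last m)) by fun_prop)).aestronglyMeasurable 1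
      (ae_of_all _ fun x ↦ abs_sgnKernel_le _ _)
  have hmap : (Measure.pi fun _ : Fin m ↦ unif).map
        (fun x ↦ (m : ℝ)⁻¹ * biAlternatingU sgnKernel x) =
      (Measure.pi fun _ : Fin (m + 1) ↦ unif).map
        fun x ↦ (m : ℝ)⁻¹ * biAlternatingU sgnKernel (φ x) := by
    rw [← hmp.map_eq, Measure.map_map ((hB m).const_mul _) hmp.measurable]
    rfl
  have hm0 : (0 : ℝ) < m := by exact_mod_cast hm.pos
  have key : ∀ x, ((m + 1 : ℕ) : ℝ)⁻¹ * biAlternatingU sgnKernel x -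
      (m : ℝ)⁻¹ * biAlternatingU sgnKernel (φ x) =
      ((m + 1 : ℕ) : ℝ)⁻¹ * l x - ((m : ℝ)⁻¹ - ((m + 1 : ℕ) : ℝ)⁻¹) *
        biAlternatingU sgnKernel (φ x) := by
    intro x
    rw [biAlternatingU_castSucc]
    ring
  have hdi : Integrable (fun x ↦ ((m + 1 : ℕ) : ℝ)⁻¹ * l x -
      ((m : ℝ)⁻¹ - ((m + 1 : ℕ) : ℝ)⁻¹) * biAlternatingU sgnKernel (φ x))
      (Measure.pi fun _ ↦ unif) := (hl.const_mul _).sub (hBi.const_mul _)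
  have hpos : 0 ≤ (m : ℝ)⁻¹ - ((m + 1 : ℕ) : ℝ)⁻¹ := by
    rw [sub_nonneg]
    exact inv_anti₀ hm0 (by push_cast; linarith)
  rw [hmap]
  refine (norm_charFun_map_sub_le ((hB _).const_mul _).aemeasurable
    (((hB m).comp hmp.measurable).const_mul _).aemeasurable
    (hdi.congr (ae_of_all _ fun x ↦ (key x).symm)) t).trans (mul_le_mul_of_nonneg_left ?_ (abs_nonneg t))
  refine (integral_congr_ae (ae_of_all _ fun x ↦ congrArg abs (key x))).trans_le ?_
  calc _ ≤ ∫ x, (((m + 1 : ℕ) : ℝ)⁻¹ * |l x| + ((m : ℝ)⁻¹ - ((m + 1 : ℕ) : ℝ)⁻¹) *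
        |biAlternatingU sgnKernel (φ x)|) ∂(Measure.pi fun _ ↦ unif) := by
        refine integral_mono hdi.abs ((hl.abs.const_mul _).add (hBi.abs.const_mul _)) fun x ↦ ?_
        refine (abs_sub _ _).trans (le_of_eq ?_)
        rw [abs_mul, abs_mul, abs_of_nonneg hpos, abs_of_nonneg (by positivity)]
    _ = ((m + 1 : ℕ) : ℝ)⁻¹ * ∫ x, |l x| ∂(Measure.pi fun _ ↦ unif) +
        ((m : ℝ)⁻¹ - ((m + 1 : ℕ) : ℝ)⁻¹) *
          ∫ x, |biAlternatingU sgnKernel (φ x)| ∂(Measure.pi fun _ ↦ unif) := by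
        rw [integral_add (hl.abs.const_mul _) (hBi.abs.const_mul _), integral_const_mul,
          integral_const_mul]
    _ ≤ ((m + 1 : ℕ) : ℝ)⁻¹ * (1 + 2 * √m) + ((m : ℝ)⁻¹ - ((m + 1 : ℕ) : ℝ)⁻¹) * m :=
        add_le_add (mul_le_mul_of_nonneg_left (integral_abs_last_le m) (by positivity))
          (mul_le_mul_of_nonneg_left hBl hpos)
    _ = _ := by
        push_cast
        field_simp
        ring

theorem tendsto_charFun_biAlternatingU {t : ℝ} {c : ℂ}
    (hc : Tendsto (fun n : ℕ ↦ charFun ((Measure.pi fun _ : Fin n ↦ unif).map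
      fun x ↦ (n : ℝ)⁻¹ * cyclicU sgnKernel x) t) atTop (𝓝 c)) :
    Tendsto (fun n : ℕ ↦ charFun ((Measure.pi fun _ : Fin n ↦ unif).map
      fun x ↦ (n : ℝ)⁻¹ * biAlternatingU sgnKernel x) t) atTop (𝓝 c) := by
  set d : ℕ → ℂ := fun n ↦ charFun ((Measure.pi fun _ : Fin n ↦ unif).map
      fun x ↦ (n : ℝ)⁻¹ * cyclicU sgnKernel x) t
  set b : ℕ → ℂ := fun n ↦ charFun ((Measure.pi fun _ : Fin n ↦ unif).map
      fun x ↦ (n : ℝ)⁻¹ * biAlternatingU sgnKernel x) t with hb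
  have hodd : ∀ n, Odd n → b n = d n := by
    intro n hn
    have h := congrArg (Measure.map fun y ↦ (n : ℝ)⁻¹ * y) (map_biAlternatingU_eq_map_cyclicU hn)
    rw [Measure.map_map (measurable_const_mul _) (measurable_biAlternatingU measurable_sgnKernel n),
      Measure.map_map (measurable_const_mul _) (measurable_cyclicU measurable_sgnKernel n)] at h
    exact congrArg (fun ν ↦ charFun ν t) h
  -- The nearest odd number not above `n`. The value at `n = 0` is a truncated subtraction, excluded
  -- below by `1 ≤ n`.
  let e : ℕ → ℕ := fun n ↦ if Odd n then n else n - 1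
  have he : Tendsto e atTop atTop := by
    refine tendsto_atTop_mono (fun n ↦ ?_) (tendsto_sub_atTop_nat 1)
    simp only [e]
    split_ifs <;> omega
  have hz : Tendsto (fun n : ℕ ↦ |t| * ((n : ℝ)⁻¹ * (2 + 2 * √n))) atTop (𝓝 0) := by
    have h1 : Tendsto (fun n : ℕ ↦ (n : ℝ)⁻¹) atTop (𝓝 0) := tendsto_inv_atTop_nhds_zero_nat
    have h2 := (Real.continuous_sqrt.tendsto _).comp h1
    have h3 := ((h1.mul_const 2).add (h2.const_mul 2)).const_mul |t|
    rw [Real.sqrt_zero, zero_mul, mul_zero, add_zero, mul_zero] at h3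
    refine h3.congr fun n ↦ ?_
    have : √((n : ℝ)⁻¹) = (n : ℝ)⁻¹ * √n := by
      rw [Real.sqrt_inv, inv_mul_eq_div, Real.sqrt_div_self', one_div]
    rw [Function.comp_apply, this]
    ring
  have hdiff : Tendsto (fun n ↦ b n - d (e n)) atTop (𝓝 0) := by
    refine squeeze_zero_norm' ?_ hz
    filter_upwards [eventually_ge_atTop 1] with n hn
    by_cases ho : Odd n
    · simp only [e, if_pos ho, hodd n ho, sub_self, norm_zero]
      positivity
    · obtain ⟨m, rfl⟩ : ∃ m, n = m + 1 := ⟨n - 1, by omega⟩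
      have hm : Odd m := by
        rcases Nat.even_or_odd m with h | h
        · exact absurd h.add_one ho
        · exact h
      simp only [e, if_neg ho, Nat.add_sub_cancel, ← hodd m hm]
      refine (norm_charFun_biAlternatingU_sub_le hm t).trans ?_
      gcongr
      exact Nat.le_succ m
  simpa using hdiff.add (hc.comp he)

theorem tendstoInDistribution_of_charFun {Ω : ℕ → Type*} [∀ n, MeasurableSpace (Ω n)]
    {μ : ∀ n, Measure (Ω n)} [∀ n, IsProbabilityMeasure (μ n)] {T : ∀ n, Ω n → ℝ}
    (hT : ∀ n, AEMeasurable (T n) (μ n)) {Ω' : Type*} [MeasurableSpace Ω'] {P : Measure Ω'}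
    [IsProbabilityMeasure P] {W : Ω' → ℝ} (hW : AEMeasurable W P)
    (h : ∀ t, Tendsto (fun n ↦ charFun ((μ n).map (T n)) t) atTop (𝓝 (charFun (P.map W) t))) :
    TendstoInDistribution T atTop W μ P :=
  ⟨hT, hW, ProbabilityMeasure.tendsto_of_tendsto_charFun h⟩

theorem map_const_mul_congr {Ω Ω' : Type*} [MeasurableSpace Ω] [MeasurableSpace Ω']
    {μ : Measure Ω} {ν : Measure Ω'} {f : Ω → ℝ} {g : Ω' → ℝ} (hf : AEMeasurable f μ)
    (hg : AEMeasurable g ν) (h : μ.map f = ν.map g) (a : ℝ) :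
    μ.map (fun ω ↦ a * f ω) = ν.map fun ω ↦ a * g ω := by
  have := congrArg (Measure.map fun y ↦ a * y) h
  rwa [AEMeasurable.map_map_of_aemeasurable (measurable_const_mul _).aemeasurable hf,
    AEMeasurable.map_map_of_aemeasurable (measurable_const_mul _).aemeasurable hg] at this

end CyclicU

/-! ### The main theorem. -/

theorem mainTheorem11 :
    -- The nonzero eigenvalues of `T_{f₁₂}` are `i / (π k)`, `k ≠ 0`, and they are simple.
    (∀ z : ℂ, z ≠ 0 → (CyclicU.writheOperator.HasEigenvalue z ↔
      ∃ k : ℤ, k ≠ 0 ∧ z = Complex.I / (Real.pi * k))) ∧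
    (∀ k : ℤ, k ≠ 0 → Module.finrank ℂ
      (CyclicU.writheOperator.eigenspace (Complex.I / (Real.pi * k))) = 1) ∧
    -- The stochastic area distribution exists.
    (∃ γ : Measure ℝ, IsProbabilityMeasure γ ∧ CyclicU.IsStochasticAreaLaw γ) ∧
    -- For uniform i.i.d. variables the statistics have the laws of those of a random permutation.
    (∀ (Ω : Type*) [MeasurableSpace Ω] (P : Measure Ω) [IsProbabilityMeasure P]
      (X : ℕ → Ω → ℝ), (∀ i, HasLaw (X i) CyclicU.unif P) → iIndepFun X P → ∀ n : ℕ,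
        IdentDistrib (fun ω ↦ CyclicU.cyclicU CyclicU.sgnKernel fun i : Fin n ↦ X i ω)
          (CyclicU.writhe (n := n)) P (CyclicU.uniformPerm n) ∧
        IdentDistrib (fun ω ↦ CyclicU.biAlternatingU CyclicU.sgnKernel fun i : Fin n ↦ X i ω)
          (CyclicU.biAlternatingInv (n := n)) P (CyclicU.uniformPerm n)) ∧
    -- For odd `n`, writhe and bi-alternating inversion number are equal in distribution.
    (∀ n : ℕ, Odd n → IdentDistrib (CyclicU.writhe (n := n)) (CyclicU.biAlternatingInv (n := n))
      (CyclicU.uniformPerm n) (CyclicU.uniformPerm n)) ∧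
    -- The limit theorems.
    (∀ (Ω' : Type*) [MeasurableSpace Ω'] (P' : Measure Ω') [IsProbabilityMeasure P']
      (η : ℕ → Ω' → ℝ), (∀ k, AEMeasurable (η k) P') →
      (∀ k, CyclicU.IsStochasticAreaLaw (P'.map (η k))) → iIndepFun η P' →
      ∃ W : Ω' → ℝ,
        (∀ᵐ ω ∂P', Tendsto
          (fun K : ℕ ↦ ∑ k ∈ Finset.Icc 1 K, 1 / (Real.pi * (k : ℝ)) * η k ω) atTop
          (𝓝 (W ω))) ∧
        (∀ (Ω : Type*) [MeasurableSpace Ω] (P : Measure Ω) [IsProbabilityMeasure P]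
          (X : ℕ → Ω → ℝ), (∀ i, HasLaw (X i) CyclicU.unif P) → iIndepFun X P →
          TendstoInDistribution (fun (n : ℕ) ω ↦
            (n : ℝ)⁻¹ * CyclicU.cyclicU CyclicU.sgnKernel fun i : Fin n ↦ X i ω)
            atTop W (fun _ ↦ P) P') ∧
        TendstoInDistribution
          (fun (n : ℕ) (σ : Equiv.Perm (Fin n)) ↦ (n : ℝ)⁻¹ * CyclicU.writhe σ)
          atTop W CyclicU.uniformPerm P' ∧
        TendstoInDistribution
          (fun (n : ℕ) (σ : Equiv.Perm (Fin n)) ↦ (n : ℝ)⁻¹ * CyclicU.biAlternatingInv σ)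
          atTop W CyclicU.uniformPerm P') := by
  refine ⟨fun z hz ↦ CyclicU.hasEigenvalue_writheOperator_iff hz,
    fun k hk ↦ CyclicU.finrank_eigenspace_writheOperator hk,
    ⟨CyclicU.areaLaw, CyclicU.isProbabilityMeasure_areaLaw, CyclicU.isStochasticAreaLaw_areaLaw⟩,
    fun Ω _ P _ X hX hi n ↦ CyclicU.identDistrib_iid hX hi n,
    fun n hn ↦ CyclicU.identDistrib_writhe_biAlternatingInv hn,
    fun Ω' _ P' _ η hm hlaw hi ↦ ?_⟩
  obtain ⟨W, hW, hconv, hchar⟩ := CyclicU.exists_area_series hm hlaw hi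
  -- The limits are established under the product measure on `Fin n → ℝ`; equality of laws then
  -- transfers them to the given i.i.d. sequence and to permutations.
  have hC := fun t ↦ CyclicU.tendsto_charFun_cyclicU (hchar t)
  have hB := fun t ↦ CyclicU.tendsto_charFun_biAlternatingU (hC t)
  have hwrithe : ∀ n : ℕ, (CyclicU.uniformPerm n).map (fun σ ↦ (n : ℝ)⁻¹ * CyclicU.writhe σ) =
      (Measure.pi fun _ : Fin n ↦ CyclicU.unif).map
        fun x ↦ (n : ℝ)⁻¹ * CyclicU.cyclicU CyclicU.sgnKernel x := fun n ↦
    CyclicU.map_const_mul_congr (CyclicU.measurable_perm _).aemeasurable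
      (CyclicU.measurable_cyclicU CyclicU.measurable_sgnKernel n).aemeasurable
      (CyclicU.map_cyclicU n).symm _
  refine ⟨W, hconv, fun Ω _ P _ X hX hi' ↦ ?_, ?_, ?_⟩
  · have hid := fun n ↦ (CyclicU.identDistrib_iid hX hi' n).1
    refine CyclicU.tendstoInDistribution_of_charFun
      (fun n ↦ (hid n).aemeasurable_fst.const_mul _) hW fun t ↦ ?_
    refine (hC t).congr fun n ↦ ?_
    rw [← hwrithe, CyclicU.map_const_mul_congr (hid n).aemeasurable_fst (hid n).aemeasurable_snd
      (hid n).map_eq]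
  · refine CyclicU.tendstoInDistribution_of_charFun
      (fun n ↦ (CyclicU.measurable_perm _).aemeasurable) hW fun t ↦ ?_
    simpa only [hwrithe] using hC t
  · refine CyclicU.tendstoInDistribution_of_charFun
      (fun n ↦ (CyclicU.measurable_perm _).aemeasurable) hW fun t ↦ ?_
    refine (hB t).congr fun n ↦ ?_
    rw [CyclicU.map_const_mul_congr
      (CyclicU.measurable_biAlternatingU CyclicU.measurable_sgnKernel n).aemeasurable
      (CyclicU.measurable_perm _).aemeasurable (CyclicU.map_biAlternatingU n)]
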